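/- **Setting.** Let $n\ge 1$ and let $\bar A\in\{0,1\}^{n\times n}$ be the zero/nonzero pattern of the dynamics of $x[k+1]=Ax[k]+Bu[k]$, $y[k]=Cx[k]$, $u[k]=Ky[k]$. A collection $\iota=(\iota_1,\dots,\iota_p)$ of state indices gives dedicated actuators, with pattern $\bar B(\iota)\in\{0,1\}^{n\times p}$ whose $i$-th column is $e_{\iota_i}$; a collection $\gamma=(\gamma_1,\dots,\gamma_m)$ gives dedicated sensors, with pattern $\bar C(\gamma)\in\{0,1\}^{m\times n}$ whose $j$-th row is $e_{\gamma_j}^{\mathsf T}$. A structural system is structurally controllable (observable) if almost all of its real realizations, with respect to Lebesgue measure on the nonzero entries, are controllable (observable). For a set $\mathcal K$ of links (sensor, actuator), the information pattern $\bar K(\mathcal K)\in\{0,1\}^{p\times m}$ has $\bar K_{ij}=1$ iff $(j,i)\in\mathcal K$. The fixed modes of $(A,B,C)$ with respect to $\bar K$ are the complex numbers that are eigenvalues of $A+BKC$ for every real $K$ with $K_{ij}=0$ whenever $\bar K_{ij}=0$. The structural system has (has no) structurally fixed modes with respect to $\bar K$ if almost all realizations $(A,B,C)$ have a (have no) fixed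 mode. **Assumptions.** (A1) The bipartite graph with two copies of the state vertices as its sides and an edge $(x_i,x_j)$ whenever $\bar A_{ji}=1$ has a perfect matching. Moreover $\iota$ and $\gamma$ are collections with the minimum number of elements such that $(\bar A,\bar B(\iota))$ is structurally controllable and $(\bar A,\bar C(\gamma))$ is structurally observable, respectively. **Procedure 1.** Let $\mathcal B$ be the bipartite graph between actuators and sensors with an edge $(i,j)$ if there is a path from actuator $i$ to sensor $j$ in the system digraph $\mathcal D(\bar A,\bar B(\iota),\bar C(\gamma))$. Choose a maximum matching $M^*$ of $\mathcal B$ and an enumeration $(i_1,j_1),\dots,(i_k,j_k)$ of it. Let $\mathcal K$ be the sequential pairing, which consists of the links from sensor $j_{l-1}$ to actuator $i_l$ for $l=2,\dots,k$ and the link from sensor $j_k$ to actuator $i_1$. If $p\le m$, let $\mathcal K'$ contain exactly one link from each sensor unmatched by $M^*$ and no link from a matched sensor, with the end points chosen so that each actuator unmatched by $M^*$ receives at least one of these links. If $p>m$, exchange the roles: $\mathcal K'$ contains exactly one link to each unmatched actuator and no link to a matched actuator, and each unmatched sensor emits at least one of these links. The result is $\mathcal K^*=\mathcal K\cup\mathcal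 K'$. **Lemma 1.** (i) Under these assumptions, for every result $\mathcal K^*$ of Procedure 1, $\bar K(\mathcal K^*)$ is a sparsest information pattern for which $(\bar A,\bar B(\iota),\bar C(\gamma))$ has no structurally fixed modes: it has none with respect to $\bar K(\mathcal K^*)$, and it has structurally fixed modes with respect to each pattern in $\{0,1\}^{p\times m}$ with fewer nonzero entries. (ii) Procedure 1 can be implemented in time $\mathcal O\big(\max\{|\mathcal V|+|\mathcal E|,(p+m)^{5/2}\}\big)$, where $\mathcal V$ and $\mathcal E$ are the vertex and edge sets of $\mathcal D(\bar A,\bar B(\iota),\bar C(\gamma))$: there are a constant $\kappa$ and one program of a random access machine that, for all data as above, given $n,p,m$, the list of edges of $\mathcal D(\bar A)$ in any order, $\iota$ and $\gamma$, halts after at most $\kappa\max\{|\mathcal V|+|\mathcal E|,(p+m)^{5/2}\}$ steps with the list of the links of some result $\mathcal K^*$ of Procedure 1 in its memory. The machine stores natural numbers of arbitrary size in its registers and memory cells; its unit-cost instructions are loading constants, addition, truncated subtraction, bitwise and/or, halving with rounding down, indirect load and store, and jump on zero (there is no multiplication). -/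

import Mathlib

noncomputable section

/-! ### Structural patterns, realizations and fixed modes -/

/-- A zero / nonzero pattern: a binary matrix. -/
abbrev Pattern (r s : ℕ) : Type := Matrix (Fin r) (Fin s) Bool

/-- The free parameters of a pattern: one real number for each nonzero position. -/
abbrev Pattern.Params {r s : ℕ} (P : Pattern r s) : Type :=
  {e : Fin r × Fin s // P e.1 e.2 = true} → ℝ

/-- The real matrix with pattern `P` and the given parameters. -/
def Pattern.realize {r s : ℕ} (P : Pattern r s) (θ : P.Params) : Matrix (Fin r) (Fin s) ℝ :=
  fun i j => if h : P i j = true then θ ⟨(i, j), h⟩ else 0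

/-- The number of nonzero entries of a pattern. -/
def Pattern.nnz {r s : ℕ} (P : Pattern r s) : ℕ :=
  (Finset.univ.filter fun e : Fin r × Fin s => P e.1 e.2 = true).card

/-- Kalman controllability of `x[k+1] = A x[k] + B u[k]`: the matrix
`[B, A B, …, A ^ (n - 1) B]` has rank `n`. -/
def IsControllable {n p : ℕ} (A : Matrix (Fin n) (Fin n) ℝ) (B : Matrix (Fin n) (Fin p) ℝ) :
    Prop :=
  Matrix.rank (fun (i : Fin n) (e : Fin n × Fin p) => (A ^ (e.1 : ℕ) * B) i e.2 :
    Matrix (Fin n) (Fin n × Fin p) ℝ) = n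

/-- Kalman observability of `x[k+1] = A x[k]`, `y[k] = C x[k]`: the matrix with the block rows
`C, C A, …, C A ^ (n - 1)` has rank `n`. -/
def IsObservable {n m : ℕ} (A : Matrix (Fin n) (Fin n) ℝ) (C : Matrix (Fin m) (Fin n) ℝ) :
    Prop :=
  Matrix.rank (fun (e : Fin n × Fin m) (i : Fin n) => (C * A ^ (e.1 : ℕ)) e.2 i :
    Matrix (Fin n × Fin m) (Fin n) ℝ) = n

/-- Almost all realizations (for Lebesgue measure on the free parameters) are controllable. -/
def StructurallyControllable {n p : ℕ} (A : Pattern n n) (B : Pattern n p) : Prop :=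
  ∀ᵐ θ : A.Params × B.Params, IsControllable (A.realize θ.1) (B.realize θ.2)

/-- Almost all realizations are observable. -/
def StructurallyObservable {n m : ℕ} (A : Pattern n n) (C : Pattern m n) : Prop :=
  ∀ᵐ θ : A.Params × C.Params, IsObservable (A.realize θ.1) (C.realize θ.2)

/-- The fixed modes of `(A, B, C)` with respect to the information pattern `K`: the complex
numbers that are eigenvalues of `A + B G C` for all real gains `G` vanishing where `K` does. -/
def fixedModes {n p m : ℕ} (A : Matrix (Fin n) (Fin n) ℝ) (B : Matrix (Fin n) (Fin p) ℝ)
    (C : Matrix (Fin m) (Fin n) ℝ) (K : Pattern p m) : Set ℂ :=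
  {z | ∀ G : Matrix (Fin p) (Fin m) ℝ, (∀ i j, K i j = false → G i j = 0) →
    z ∈ spectrum ℂ ((A + B * G * C).map (algebraMap ℝ ℂ))}

/-- Almost all realizations of the structural system have a fixed mode. -/
def HasStructurallyFixedModes {n p m : ℕ} (A : Pattern n n) (B : Pattern n p) (C : Pattern m n)
    (K : Pattern p m) : Prop :=
  ∀ᵐ θ : A.Params × B.Params × C.Params,
    fixedModes (A.realize θ.1) (B.realize θ.2.1) (C.realize θ.2.2) K ≠ ∅

/-- Almost all realizations of the structural system have no fixed mode. -/
def NoStructurallyFixedModes {n p m : ℕ} (A : Pattern n n) (B : Pattern n p) (C : Pattern m n)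
    (K : Pattern p m) : Prop :=
  ∀ᵐ θ : A.Params × B.Params × C.Params,
    fixedModes (A.realize θ.1) (B.realize θ.2.1) (C.realize θ.2.2) K = ∅

/-- `K` is a sparsest information pattern without structurally fixed modes: generically there is
no fixed mode, and each pattern with fewer links generically has one. -/
def IsSparsestPattern {n p m : ℕ} (A : Pattern n n) (B : Pattern n p) (C : Pattern m n)
    (K : Pattern p m) : Prop :=
  NoStructurallyFixedModes A B C K ∧
    ∀ K' : Pattern p m, K'.nnz < K.nnz → HasStructurallyFixedModes A B C K'

/-! ### Dedicated actuators and sensors -/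

/-- Actuator `j` acts on the single state variable `b j`. -/
def actuatorPattern {n p : ℕ} (b : Fin p → Fin n) : Pattern n p := fun i j => decide (b j = i)

/-- Sensor `j` measures the single state variable `c j`. -/
def sensorPattern {n m : ℕ} (c : Fin m → Fin n) : Pattern m n := fun j i => decide (c j = i)

/-- A minimum collection of dedicated actuators ensuring structural controllability. -/
def IsMinActuation {n p : ℕ} (A : Pattern n n) (b : Fin p → Fin n) : Prop :=
  StructurallyControllable A (actuatorPattern b) ∧
    ∀ (p' : ℕ) (b' : Fin p' → Fin n), StructurallyControllable A (actuatorPattern b') → p ≤ p'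

/-- A minimum collection of dedicated sensors ensuring structural observability. -/
def IsMinSensing {n m : ℕ} (A : Pattern n n) (c : Fin m → Fin n) : Prop :=
  StructurallyObservable A (sensorPattern c) ∧
    ∀ (m' : ℕ) (c' : Fin m' → Fin n), StructurallyObservable A (sensorPattern c') → m ≤ m'

/-! ### The system digraph -/

/-- Vertices of the system digraph: state, input and output vertices. -/
abbrev SysVertex (n p m : ℕ) : Type := Fin n ⊕ Fin p ⊕ Fin m

/-- Edges of the system digraph: `x i → x j` if `A j i ≠ 0`, `u j → x i` if `B i j ≠ 0`, and
`x i → y j` if `C j i ≠ 0`. -/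
def SysEdge {n p m : ℕ} (A : Pattern n n) (B : Pattern n p) (C : Pattern m n) :
    SysVertex n p m → SysVertex n p m → Prop
  | .inl i, .inl j => A j i = true
  | .inr (.inl j), .inl i => B i j = true
  | .inl i, .inr (.inr j) => C j i = true
  | _, _ => False

/-- The number of vertices of the system digraph. -/
def numVertices (n p m : ℕ) : ℕ := Nat.card (SysVertex n p m)

/-- The number of edges of the system digraph. -/
def numEdges {n p m : ℕ} (A : Pattern n n) (B : Pattern n p) (C : Pattern m n) : ℕ :=
  Set.ncard {e : SysVertex n p m × SysVertex n p m | SysEdge A B C e.1 e.2}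

/-- There is a path from dedicated actuator `i` to dedicated sensor `j`. -/
def Reaches {n p m : ℕ} (A : Pattern n n) (b : Fin p → Fin n) (c : Fin m → Fin n)
    (i : Fin p) (j : Fin m) : Prop :=
  Relation.ReflTransGen (SysEdge A (actuatorPattern b) (sensorPattern c))
    (.inr (.inl i)) (.inr (.inr j))

/-! ### Matchings of bipartite graphs -/

/-- A matching of the bipartite graph with edge relation `R`: edges, no two sharing a vertex. -/
def IsBipMatching {α β : Type} (R : α → β → Prop) (M : Finset (α × β)) : Prop :=
  (∀ e ∈ M, R e.1 e.2) ∧ ∀ e ∈ M, ∀ e' ∈ M, (e.1 = e'.1 ∨ e.2 = e'.2) → e = e'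

/-- A matching with the largest number of edges. -/
def IsMaxBipMatching {α β : Type} (R : α → β → Prop) (M : Finset (α × β)) : Prop :=
  IsBipMatching R M ∧ ∀ M' : Finset (α × β), IsBipMatching R M' → M'.card ≤ M.card

/-- The left vertex `a` belongs to an edge of `M`. -/
def LeftMatched {α β : Type} (M : Finset (α × β)) (a : α) : Prop := ∃ b, (a, b) ∈ M

/-- The right vertex `b` belongs to an edge of `M`. -/
def RightMatched {α β : Type} (M : Finset (α × β)) (b : β) : Prop := ∃ a, (a, b) ∈ M

/-- The state bipartite graph, with an edge `(x i, x j)` if `A j i ≠ 0`, has a perfect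
matching. -/
def HasPerfectStateMatching {n : ℕ} (A : Pattern n n) : Prop :=
  ∃ M : Finset (Fin n × Fin n), IsBipMatching (fun i j => A j i = true) M ∧
    (∀ i, LeftMatched M i) ∧ ∀ j, RightMatched M j

/-! ### The design procedure

A communication link is a pair `(sensor, actuator)`. -/

/-- The information pattern of a set of links. -/
def linkPattern {p m : ℕ} (L : Finset (Fin m × Fin p)) : Pattern p m :=
  fun i j => decide ((j, i) ∈ L)

/-- `L` is a sequential pairing induced by `M`: for some enumeration `(i₁, j₁), …, (iₖ, jₖ)` of
`M` without repetition, `L` has exactly the links from sensor `jₗ₋₁` to actuator `iₗ`,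
`l = 2, …, k`, and from sensor `jₖ` to actuator `i₁`. -/
def IsSequentialPairing {p m : ℕ} (M : Finset (Fin p × Fin m)) (L : Finset (Fin m × Fin p)) :
    Prop :=
  ∃ (k : ℕ) (e : Fin k → Fin p × Fin m), Function.Injective e ∧
    Finset.univ.image e = M ∧
    L = Finset.univ.image fun t : Fin k => ((e t).2, (e (finRotate k t)).1)

/-- The extra links. If there are at most as many actuators as sensors, each unmatched sensor
gets exactly one link, matched sensors get none, and each unmatched actuator is the end of some
of these links. If there are more actuators than sensors, the roles are exchanged. -/
def IsExtraLinks {p m : ℕ} (M : Finset (Fin p × Fin m)) (L : Finset (Fin m × Fin p)) : Prop :=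
  (p ≤ m ∧ (∀ j, ¬ RightMatched M j → ∃! i, (j, i) ∈ L) ∧
    (∀ j i, (j, i) ∈ L → ¬ RightMatched M j) ∧
    ∀ i, ¬ LeftMatched M i → ∃ j, (j, i) ∈ L) ∨
  (m < p ∧ (∀ i, ¬ LeftMatched M i → ∃! j, (j, i) ∈ L) ∧
    (∀ j i, (j, i) ∈ L → ¬ LeftMatched M i) ∧
    ∀ j, ¬ RightMatched M j → ∃ i, (j, i) ∈ L)

/-- `L` is a possible result of the procedure: the union of a sequential pairing induced by a
maximum matching of the bipartite graph `Reaches` and of extra links for this matching. -/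
def IsProcedureResult {n p m : ℕ} (A : Pattern n n) (b : Fin p → Fin n) (c : Fin m → Fin n)
    (L : Finset (Fin m × Fin p)) : Prop :=
  ∃ (M : Finset (Fin p × Fin m)) (L₁ L₂ : Finset (Fin m × Fin p)),
    IsMaxBipMatching (Reaches A b c) M ∧ IsSequentialPairing M L₁ ∧ IsExtraLinks M L₂ ∧
    L = L₁ ∪ L₂

end

/-! ### A random access machine with unit-cost instructions

The machine has registers and a memory, all holding natural numbers. There is no multiplication,
so a step lengthens the largest number by at most one bit. -/

/-- Instructions; `d`, `a`, `b` are register numbers and `l` is a program position. -/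
inductive RamInstr where
  /-- `R[d] := v` -/
  | const (d v : ℕ)
  /-- `R[d] := R[a] + R[b]` -/
  | add (d a b : ℕ)
  /-- `R[d] := max (R[a] - R[b]) 0` -/
  | sub (d a b : ℕ)
  /-- `R[d] :=` bitwise conjunction of `R[a]` and `R[b]` -/
  | and (d a b : ℕ)
  /-- `R[d] :=` bitwise disjunction of `R[a]` and `R[b]` -/
  | or (d a b : ℕ)
  /-- `R[d] :=` integer part of `R[a] / 2` -/
  | half (d a : ℕ)
  /-- `R[d] := MEM[R[a]]` -/
  | load (d a : ℕ)
  /-- `MEM[R[a]] := R[b]` -/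
  | store (a b : ℕ)
  /-- continue at position `l` if `R[a] = 0` -/
  | jumpZero (a l : ℕ)

/-- A program is a finite list of instructions. -/
abbrev RamProgram : Type := List RamInstr

/-- A machine state: program position, registers, memory. -/
structure RamState where
  pc : ℕ
  reg : ℕ → ℕ
  mem : ℕ → ℕ

/-- Write `v` to register `d` and go to the next instruction. -/
def RamState.setReg (s : RamState) (d v : ℕ) : RamState :=
  ⟨s.pc + 1, Function.update s.reg d v, s.mem⟩

/-- The effect of one instruction. -/
def RamInstr.exec (s : RamState) : RamInstr → RamState
  | .const d v => s.setReg d v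
  | .add d a b => s.setReg d (s.reg a + s.reg b)
  | .sub d a b => s.setReg d (s.reg a - s.reg b)
  | .and d a b => s.setReg d (s.reg a &&& s.reg b)
  | .or d a b => s.setReg d (s.reg a ||| s.reg b)
  | .half d a => s.setReg d (s.reg a / 2)
  | .load d a => s.setReg d (s.mem (s.reg a))
  | .store a b => ⟨s.pc + 1, s.reg, Function.update s.mem (s.reg a) (s.reg b)⟩
  | .jumpZero a l => if s.reg a = 0 then ⟨l, s.reg, s.mem⟩ else ⟨s.pc + 1, s.reg, s.mem⟩

/-- One step of the machine; it stays where it is once the position is outside the program. -/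
def RamProgram.step (P : RamProgram) (s : RamState) : RamState :=
  match P[s.pc]? with
  | some q => q.exec s
  | none => s

/-- The machine has halted. -/
def RamState.Halted (P : RamProgram) (s : RamState) : Prop := P.length ≤ s.pc

/-- Initial state: all registers are zero, the memory holds the input, followed by zeros. -/
def RamState.init (x : List ℕ) : RamState := ⟨0, fun _ => 0, fun a => x.getD a 0⟩

/-- `E` lists the edges `(i, j)`, meaning `x i → x j`, of the state digraph without repetition,
in any order. -/
def IsEdgeList {n : ℕ} (A : Pattern n n) (E : List (Fin n × Fin n)) : Prop :=
  E.Nodup ∧ ∀ i j, (i, j) ∈ E ↔ A j i = true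

/-- The input: the numbers of states, actuators, sensors and state edges, the state edges, the
actuated state of each actuator, and the measured state of each sensor. -/
def encodeInput {n p m : ℕ} (E : List (Fin n × Fin n)) (b : Fin p → Fin n) (c : Fin m → Fin n) :
    List ℕ :=
  [n, p, m, E.length] ++ E.flatMap (fun e => [(e.1 : ℕ), (e.2 : ℕ)]) ++
    List.ofFn (fun i => (b i : ℕ)) ++ List.ofFn (fun j => (c j : ℕ))

/-- The memory holds the number of links in cell `0`, and then the links of `L`, each one once,
as pairs of a sensor number and an actuator number. -/
def HoldsLinks {p m : ℕ} (mem : ℕ → ℕ) (L : Finset (Fin m × Fin p)) : Prop :=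
  ∃ l : List (Fin m × Fin p), l.Nodup ∧ l.toFinset = L ∧ mem 0 = l.length ∧
    ∀ (t : ℕ) (h : t < l.length),
      mem (1 + 2 * t) = ((l[t]'h).1 : ℕ) ∧ mem (2 + 2 * t) = ((l[t]'h).2 : ℕ)

/-!
# Sparsest information patterns without structurally fixed modes

**Sparsity.** Controllability is decided by the eigenvector test of Popov, Belevitch and Hautus,
which amounts to the non-vanishing of a polynomial in the parameters
(`eigenvectorTest_iff_det_ne_zero`). So a family that is polynomial in its parameters passes the
test almost everywhere as soon as it passes it at one point (`GenericEval.ae_eigenvectorTest`).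
If the pattern has a perfect matching, the cycles of the corresponding permutation, with weights
that are distinct between cycles, together with one edge into each cycle from a cycle closer to the
sources, give such a point (`exists_realization_eigenvectorTest`). Hence, under the matching
assumption, structural controllability is the reachability of all states, and no actuator of a
minimum collection is redundant: some set of states, closed under predecessors, is actuated by it
alone (`IsMinActuation.exists_private`). Without a link to this actuator, the modes of this set
stay fixed for every realization. By duality the same holds for sensors, so that a pattern without
structurally fixed modes has at least `max p m` links, which is the number of links of a result of
the procedure (`IsProcedureResult.card_le`).

Conversely, the links of a result make the closed loop strongly connected: the sequential pairing
closes a cycle through all matched actuators and sensors, every unmatched vertex of the bipartite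
graph has only matched neighbours (`IsMaxBipMatching.matched`), and the extra links lead back from
the unmatched sensors and to the unmatched actuators. Then, for almost every realization, some gain
makes the closed loop controllable from the actuator end `i` and observable from the sensor end `j`
of a link. A fixed mode would be an eigenvalue both of this closed-loop matrix and of the one with
the gain of this link changed; a left eigenvector of the first and a right eigenvector of the second
are paired nontrivially by the rank-one difference, which is absurd (`fixedModes_eq_empty`).

**Running time.** The program is written in a structured language with variables, arrays, loops and
a weakest precondition calculus that also counts time, and is compiled to the machine; the number
of machine steps is at most a constant times the time of the structured program
(`Cmd.simulated`, `Cmd.program_correct`). As the machine has bitwise operations of unit cost on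
arbitrary numbers, sets of states and of sensors are stored as bit masks, and the lowest element of
a set is isolated in constant time and located with a table of logarithms (`exists_lowBit`).
A path-based depth-first search, which merges strongly connected components on a stack, computes the
set of sensors that each actuator reaches in time `O(n + p + e)` (`searchCmd_wp`). A maximum
matching is computed by at most `p + 1` searches for an augmenting path, each in time `O(p + m)` as
a mask provides an unvisited neighbour in constant time; when a search fails, the visited vertices
give a vertex cover of the size of the matching (`ExploreInv.card_le`). The links are then listed in
time `O(p + m)` (`outputCmd_wp`). The total `O(n + e + (p + m) ^ 2)` is within the bound.
-/

/-! ### Nonzero polynomials are almost everywhere nonzero -/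

/-- The parameters `θ : Θ` enter polynomials in the indeterminates `σ` through the values `ev θ`,
and a polynomial that is nonzero for one parameter is nonzero for almost every parameter. -/
structure GenericEval {Θ σ : Type} [MeasureTheory.MeasureSpace Θ] (ev : Θ → σ → ℝ) : Prop where
  measurable : Measurable ev
  ae_ne_zero : ∀ (q : MvPolynomial σ ℝ) (θ₀ : Θ), MvPolynomial.eval (ev θ₀) q ≠ 0 →
    ∀ᵐ θ, MvPolynomial.eval (ev θ) q ≠ 0

theorem genericEval_real : GenericEval (fun (x : ℝ) (_ : Unit) => x) where
  measurable := by fun_prop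
  ae_ne_zero q x₀ h := by
    set r : Polynomial ℝ := MvPolynomial.aeval (fun _ => Polynomial.X) q with hr
    have key : ∀ x : ℝ, MvPolynomial.eval (fun _ => x) q = r.eval x := by
      intro x
      rw [hr, ← Polynomial.coe_evalRingHom, MvPolynomial.aeval_def, MvPolynomial.hom_eval₂]
      have : (Polynomial.evalRingHom x).comp (algebraMap ℝ (Polynomial ℝ)) = RingHom.id ℝ := by
        ext y
        simp
      rw [this]
      simp only [MvPolynomial.eval, MvPolynomial.coe_eval₂Hom, Polynomial.coe_evalRingHom,
        Polynomial.eval_X]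
    have hr0 : r ≠ 0 := by
      intro h0
      apply h
      rw [key, h0, Polynomial.eval_zero]
    have hfin : (r.rootSet ℝ).Finite := Polynomial.rootSet_finite r ℝ
    rw [MeasureTheory.ae_iff]
    refine MeasureTheory.measure_mono_null ?_ (hfin.measure_zero _)
    intro x hx
    simp only [ne_eq, not_not, Set.mem_ofPred_eq] at hx
    rw [Polynomial.mem_rootSet]
    refine ⟨hr0, ?_⟩
    rw [Polynomial.coe_aeval_eq_eval, ← key]
    exact hx

theorem GenericEval.prod {Θ Θ' σ τ : Type} [MeasureTheory.MeasureSpace Θ]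
    [MeasureTheory.MeasureSpace Θ']
    [MeasureTheory.SFinite (MeasureTheory.volume : MeasureTheory.Measure Θ)]
    [MeasureTheory.SFinite (MeasureTheory.volume : MeasureTheory.Measure Θ')]
    [Finite σ] [Finite τ] {ev : Θ → σ → ℝ} {ev' : Θ' → τ → ℝ}
    (h : GenericEval ev) (h' : GenericEval ev') :
    GenericEval (fun θ : Θ × Θ' => Sum.elim (ev θ.1) (ev' θ.2)) where
  measurable := by
    have := h.measurable
    have := h'.measurable
    refine measurable_pi_iff.2 ?_
    rintro (i | i)
    · simp only [Sum.elim_inl]; fun_prop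
    · simp only [Sum.elim_inr]; fun_prop
  ae_ne_zero q θ₀ h₀ := by
    have hm : Measurable (fun θ : Θ × Θ' => Sum.elim (ev θ.1) (ev' θ.2)) := by
      have := h.measurable
      have := h'.measurable
      refine measurable_pi_iff.2 ?_
      rintro (i | i)
      · simp only [Sum.elim_inl]; fun_prop
      · simp only [Sum.elim_inr]; fun_prop
    have hq : Measurable (fun x : σ ⊕ τ → ℝ => MvPolynomial.eval x q) :=
      (MvPolynomial.continuous_eval q).measurable
    rw [MeasureTheory.Measure.volume_eq_prod, MeasureTheory.Measure.ae_prod_iff_ae_ae]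
    · have h1 := h.ae_ne_zero (MvPolynomial.aeval
        (Sum.elim MvPolynomial.X (fun t => MvPolynomial.C (ev' θ₀.2 t))) q) θ₀.1
      have e1 : ∀ x : σ → ℝ, MvPolynomial.eval x (MvPolynomial.aeval
          (Sum.elim MvPolynomial.X (fun t => MvPolynomial.C (ev' θ₀.2 t))) q) =
          MvPolynomial.eval (Sum.elim x (ev' θ₀.2)) q := by
        intro x
        rw [MvPolynomial.aeval_def, MvPolynomial.eval, MvPolynomial.coe_eval₂Hom,
          ← MvPolynomial.coe_eval₂Hom, MvPolynomial.hom_eval₂, MvPolynomial.eval,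
          MvPolynomial.coe_eval₂Hom]
        congr 1
        · ext y; simp
        · ext y; cases y <;> simp
      rw [e1] at h1
      filter_upwards [h1 h₀] with θ hθ
      rw [e1] at hθ
      have h2 := h'.ae_ne_zero (MvPolynomial.aeval
        (Sum.elim (fun t => MvPolynomial.C (ev θ t)) MvPolynomial.X) q) θ₀.2
      have e2 : ∀ x : τ → ℝ, MvPolynomial.eval x (MvPolynomial.aeval
          (Sum.elim (fun t => MvPolynomial.C (ev θ t)) MvPolynomial.X) q) =
          MvPolynomial.eval (Sum.elim (ev θ) x) q := by
        intro x
        rw [MvPolynomial.aeval_def, MvPolynomial.eval, MvPolynomial.coe_eval₂Hom,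
          ← MvPolynomial.coe_eval₂Hom, MvPolynomial.hom_eval₂, MvPolynomial.eval,
          MvPolynomial.coe_eval₂Hom]
        congr 1
        · ext y; simp
        · ext y; cases y <;> simp
      rw [e2] at h2
      filter_upwards [h2 hθ] with θ' hθ'
      rwa [e2] at hθ'
    · exact (measurableSet_singleton (0 : ℝ)).compl.preimage (hq.comp hm)

theorem GenericEval.comp {Θ Θ' σ τ : Type} [MeasureTheory.MeasureSpace Θ]
    [MeasureTheory.MeasureSpace Θ'] {ev : Θ → σ → ℝ} {ev' : Θ' → τ → ℝ} (h' : GenericEval ev')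
    {e : Θ → Θ'} (he : MeasureTheory.MeasurePreserving e) (f : σ → τ)
    (hev : ∀ θ, ev θ = ev' (e θ) ∘ f) : GenericEval ev where
  measurable := by
    have h1 : ev = fun θ => ev' (e θ) ∘ f := funext hev
    rw [h1]
    have := (h'.measurable).comp he.measurable
    refine measurable_pi_iff.2 fun i => ?_
    exact (measurable_pi_iff.1 this) (f i)
  ae_ne_zero q θ₀ h₀ := by
    have key : ∀ θ, MvPolynomial.eval (ev θ) q =
        MvPolynomial.eval (ev' (e θ)) (MvPolynomial.rename f q) := by
      intro θ
      rw [MvPolynomial.eval_rename, hev]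
    rw [key] at h₀
    have := he.quasiMeasurePreserving.ae (h'.ae_ne_zero _ _ h₀)
    filter_upwards [this] with θ hθ
    rwa [key]

theorem genericEval_fin (k : ℕ) : GenericEval (fun x : Fin k → ℝ => x) := by
  induction k with
  | zero =>
    refine ⟨measurable_id, fun q x₀ h => Filter.Eventually.of_forall fun x => ?_⟩
    rwa [Subsingleton.elim x x₀]
  | succ k ih =>
    refine (genericEval_real.prod ih).comp
      (MeasureTheory.volume_preserving_piFinSuccAbove (fun _ : Fin (k + 1) => ℝ) 0)
      (Fin.cases (Sum.inl ()) Sum.inr) ?_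
    intro x
    funext i
    refine Fin.cases ?_ (fun j => ?_) i
    · simp [MeasurableEquiv.piFinSuccAbove, Fin.insertNthEquiv]
    · simp [MeasurableEquiv.piFinSuccAbove, Fin.insertNthEquiv]; rfl

theorem genericEval_pi (ι : Type) [Fintype ι] : GenericEval (fun x : ι → ℝ => x) := by
  refine (genericEval_fin (Fintype.card ι)).comp
    (MeasureTheory.volume_measurePreserving_piCongrLeft (fun _ => ℝ) (Fintype.equivFin ι))
    (Fintype.equivFin ι) ?_
  intro x
  funext i
  simp [MeasurableEquiv.piCongrLeft, Equiv.piCongrLeft, Equiv.piCongrLeft']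

/-! ### The Kalman matrix and the eigenvector test -/

/-- The Kalman matrix `[B, M B, …, M ^ (n - 1) B]`. -/
def kalman {R : Type} [CommRing R] {n p : ℕ} (M : Matrix (Fin n) (Fin n) R)
    (B : Matrix (Fin n) (Fin p) R) : Matrix (Fin n) (Fin n × Fin p) R :=
  fun i e => (M ^ (e.1 : ℕ) * B) i e.2

/-- The eigenvector test of Popov, Belevitch and Hautus: no complex left eigenvector of `M` is
annihilated by `B`. -/
def EigenvectorTest {n p : ℕ} (M : Matrix (Fin n) (Fin n) ℝ) (B : Matrix (Fin n) (Fin p) ℝ) :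
    Prop :=
  ∀ (z : ℂ) (w : Fin n → ℂ), Matrix.vecMul w (M.map (algebraMap ℝ ℂ)) = z • w →
    Matrix.vecMul w (B.map (algebraMap ℝ ℂ)) = 0 → w = 0

theorem vecMul_pow_eq_smul {R : Type} [CommRing R] {n : ℕ} {M : Matrix (Fin n) (Fin n) R}
    {w : Fin n → R} {z : R} (h : Matrix.vecMul w M = z • w) (k : ℕ) :
    Matrix.vecMul w (M ^ k) = z ^ k • w := by
  induction k with
  | zero => simp
  | succ k ih =>
    rw [pow_succ, ← Matrix.vecMul_vecMul, ih, Matrix.smul_vecMul, h, smul_smul, pow_succ]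

theorem vecMul_kalman_eq_zero_iff {R : Type} [CommRing R] {n p : ℕ}
    {M : Matrix (Fin n) (Fin n) R} {B : Matrix (Fin n) (Fin p) R} {w : Fin n → R} :
    Matrix.vecMul w (kalman M B) = 0 ↔ ∀ k < n, Matrix.vecMul w (M ^ k * B) = 0 := by
  constructor
  · intro h k hk
    funext j
    exact congrFun h (⟨k, hk⟩, j)
  · intro h
    funext e
    exact congrFun (h e.1 e.1.2) e.2

/-- By the theorem of Cayley and Hamilton, the powers below the dimension decide. -/
theorem vecMul_pow_mul_eq_zero {R : Type} [Field R] {n p : ℕ}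
    {M : Matrix (Fin n) (Fin n) R} {B : Matrix (Fin n) (Fin p) R} {w : Fin n → R}
    (h : ∀ k < n, Matrix.vecMul w (M ^ k * B) = 0) (k : ℕ) :
    Matrix.vecMul w (M ^ k * B) = 0 := by
  rw [Matrix.pow_eq_aeval_mod_charpoly]
  set r := Polynomial.X ^ k %ₘ M.charpoly with hr
  rcases Nat.eq_zero_or_pos n with rfl | hn
  · have : w = 0 := Subsingleton.elim _ _
    rw [this, Matrix.zero_vecMul]
  · have hdeg : r.natDegree < n := by
      have h1 := Polynomial.natDegree_modByMonic_lt (Polynomial.X ^ k) M.charpoly_monic (by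
        intro h1
        have := M.charpoly_natDegree_eq_dim
        rw [h1] at this
        simp at this
        omega)
      rwa [M.charpoly_natDegree_eq_dim, Fintype.card_fin] at h1
    rw [Polynomial.aeval_eq_sum_range, Matrix.sum_mul, Matrix.vecMul_sum]
    refine Finset.sum_eq_zero fun i hi => ?_
    rw [Matrix.smul_mul, Matrix.vecMul_smul, h i (by simp at hi; omega), smul_zero]

theorem map_kalman {R S : Type} [CommRing R] [CommRing S] (f : R →+* S) {n p : ℕ}
    (M : Matrix (Fin n) (Fin n) R) (B : Matrix (Fin n) (Fin p) R) :
    (kalman M B).map f = kalman (M.map f) (B.map f) := by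
  ext i e
  simp only [kalman, Matrix.map_apply]
  have : (M ^ (e.1 : ℕ) * B).map f = (M.map f) ^ (e.1 : ℕ) * B.map f := by
    rw [Matrix.map_mul, Matrix.map_pow]
  exact congrFun (congrFun this i) e.2

theorem eigenvectorTest_iff_det_ne_zero {n p : ℕ} (M : Matrix (Fin n) (Fin n) ℝ)
    (B : Matrix (Fin n) (Fin p) ℝ) :
    EigenvectorTest M B ↔ (kalman M B * (kalman M B).transpose).det ≠ 0 := by
  constructor
  · intro h hdet
    obtain ⟨x, hx0, hx⟩ := Matrix.exists_vecMul_eq_zero_iff.2 hdet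
    have hxK : Matrix.vecMul x (kalman M B) = 0 := by
      have h1 : dotProduct (Matrix.vecMul x (kalman M B)) (Matrix.vecMul x (kalman M B)) = 0 := by
        have h2 := congrArg (fun y => dotProduct y x) hx
        simp only [zero_dotProduct] at h2
        rw [← Matrix.vecMul_vecMul, ← Matrix.dotProduct_mulVec, Matrix.mulVec_transpose] at h2
        exact h2
      exact dotProduct_self_eq_zero.1 h1
    have hall := vecMul_pow_mul_eq_zero (vecMul_kalman_eq_zero_iff.1 hxK)
    -- The complex vectors annihilated by all `M ^ k B` form an invariant subspace.
    let W : Submodule ℂ (Fin n → ℂ) :=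
      ⨅ k : ℕ, LinearMap.ker (Matrix.vecMulLinear
        ((M.map (algebraMap ℝ ℂ)) ^ k * B.map (algebraMap ℝ ℂ)))
    have hW : ∀ w, w ∈ W ↔ ∀ k : ℕ, Matrix.vecMul w
        ((M.map (algebraMap ℝ ℂ)) ^ k * B.map (algebraMap ℝ ℂ)) = 0 := by
      intro w
      simp [W]
    have hinv : ∀ w ∈ W, Matrix.vecMulLinear (M.map (algebraMap ℝ ℂ)) w ∈ W := by
      intro w hw
      rw [hW] at hw ⊢
      intro k
      rw [Matrix.vecMulLinear_apply, Matrix.vecMul_vecMul, ← Matrix.mul_assoc, ← pow_succ']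
      exact hw (k + 1)
    have hxW : (fun i => (x i : ℂ)) ∈ W := by
      rw [hW]
      intro k
      have h1 := hall k
      rw [← Matrix.map_pow, ← Matrix.map_mul]
      funext j
      have h2 := congrFun h1 j
      simp only [Matrix.vecMul, dotProduct, Matrix.map_apply, Pi.zero_apply] at h2 ⊢
      rw [← Complex.ofReal_zero, ← h2]
      push_cast
      rfl
    have hne : (⟨_, hxW⟩ : W) ≠ 0 := by
      intro h0
      apply hx0
      funext i
      have := congrFun (congrArg Subtype.val h0) i
      simpa using this
    have : Nontrivial W := ⟨⟨_, _, hne⟩⟩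
    obtain ⟨z, hz⟩ := Module.End.exists_eigenvalue
      ((Matrix.vecMulLinear (M.map (algebraMap ℝ ℂ))).restrict hinv)
    obtain ⟨w, hw⟩ := hz.exists_hasEigenvector
    have h1 := hw.apply_eq_smul
    have h2 : (w : Fin n → ℂ) = 0 := by
      refine h z w ?_ ?_
      · have := congrArg Subtype.val h1
        simpa using this
      · have := (hW w).1 w.2 0
        simpa using this
    exact hw.2 (Subtype.ext h2)
  · intro hdet z w hz hB
    have h1 : Matrix.vecMul w ((kalman M B).map (algebraMap ℝ ℂ)) = 0 := by
      rw [map_kalman, vecMul_kalman_eq_zero_iff]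
      intro k _
      rw [← Matrix.vecMul_vecMul, vecMul_pow_eq_smul hz, Matrix.smul_vecMul, hB, smul_zero]
    have h2 : Matrix.vecMul w
        ((kalman M B * (kalman M B).transpose).map (algebraMap ℝ ℂ)) = 0 := by
      rw [Matrix.map_mul, ← Matrix.vecMul_vecMul, h1, Matrix.zero_vecMul]
    refine Matrix.eq_zero_of_vecMul_eq_zero ?_ h2
    rw [← RingHom.mapMatrix_apply, ← RingHom.map_det]
    simpa using hdet

theorem EigenvectorTest.isControllable {n p : ℕ} {M : Matrix (Fin n) (Fin n) ℝ}
    {B : Matrix (Fin n) (Fin p) ℝ} (h : EigenvectorTest M B) : IsControllable M B := by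
  have h1 := (eigenvectorTest_iff_det_ne_zero M B).1 h
  have h2 : (kalman M B).rank = n := by
    rw [← Matrix.rank_self_mul_transpose, Matrix.rank_of_isUnit, Fintype.card_fin]
    rw [Matrix.isUnit_iff_isUnit_det]
    exact isUnit_iff_ne_zero.2 h1
  exact h2

theorem eq_zero_of_rank_kalman {n p : ℕ} {M : Matrix (Fin n) (Fin n) ℝ}
    {B : Matrix (Fin n) (Fin p) ℝ} (h : IsControllable M B) {x : Fin n → ℝ}
    (hx : ∀ k : ℕ, Matrix.vecMul x (M ^ k * B) = 0) : x = 0 := by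
  have h0 : (kalman M B).rank = n := h
  rw [← Matrix.rank_transpose, Matrix.rank] at h0
  have h1 := LinearMap.finrank_range_add_finrank_ker (kalman M B).transpose.mulVecLin
  rw [h0, Module.finrank_fin_fun] at h1
  have h2 : LinearMap.ker (kalman M B).transpose.mulVecLin = ⊥ :=
    Submodule.finrank_eq_zero.1 (by omega)
  have h3 : x ∈ LinearMap.ker (kalman M B).transpose.mulVecLin := by
    rw [LinearMap.mem_ker, Matrix.mulVecLin_apply, Matrix.mulVec_transpose]
    exact vecMul_kalman_eq_zero_iff.2 fun k _ => hx k
  rw [h2] at h3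
  simpa using h3

/-- The matrices of a family that is polynomial in generic parameters pass the eigenvector test
almost everywhere as soon as they pass it once. -/
theorem GenericEval.ae_eigenvectorTest {Θ σ : Type} [MeasureTheory.MeasureSpace Θ]
    {ev : Θ → σ → ℝ} (h : GenericEval ev) {n p : ℕ}
    (M : Matrix (Fin n) (Fin n) (MvPolynomial σ ℝ)) (B : Matrix (Fin n) (Fin p) (MvPolynomial σ ℝ))
    (θ₀ : Θ) (h₀ : EigenvectorTest (M.map (MvPolynomial.eval (ev θ₀)))
      (B.map (MvPolynomial.eval (ev θ₀)))) :
    ∀ᵐ θ, EigenvectorTest (M.map (MvPolynomial.eval (ev θ))) (B.map (MvPolynomial.eval (ev θ))) := by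
  have key : ∀ θ, (EigenvectorTest (M.map (MvPolynomial.eval (ev θ)))
      (B.map (MvPolynomial.eval (ev θ))) ↔
      MvPolynomial.eval (ev θ) (kalman M B * (kalman M B).transpose).det ≠ 0) := by
    intro θ
    rw [eigenvectorTest_iff_det_ne_zero, ← map_kalman, ← Matrix.transpose_map, ← Matrix.map_mul,
      ← RingHom.mapMatrix_apply, ← RingHom.map_det]
  filter_upwards [h.ae_ne_zero _ θ₀ ((key θ₀).1 h₀)] with θ hθ
  exact (key θ).2 hθ

/-! ### A controllable realization of a pattern with a perfect matching -/

/-- From every cycle class that meets no source, an edge leads back to a class that is closer to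
the sources: breadth-first search on the classes. -/
theorem exists_class_forest {V Q : Type} (E : V → V → Prop) (cls : V → Q) (S : Set V)
    (hcls : Function.Surjective cls) (hS : ∀ x, ∃ s ∈ S, Relation.ReflTransGen E s x) :
    ∃ (d : Q → ℕ) (u v : Q → V), ∀ q, (d q = 0 → ∃ s ∈ S, cls s = q) ∧
      (d q ≠ 0 → cls (v q) = q ∧ E (u q) (v q) ∧ d (cls (u q)) < d q) := by
  classical
  let Lv : ℕ → Set Q := fun k => Nat.rec {q | ∃ s ∈ S, cls s = q}
    (fun _ T => T ∪ {q | ∃ u v, cls v = q ∧ E u v ∧ cls u ∈ T}) k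
  have h0 : ∀ q, q ∈ Lv 0 ↔ ∃ s ∈ S, cls s = q := fun q => Iff.rfl
  have h1 : ∀ k q, q ∈ Lv (k + 1) ↔ (q ∈ Lv k ∨ ∃ u v, cls v = q ∧ E u v ∧ cls u ∈ Lv k) :=
    fun k q => Iff.rfl
  have hex : ∀ q, ∃ k, q ∈ Lv k := by
    intro q
    obtain ⟨x, rfl⟩ := hcls q
    obtain ⟨s, hs, hsx⟩ := hS x
    induction hsx with
    | refl => exact ⟨0, (h0 _).2 ⟨s, hs, rfl⟩⟩
    | @tail y z _ hyz ih =>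
      obtain ⟨k, hk⟩ := ih
      exact ⟨k + 1, (h1 _ _).2 (Or.inr ⟨y, z, rfl, hyz, hk⟩)⟩
  let d : Q → ℕ := fun q => sInf {k | q ∈ Lv k}
  have hd : ∀ q, q ∈ Lv (d q) := fun q => Nat.sInf_mem (s := {k | q ∈ Lv k}) (hex q)
  have hle : ∀ q k, q ∈ Lv k → d q ≤ k := fun q k h => Nat.sInf_le h
  have hpar : ∀ q, ∃ uv : V × V, d q ≠ 0 →
      cls uv.2 = q ∧ E uv.1 uv.2 ∧ d (cls uv.1) < d q := by
    intro q
    obtain ⟨x, rfl⟩ := hcls q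
    by_cases hq : d (cls x) = 0
    · exact ⟨(x, x), fun h => absurd hq h⟩
    · obtain ⟨k, hk⟩ := Nat.exists_eq_succ_of_ne_zero hq
      have hmem := hd (cls x)
      rw [hk, Nat.succ_eq_add_one, h1] at hmem
      rcases hmem with hmem | ⟨u, v, hv, huv, hu⟩
      · have := hle _ _ hmem
        omega
      · refine ⟨(u, v), fun _ => ⟨hv, huv, ?_⟩⟩
        have := hle _ _ hu
        show d (cls u) < _
        omega
  choose uv huv using hpar
  refine ⟨d, fun q => (uv q).1, fun q => (uv q).2, fun q => ⟨fun hq => ?_, huv q⟩⟩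
  have hmem := hd q
  rw [hq] at hmem
  exact (h0 q).1 hmem

/-- A vector satisfying `a w (σ x) = z w x` on a cycle of `σ`, except that it has a nonzero defect
at one point, vanishes nowhere on the cycle. -/
theorem ne_zero_of_cycle_defect {V : Type} [Finite V] (σ : Equiv.Perm V) (w : V → ℂ) (z a c : ℂ)
    (hz : z ≠ 0) (ha : a ≠ 0) (hc : c ≠ 0) (x₀ : V) (h₀ : w (σ x₀) * a + c = z * w x₀)
    (h : ∀ x, σ.SameCycle x₀ x → x ≠ x₀ → w (σ x) * a = z * w x) (y : V)
    (hy : σ.SameCycle x₀ y) : w y ≠ 0 := by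
  intro hwy
  have hfwd : ∀ j : ℕ, w ((σ ^ j) y) = 0 ∨ w x₀ = 0 := by
    intro j
    induction j with
    | zero => left; simpa using hwy
    | succ j ih =>
      rcases ih with ih | ih
      · by_cases hj : (σ ^ j) y = x₀
        · right; rw [← hj]; exact ih
        · left
          have := h _ (by simpa using hy) hj
          rw [ih, mul_zero] at this
          rw [pow_succ', Equiv.Perm.mul_apply]
          exact (mul_eq_zero.1 this).resolve_right ha
      · exact Or.inr ih
  have hbwd : ∀ j : ℕ, w ((σ⁻¹ ^ j) y) = 0 ∨ w (σ x₀) = 0 := by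
    intro j
    induction j with
    | zero => left; simpa using hwy
    | succ j ih =>
      rcases ih with ih | ih
      · have hs : σ ((σ⁻¹ ^ (j + 1)) y) = (σ⁻¹ ^ j) y := by
          rw [pow_succ', Equiv.Perm.mul_apply]; simp
        by_cases hj : (σ⁻¹ ^ (j + 1)) y = x₀
        · right; rw [← hj, hs]; exact ih
        · left
          have := h ((σ⁻¹ ^ (j + 1)) y)
            (by rw [inv_pow, ← zpow_natCast, ← zpow_neg]; simpa using hy) hj
          rw [hs, ih, zero_mul] at this
          exact (mul_eq_zero.1 this.symm).resolve_left hz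
      · exact Or.inr ih
  have hx₀ : w x₀ = 0 := by
    obtain ⟨k, _, hk⟩ := hy.symm.exists_pow_eq'
    have := hfwd k
    rw [hk] at this
    simpa using this
  have hσ : w (σ x₀) = 0 := by
    have h2 : σ⁻¹.SameCycle y (σ x₀) := by
      rw [Equiv.Perm.sameCycle_inv]
      exact hy.symm.apply_right
    obtain ⟨k, _, hk⟩ := h2.exists_pow_eq'
    have := hbwd k
    rw [hk] at this
    simpa using this
  rw [hx₀, hσ] at h₀
  simp at h₀
  exact hc h₀

/-- The realization of dedicated actuators with unit gains. -/
def inputMatrix {n p : ℕ} (b : Fin p → Fin n) : Matrix (Fin n) (Fin p) ℝ :=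
  fun x i => if b i = x then 1 else 0

/-- If the pattern has a perfect matching `σ` and every state is reachable from the sources, some
realization passes the eigenvector test. The realization gives the cycles of `σ` disjoint
spectra, through weights of different absolute values, and links the cycles by a spanning forest;
a left eigenvector then vanishes nowhere on a branch that leads back to a source. -/
theorem exists_realization_eigenvectorTest {n p : ℕ} (E : Fin n → Fin n → Prop)
    (σ : Equiv.Perm (Fin n)) (hσ : ∀ x, E x (σ x)) (b : Fin p → Fin n)
    (hb : ∀ x, ∃ i, Relation.ReflTransGen E (b i) x) :
    ∃ M : Matrix (Fin n) (Fin n) ℝ, (∀ y x, ¬ E x y → M y x = 0) ∧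
      EigenvectorTest M (inputMatrix b) := by
  classical
  let Q := Quotient (Equiv.Perm.SameCycle.setoid σ)
  let cls : Fin n → Q := Quotient.mk _
  have hclsS : ∀ {x y}, cls x = cls y → σ.SameCycle x y := fun h => Quotient.exact h
  have hclsσ : ∀ x, cls (σ x) = cls x := fun x =>
    Quotient.sound (Equiv.Perm.sameCycle_apply_left.2 (Equiv.Perm.SameCycle.refl σ x))
  obtain ⟨d, u, v, hd⟩ := exists_class_forest E cls (Set.range b) Quotient.mk_surjective
    (fun x => by obtain ⟨i, hi⟩ := hb x; exact ⟨b i, ⟨i, rfl⟩, hi⟩)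
  let a : Q → ℝ := fun q => (Fintype.equivFin Q q : ℕ) + 1
  have hapos : ∀ q, 0 < a q := fun q => by positivity
  have hainj : ∀ q r, a q = a r → q = r := by
    intro q r h
    have : ((Fintype.equivFin Q q : ℕ) : ℝ) = (Fintype.equivFin Q r : ℕ) := by
      simpa [a] using h
    exact (Fintype.equivFin Q).injective (Fin.ext (by exact_mod_cast this))
  let N : Matrix (Fin n) (Fin n) ℝ := fun y x =>
    if d (cls y) ≠ 0 ∧ y = v (cls y) ∧ x = u (cls y) then 1 else 0
  let M : Matrix (Fin n) (Fin n) ℝ := fun y x => (if y = σ x then a (cls x) else 0) + N y x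
  refine ⟨M, ?_, ?_⟩
  · intro y x hE
    have h1 : y ≠ σ x := fun h => hE (h ▸ hσ x)
    have h2 : ¬ (d (cls y) ≠ 0 ∧ y = v (cls y) ∧ x = u (cls y)) := by
      rintro ⟨h3, h4, h5⟩
      have := ((hd (cls y)).2 h3).2.1
      rw [← h4, ← h5] at this
      exact hE this
    simp only [M, N, if_neg h1, if_neg h2, add_zero]
  intro z w hw hwB
  have hwb : ∀ i, w (b i) = 0 := by
    intro i
    have : ∑ x, w x * algebraMap ℝ ℂ (inputMatrix b x i) = 0 := congrFun hwB i
    simpa [inputMatrix, apply_ite] using this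
  have heq : ∀ x, w (σ x) * a (cls x) + ∑ y, w y * (N y x : ℂ) = z * w x := by
    intro x
    have h1 := congrFun hw x
    simp only [Matrix.vecMul, dotProduct, Matrix.map_apply, Pi.smul_apply, smul_eq_mul] at h1
    rw [← h1]
    have h2 : ∀ y, w y * (algebraMap ℝ ℂ) (M y x) =
        (if y = σ x then w y * a (cls x) else 0) + w y * (N y x : ℂ) := by
      intro y
      by_cases hy : y = σ x
      · simp [M, hy, mul_add]
      · simp [M, hy]
    rw [Finset.sum_congr rfl fun y _ => h2 y, Finset.sum_add_distrib]
    simp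
  -- Where no child of a class contributes, the restriction of `w` to the class is an eigenvector
  -- of a weighted cycle.
  have hhom : ∀ r, (∀ q, d q ≠ 0 → cls (u q) = r → w (v q) = 0) → (∃ x, cls x = r ∧ w x ≠ 0) →
      ‖z‖ = a r ∧ ∀ x, cls x = r → w x ≠ 0 := by
    intro r hr ⟨x₁, hx₁, hwx₁⟩
    have h1 : ∀ x, cls x = r → w (σ x) * a r = z * w x := by
      intro x hx
      rw [← heq x, hx, Finset.sum_eq_zero, add_zero]
      intro y _
      by_cases hy : d (cls y) ≠ 0 ∧ y = v (cls y) ∧ x = u (cls y)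
      · have := hr (cls y) hy.1 (by rw [← hy.2.2, hx])
        rw [← hy.2.1] at this
        rw [this, zero_mul]
      · simp [N, if_neg hy]
    have h2 : ∀ x, cls x = r → ‖w (σ x)‖ * a r = ‖z‖ * ‖w x‖ := by
      intro x hx
      have := congrArg norm (h1 x hx)
      rwa [norm_mul, norm_mul, Complex.norm_real, Real.norm_of_nonneg (hapos r).le] at this
    have h3 : (∑ x ∈ Finset.univ.filter (fun x => cls x = r), ‖w (σ x)‖) =
        ∑ x ∈ Finset.univ.filter (fun x => cls x = r), ‖w x‖ := by
      refine Finset.sum_equiv σ ?_ (fun _ _ => rfl)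
      intro x
      simp [hclsσ]
    have h4 : (∑ x ∈ Finset.univ.filter (fun x => cls x = r), ‖w x‖) * a r =
        ‖z‖ * ∑ x ∈ Finset.univ.filter (fun x => cls x = r), ‖w x‖ := by
      rw [← h3, Finset.sum_mul, h3, Finset.mul_sum]
      exact Finset.sum_congr rfl fun x hx => h2 x (by simpa using hx)
    have h5 : 0 < ∑ x ∈ Finset.univ.filter (fun x => cls x = r), ‖w x‖ :=
      Finset.sum_pos' (fun _ _ => norm_nonneg _) ⟨x₁, by simpa using hx₁, norm_pos_iff.2 hwx₁⟩
    have h6 : ‖z‖ = a r := by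
      rw [mul_comm] at h4
      exact (mul_right_cancel₀ h5.ne' h4).symm
    refine ⟨h6, fun x hx => ?_⟩
    have h7 : ∀ k : ℕ, ‖w ((σ ^ k) x₁)‖ = ‖w x₁‖ ∧ cls ((σ ^ k) x₁) = r := by
      intro k
      induction k with
      | zero => exact ⟨by simp, by simpa using hx₁⟩
      | succ k ih =>
        rw [pow_succ', Equiv.Perm.mul_apply]
        refine ⟨?_, by rw [hclsσ]; exact ih.2⟩
        have := h2 _ ih.2
        rw [h6, mul_comm] at this
        rw [mul_left_cancel₀ (hapos r).ne' this, ih.1]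
    obtain ⟨k, _, hk⟩ := (hclsS (hx₁.trans hx.symm)).exists_pow_eq'
    have := (h7 k).1
    rw [hk] at this
    rw [← norm_ne_zero_iff, this]
    exact norm_ne_zero_iff.2 hwx₁
  by_contra hw0
  obtain ⟨x₁, hx₁⟩ : ∃ x, w x ≠ 0 := by
    by_contra h
    push Not at h
    exact hw0 (funext h)
  let Z : Finset Q := Finset.univ.filter fun q => ∃ x, cls x = q ∧ w x ≠ 0
  obtain ⟨q₀, hq₀Z, hq₀⟩ := Z.exists_max_image d ⟨cls x₁, by simp only [Z, Finset.mem_filter]; exact ⟨Finset.mem_univ _, x₁, rfl, hx₁⟩⟩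
  have hZ : ∀ q, q ∈ Z ↔ ∃ x, cls x = q ∧ w x ≠ 0 := fun q => by simp [Z]
  have hq₀h := hhom q₀ (by
    intro q hq hqu
    by_contra hne
    have h1 := hq₀ q ((hZ q).2 ⟨v q, ((hd q).2 hq).1, hne⟩)
    have h2 := ((hd q).2 hq).2.2
    rw [hqu] at h2
    omega) ((hZ q₀).1 hq₀Z)
  let par : Q → Q → Prop := fun q r => d q ≠ 0 ∧ cls (u q) = r
  have hpard : ∀ q r, Relation.ReflTransGen par q r → d r ≤ d q := by
    intro q r h
    induction h with
    | refl => exact le_rfl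
    | tail _ h2 ih =>
      have := ((hd _).2 h2.1).2.2
      rw [h2.2] at this
      omega
  -- Only the ancestors of `q₀` carry nonzero entries of `w`.
  have hanc : ∀ k r, q₀ ∈ Z → d q₀ - d r ≤ k → r ∈ Z → Relation.ReflTransGen par q₀ r := by
    intro k
    induction k with
    | zero =>
      intro r _ hk hr
      by_cases hch : ∀ q, d q ≠ 0 → cls (u q) = r → w (v q) = 0
      · rw [hainj _ _ ((hhom r hch ((hZ r).1 hr)).1.symm.trans hq₀h.1)]
      · push Not at hch
        obtain ⟨q, hq, hqr, hne⟩ := hch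
        have h1 := hq₀ q ((hZ q).2 ⟨v q, ((hd q).2 hq).1, hne⟩)
        have h2 := ((hd q).2 hq).2.2
        rw [hqr] at h2
        omega
    | succ k ih =>
      intro r hq₀Z hk hr
      by_cases hch : ∀ q, d q ≠ 0 → cls (u q) = r → w (v q) = 0
      · rw [hainj _ _ ((hhom r hch ((hZ r).1 hr)).1.symm.trans hq₀h.1)]
      · push Not at hch
        obtain ⟨q, hq, hqr, hne⟩ := hch
        have h2 := ((hd q).2 hq).2.2
        rw [hqr] at h2
        exact (ih q hq₀Z (by omega) ((hZ q).2 ⟨v q, ((hd q).2 hq).1, hne⟩)).tail ⟨hq, hqr⟩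
  have hz0 : z ≠ 0 := by
    rw [← norm_ne_zero_iff, hq₀h.1]
    exact (hapos _).ne'
  have hall : ∀ r, Relation.ReflTransGen par q₀ r → ∀ x, cls x = r → w x ≠ 0 := by
    intro r hr
    induction hr with
    | refl => exact hq₀h.2
    | @tail q r h1 h2 ih =>
      obtain ⟨hq, rfl⟩ := h2
      have hvq : w (v q) ≠ 0 := ih _ ((hd q).2 hq).1
      have huniq : ∀ y, d (cls y) ≠ 0 → y = v (cls y) → cls (u (cls y)) = cls (u q) → w y ≠ 0 →
          y = v q := by
        intro y hy hyv hyu hwy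
        have hy1 := hanc _ (cls y) hq₀Z le_rfl ((hZ _).2 ⟨y, rfl, hwy⟩)
        have hru : Relator.RightUnique par := fun _ _ _ h h' => h.2.symm.trans h'.2
        have key : ∀ q r, d q ≠ 0 → d r ≠ 0 → cls (u q) = cls (u r) →
            Relation.ReflTransGen par q r → q = r := by
          intro q r hq hr hqr h
          rcases h.cases_head with h | ⟨t, h, h'⟩
          · exact h
          · exfalso
            have h3 := hpard _ _ h'
            rw [← h.2, hqr] at h3
            have := ((hd r).2 hr).2.2
            omega
        have hcy : cls y = q := by
          rcases Relation.ReflTransGen.total_of_right_unique hru hy1 h1 with h | h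
          · exact key _ _ hy hq hyu h
          · exact (key _ _ hq hy hyu.symm h).symm
        rw [hyv, hcy]
      intro x hx
      refine ne_zero_of_cycle_defect σ w z (a (cls (u q))) (w (v q)) hz0
        (by exact_mod_cast (hapos _).ne') hvq (u q) ?_ ?_ x (hclsS hx.symm)
      · rw [← heq (u q), Finset.sum_eq_single (v q)]
        · have : N (v q) (u q) = 1 := by
            have h3 := ((hd q).2 hq).1
            simp only [N]
            rw [if_pos]
            rw [h3]
            exact ⟨hq, rfl, rfl⟩
          rw [this]
          simp
        · intro y _ hy
          by_cases hN : d (cls y) ≠ 0 ∧ y = v (cls y) ∧ u q = u (cls y)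
          · by_cases hwy : w y = 0
            · rw [hwy, zero_mul]
            · exact absurd (huniq y hN.1 hN.2.1 (by rw [← hN.2.2]) hwy) hy
          · simp [N, if_neg hN]
        · simp
      · intro x' hx' hne
        have hcx : cls x' = cls (u q) := (Quotient.sound hx').symm
        rw [← heq x', hcx, Finset.sum_eq_zero, add_zero]
        intro y _
        by_cases hN : d (cls y) ≠ 0 ∧ y = v (cls y) ∧ x' = u (cls y)
        · by_cases hwy : w y = 0
          · rw [hwy, zero_mul]
          · exfalso
            have h3 := huniq y hN.1 hN.2.1 (by rw [← hN.2.2, hcx]) hwy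
            apply hne
            rw [hN.2.2, h3, ((hd q).2 hq).1]
        · simp [N, if_neg hN]
  have hroot : ∀ k r, d r ≤ k → Relation.ReflTransGen par q₀ r → False := by
    intro k
    induction k with
    | zero =>
      intro r hk hr
      obtain ⟨_, ⟨i, rfl⟩, hi⟩ := (hd r).1 (by omega)
      exact hall r hr _ hi (hwb i)
    | succ k ih =>
      intro r hk hr
      by_cases h0 : d r = 0
      · exact ih r (by omega) hr
      · have := ((hd r).2 h0).2.2
        exact ih (cls (u r)) (by omega) (hr.tail ⟨h0, rfl⟩)
  exact hroot _ q₀ le_rfl .refl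

/-! ### Structural controllability of patterns with a perfect matching -/

/-- Reachability in the state digraph. -/
def StateReach {n : ℕ} (A : Pattern n n) : Fin n → Fin n → Prop :=
  Relation.ReflTransGen fun x y => A y x = true

/-- The transposed pattern. -/
def Pattern.flip {r s : ℕ} (P : Pattern r s) : Pattern s r := fun i j => P j i

theorem vecMul_eq_sum {R : Type} [CommRing R] {r s : ℕ} (w : Fin r → R)
    (M : Matrix (Fin r) (Fin s) R) (j : Fin s) : Matrix.vecMul w M j = ∑ i, w i * M i j := rfl

/-- The pattern with indeterminates at its nonzero positions. -/
noncomputable def Pattern.generic {r s : ℕ} (P : Pattern r s) {σ : Type}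
    (f : {e : Fin r × Fin s // P e.1 e.2 = true} → σ) :
    Matrix (Fin r) (Fin s) (MvPolynomial σ ℝ) :=
  fun i j => if h : P i j = true then MvPolynomial.X (f ⟨(i, j), h⟩) else 0

theorem Pattern.map_generic {r s : ℕ} (P : Pattern r s) {σ : Type}
    (f : {e : Fin r × Fin s // P e.1 e.2 = true} → σ) (x : σ → ℝ) :
    (P.generic f).map (MvPolynomial.eval x) = P.realize (x ∘ f) := by
  ext i j
  simp only [Matrix.map_apply, Pattern.generic, Pattern.realize]
  split <;> simp

theorem Pattern.realize_of_support {r s : ℕ} (P : Pattern r s) (M : Matrix (Fin r) (Fin s) ℝ)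
    (h : ∀ i j, P i j = false → M i j = 0) : P.realize (fun e => M e.1.1 e.1.2) = M := by
  ext i j
  simp only [Pattern.realize]
  split
  · rfl
  · rename_i h'
    exact (h i j (by simpa using h')).symm

theorem Pattern.realize_eq_zero {r s : ℕ} {P : Pattern r s} {θ : P.Params} {i : Fin r} {j : Fin s}
    (h : P i j = false) : P.realize θ i j = 0 := by
  simp [Pattern.realize, h]

theorem realize_actuatorPattern_one {n p : ℕ} (b : Fin p → Fin n) :
    (actuatorPattern b).realize (fun _ => 1) = inputMatrix b := by
  ext x i
  by_cases h : b i = x <;> simp [Pattern.realize, inputMatrix, actuatorPattern, h]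

theorem realize_sensorPattern_one {n p : ℕ} (c : Fin p → Fin n) :
    (sensorPattern c).realize (fun _ => 1) = (inputMatrix c).transpose := by
  ext x i
  by_cases h : c x = i <;>
    simp [Pattern.realize, inputMatrix, sensorPattern, h]

/-- A perfect matching is the graph of a permutation. -/
theorem HasPerfectStateMatching.exists_perm {n : ℕ} {A : Pattern n n}
    (h : HasPerfectStateMatching A) : ∃ σ : Equiv.Perm (Fin n), ∀ x, A (σ x) x = true := by
  obtain ⟨M, hM, hl, _⟩ := h
  choose f hf using hl
  have hinj : Function.Injective f := by
    intro x y hxy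
    exact congrArg Prod.fst (hM.2 _ (hf x) _ (hf y) (Or.inr hxy))
  exact ⟨Equiv.ofBijective f (Finite.injective_iff_bijective.1 hinj), fun x => hM.1 _ (hf x)⟩

theorem structurallyControllable_of_reach {n p : ℕ} {A : Pattern n n}
    (hA : HasPerfectStateMatching A) (b : Fin p → Fin n)
    (hb : ∀ x, ∃ i, StateReach A (b i) x) : StructurallyControllable A (actuatorPattern b) := by
  obtain ⟨σ, hσ⟩ := hA.exists_perm
  obtain ⟨M, hM, hMt⟩ := exists_realization_eigenvectorTest (fun x y => A y x = true) σ hσ b hb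
  have hgen := (genericEval_pi {e : Fin n × Fin n // A e.1 e.2 = true}).prod
    (genericEval_pi {e : Fin n × Fin p // actuatorPattern b e.1 e.2 = true})
  have h1 := hgen.ae_eigenvectorTest (A.generic Sum.inl) ((actuatorPattern b).generic Sum.inr)
    (fun e => M e.1.1 e.1.2, fun _ => 1) (by
      rw [Pattern.map_generic, Pattern.map_generic]
      change EigenvectorTest (A.realize (fun e => M e.1.1 e.1.2))
        ((actuatorPattern b).realize (fun _ => 1))
      rw [A.realize_of_support M (fun i j h => hM i j (by simp [h])), realize_actuatorPattern_one]
      exact hMt)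
  filter_upwards [h1] with θ hθ
  rw [Pattern.map_generic, Pattern.map_generic] at hθ
  exact EigenvectorTest.isControllable hθ

theorem StructurallyControllable.reach {n p : ℕ} {A : Pattern n n} {b : Fin p → Fin n}
    (h : StructurallyControllable A (actuatorPattern b)) (x : Fin n) :
    ∃ i, StateReach A (b i) x := by
  by_contra hx
  push Not at hx
  obtain ⟨θ, hθ⟩ := h.exists
  set M := A.realize θ.1
  set B := (actuatorPattern b).realize θ.2
  have hsupp : ∀ k : ℕ, ∀ y, Matrix.vecMul (Pi.single x (1 : ℝ)) (M ^ k) y ≠ 0 →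
      StateReach A y x := by
    intro k
    induction k with
    | zero =>
      intro y hy
      by_cases hyx : y = x
      · rw [hyx]; exact Relation.ReflTransGen.refl
      · simp [hyx] at hy
    | succ k ih =>
      intro y hy
      rw [pow_succ, ← Matrix.vecMul_vecMul, vecMul_eq_sum] at hy
      obtain ⟨y', _, hy'⟩ := Finset.exists_ne_zero_of_sum_ne_zero hy
      refine Relation.ReflTransGen.head ?_ (ih y' (left_ne_zero_of_mul hy'))
      by_contra hne
      exact right_ne_zero_of_mul hy' (Pattern.realize_eq_zero (by simpa using hne))
  have h0 := eq_zero_of_rank_kalman hθ (x := Pi.single x 1) (by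
    intro k
    rw [← Matrix.vecMul_vecMul]
    funext i
    rw [vecMul_eq_sum]
    refine Finset.sum_eq_zero fun y _ => ?_
    by_contra hne
    have h1 := hsupp k y (left_ne_zero_of_mul hne)
    have h2 : b i = y := by
      by_contra hby
      exact right_ne_zero_of_mul hne (Pattern.realize_eq_zero (by simpa [actuatorPattern] using hby))
    exact hx i (h2 ▸ h1))
  have := congrFun h0 x
  simp at this

theorem IsMinActuation.reach {n p : ℕ} {A : Pattern n n} {b : Fin p → Fin n}
    (h : IsMinActuation A b) (x : Fin n) : ∃ i, StateReach A (b i) x :=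
  h.1.reach x

/-- No actuator of a minimum collection is redundant: it alone reaches some state. -/
theorem IsMinActuation.exists_private {n p : ℕ} {A : Pattern n n} {b : Fin p → Fin n}
    (hA : HasPerfectStateMatching A) (h : IsMinActuation A b) (i : Fin p) :
    ∃ x, ∀ i', StateReach A (b i') x → i' = i := by
  by_contra hne
  push Not at hne
  cases p with
  | zero => exact i.elim0
  | succ p =>
    have := h.2 p (b ∘ i.succAbove) (structurallyControllable_of_reach hA _ (by
      intro x
      obtain ⟨i', hi', hne'⟩ := hne x
      obtain ⟨k, rfl⟩ := Fin.exists_succAbove_eq hne'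
      exact ⟨k, hi'⟩))
    omega

theorem IsMinActuation.injective {n p : ℕ} {A : Pattern n n} {b : Fin p → Fin n}
    (hA : HasPerfectStateMatching A) (h : IsMinActuation A b) : Function.Injective b := by
  intro i i' hii
  obtain ⟨x, hx⟩ := h.exists_private hA i
  obtain ⟨k, hk⟩ := h.reach x
  have hki := hx k hk
  subst hki
  rw [hii] at hk
  exact (hx i' hk).symm

/-! ### Duality between actuators and sensors -/

theorem isObservable_iff {n m : ℕ} (M : Matrix (Fin n) (Fin n) ℝ) (C : Matrix (Fin m) (Fin n) ℝ) :
    IsObservable M C ↔ IsControllable M.transpose C.transpose := by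
  let K : Matrix (Fin n × Fin m) (Fin n) ℝ := fun e i => (C * M ^ (e.1 : ℕ)) e.2 i
  have h : (kalman M.transpose C.transpose) = K.transpose := by
    ext i e
    change (M.transpose ^ (e.1 : ℕ) * C.transpose) i e.2 = (C * M ^ (e.1 : ℕ)) e.2 i
    rw [← Matrix.transpose_pow, ← Matrix.transpose_mul]
    rfl
  have h2 := congrArg Matrix.rank h
  rw [Matrix.rank_transpose] at h2
  exact Eq.congr_left h2.symm

/-- The transposition of positions. -/
def flipIndex {r s : ℕ} (P : Pattern r s) : {e : Fin r × Fin s // P e.1 e.2 = true} ≃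
    {e : Fin s × Fin r // P.flip e.1 e.2 = true} :=
  (Equiv.prodComm (Fin r) (Fin s)).subtypeEquiv (fun _ => Iff.rfl)

/-- The transposition of the parameters of a pattern. -/
def flipParams {r s : ℕ} (P : Pattern r s) : P.Params ≃ᵐ P.flip.Params :=
  MeasurableEquiv.piCongrLeft (fun _ => ℝ) (flipIndex P)

theorem flipParams_measurePreserving {r s : ℕ} (P : Pattern r s) :
    MeasureTheory.MeasurePreserving (flipParams P) :=
  MeasureTheory.volume_measurePreserving_piCongrLeft (fun _ => ℝ) (flipIndex P)

theorem realize_flipParams {r s : ℕ} (P : Pattern r s) (θ : P.Params) :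
    P.flip.realize (flipParams P θ) = (P.realize θ).transpose := by
  ext i j
  by_cases h : P j i = true
  · have h' : P.flip i j = true := h
    simp only [Pattern.realize, Matrix.transpose_apply, dif_pos h, dif_pos h']
    exact Equiv.piCongrLeft_apply_apply (fun _ => ℝ) (flipIndex P) θ ⟨(j, i), h⟩
  · have h' : ¬ P.flip i j = true := h
    simp only [Pattern.realize, Matrix.transpose_apply, dif_neg h, dif_neg h']

theorem structurallyObservable_iff {n m : ℕ} (A : Pattern n n) (c : Fin m → Fin n) :
    StructurallyObservable A (sensorPattern c) ↔
      StructurallyControllable A.flip (actuatorPattern c) := by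
  have hmp := (flipParams_measurePreserving A).prod
    (flipParams_measurePreserving (sensorPattern c))
  have key : ∀ θ : A.Params × (sensorPattern c).Params,
      IsObservable (A.realize θ.1) ((sensorPattern c).realize θ.2) ↔
      IsControllable (A.flip.realize (flipParams A θ.1))
        (Pattern.realize (actuatorPattern c) (flipParams (sensorPattern c) θ.2)) := by
    intro θ
    rw [isObservable_iff, ← realize_flipParams, ← realize_flipParams]
    rfl
  unfold StructurallyObservable StructurallyControllable
  constructor
  · intro h
    have h2 := ((flipParams_measurePreserving A).symm).prod
      ((flipParams_measurePreserving (sensorPattern c)).symm)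
    have := h2.quasiMeasurePreserving.ae h
    filter_upwards [this] with θ hθ
    have h3 := (key _).1 hθ
    change IsControllable (A.flip.realize (flipParams A ((flipParams A).symm θ.1)))
      ((sensorPattern c).flip.realize
        (flipParams (sensorPattern c) ((flipParams (sensorPattern c)).symm θ.2))) at h3
    rw [MeasurableEquiv.apply_symm_apply] at h3
    exact (congrArg (fun η => IsControllable (A.flip.realize θ.1) ((sensorPattern c).flip.realize η))
      ((flipParams (sensorPattern c)).apply_symm_apply θ.2)).mp h3
  · intro h
    have := hmp.quasiMeasurePreserving.ae h
    filter_upwards [this] with θ hθ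
    rw [key]
    exact hθ

theorem IsMinSensing.dual {n m : ℕ} {A : Pattern n n} {c : Fin m → Fin n}
    (h : IsMinSensing A c) : IsMinActuation A.flip c :=
  ⟨(structurallyObservable_iff A c).1 h.1,
    fun m' c' h' => h.2 m' c' ((structurallyObservable_iff A c').2 h')⟩

theorem HasPerfectStateMatching.transpose {n : ℕ} {A : Pattern n n}
    (h : HasPerfectStateMatching A) : HasPerfectStateMatching A.flip := by
  classical
  obtain ⟨M, hM, hl, hr⟩ := h
  refine ⟨M.image Prod.swap, ⟨?_, ?_⟩, ?_, ?_⟩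
  · intro e he
    obtain ⟨e', he', rfl⟩ := Finset.mem_image.1 he
    exact hM.1 e' he'
  · intro e he f hf hef
    obtain ⟨e', he', rfl⟩ := Finset.mem_image.1 he
    obtain ⟨f', hf', rfl⟩ := Finset.mem_image.1 hf
    rw [hM.2 e' he' f' hf' hef.symm]
  · intro i
    obtain ⟨j, hj⟩ := hr i
    exact ⟨j, Finset.mem_image.2 ⟨_, hj, rfl⟩⟩
  · intro i
    obtain ⟨j, hj⟩ := hl i
    exact ⟨j, Finset.mem_image.2 ⟨_, hj, rfl⟩⟩

theorem stateReach_transpose {n : ℕ} {A : Pattern n n} {x y : Fin n} :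
    StateReach A.flip x y ↔ StateReach A y x := by
  unfold StateReach
  rw [← Relation.reflTransGen_swap]
  rfl

theorem IsMinSensing.reach {n m : ℕ} {A : Pattern n n} {c : Fin m → Fin n}
    (h : IsMinSensing A c) (x : Fin n) : ∃ j, StateReach A x (c j) := by
  obtain ⟨j, hj⟩ := h.dual.reach x
  exact ⟨j, stateReach_transpose.1 hj⟩

/-! ### Fixed modes -/

theorem mem_spectrum_iff_left {n : ℕ} {M : Matrix (Fin n) (Fin n) ℂ} {z : ℂ} :
    z ∈ spectrum ℂ M ↔ ∃ w, w ≠ 0 ∧ Matrix.vecMul w M = z • w := by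
  rw [spectrum.mem_iff, Matrix.isUnit_iff_isUnit_det, isUnit_iff_ne_zero, not_not,
    ← Matrix.exists_vecMul_eq_zero_iff]
  refine exists_congr fun w => and_congr_right fun _ => ?_
  rw [Matrix.vecMul_sub, sub_eq_zero, Algebra.algebraMap_eq_smul_one, Matrix.vecMul_smul,
    Matrix.vecMul_one]
  exact eq_comm

theorem mem_spectrum_iff_right {n : ℕ} {M : Matrix (Fin n) (Fin n) ℂ} {z : ℂ} :
    z ∈ spectrum ℂ M ↔ ∃ v, v ≠ 0 ∧ Matrix.mulVec M v = z • v := by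
  rw [spectrum.mem_iff, Matrix.isUnit_iff_isUnit_det, isUnit_iff_ne_zero, not_not,
    ← Matrix.exists_mulVec_eq_zero_iff]
  refine exists_congr fun w => and_congr_right fun _ => ?_
  rw [Matrix.sub_mulVec, sub_eq_zero, Algebra.algebraMap_eq_smul_one, Matrix.smul_mulVec,
    Matrix.one_mulVec]
  exact eq_comm

theorem fixedModes_transpose {n p m : ℕ} (A : Matrix (Fin n) (Fin n) ℝ)
    (B : Matrix (Fin n) (Fin p) ℝ) (C : Matrix (Fin m) (Fin n) ℝ) (K : Pattern p m) :
    fixedModes A.transpose C.transpose B.transpose K.flip =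
      fixedModes A B C K := by
  have hsp : ∀ (M : Matrix (Fin n) (Fin n) ℂ) (z : ℂ),
      z ∈ spectrum ℂ M.transpose ↔ z ∈ spectrum ℂ M := by
    intro M z
    rw [mem_spectrum_iff_left, mem_spectrum_iff_right]
    simp only [Matrix.vecMul_transpose]
  have hcl : ∀ G : Matrix (Fin p) (Fin m) ℝ,
      A.transpose + C.transpose * G.transpose * B.transpose = (A + B * G * C).transpose := by
    intro G
    rw [Matrix.transpose_add, Matrix.transpose_mul, Matrix.transpose_mul, Matrix.mul_assoc]
  ext z
  constructor
  · intro h G hG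
    have := h G.transpose (fun i j => hG j i)
    rw [hcl] at this
    exact (hsp _ z).1 this
  · intro h G hG
    have := h G.transpose (fun i j => hG j i)
    rw [← hsp] at this
    change z ∈ spectrum ℂ ((A.transpose + C.transpose * G.transpose.transpose * B.transpose).map _)
    rw [hcl]
    exact this

/-- A set of states that is closed under predecessors and receives no feedback keeps its modes. -/
theorem fixedModes_ne_empty {n p m : ℕ} {A : Matrix (Fin n) (Fin n) ℝ}
    {B : Matrix (Fin n) (Fin p) ℝ} {C : Matrix (Fin m) (Fin n) ℝ} {K : Pattern p m}
    (T : Set (Fin n)) (x₀ : Fin n) (hx₀ : x₀ ∈ T) (hA : ∀ x ∈ T, ∀ y, A x y ≠ 0 → y ∈ T)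
    (hB : ∀ x ∈ T, ∀ i, B x i ≠ 0 → ∀ j, K i j = false) : fixedModes A B C K ≠ ∅ := by
  let W : Submodule ℂ (Fin n → ℂ) :=
    { carrier := {w | ∀ x, x ∉ T → w x = 0}
      add_mem' := fun {a b} ha hb x hx => by simp [ha x hx, hb x hx]
      zero_mem' := fun x _ => rfl
      smul_mem' := fun c a ha x hx => by simp [ha x hx] }
  have hinv : ∀ w ∈ W, Matrix.vecMulLinear (A.map (algebraMap ℝ ℂ)) w ∈ W := by
    intro w hw y hy
    rw [Matrix.vecMulLinear_apply, vecMul_eq_sum]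
    refine Finset.sum_eq_zero fun x _ => ?_
    by_cases hx : x ∈ T
    · have : A x y = 0 := by
        by_contra h
        exact hy (hA x hx y h)
      simp [this]
    · rw [hw x hx, zero_mul]
  have hne : (⟨Pi.single x₀ 1, fun x hx => by
      have : x ≠ x₀ := fun h => hx (h ▸ hx₀)
      simp [this]⟩ : W) ≠ 0 := by
    intro h
    have := congrFun (congrArg Subtype.val h) x₀
    simp at this
  have : Nontrivial W := ⟨⟨_, _, hne⟩⟩
  obtain ⟨z, hz⟩ := Module.End.exists_eigenvalue
    ((Matrix.vecMulLinear (A.map (algebraMap ℝ ℂ))).restrict hinv)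
  obtain ⟨w, hw⟩ := hz.exists_hasEigenvector
  have h1 : Matrix.vecMul (w : Fin n → ℂ) (A.map (algebraMap ℝ ℂ)) = z • (w : Fin n → ℂ) := by
    have := congrArg Subtype.val hw.apply_eq_smul
    simpa using this
  refine Set.nonempty_iff_ne_empty.1 ⟨z, fun G hG => ?_⟩
  rw [mem_spectrum_iff_left]
  refine ⟨w, fun h => hw.2 (Subtype.ext h), ?_⟩
  have h2 : Matrix.vecMul (w : Fin n → ℂ) ((B * G).map (algebraMap ℝ ℂ)) = 0 := by
    funext j
    rw [vecMul_eq_sum]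
    refine Finset.sum_eq_zero fun x _ => ?_
    by_cases hx : x ∈ T
    · have : (B * G) x j = 0 := by
        rw [Matrix.mul_apply]
        refine Finset.sum_eq_zero fun i _ => ?_
        by_cases hBi : B x i = 0
        · simp [hBi]
        · rw [hG i j (hB x hx i hBi j), mul_zero]
      simp [this]
    · rw [w.2 x hx, zero_mul]
  have h3 : (A + B * G * C).map (algebraMap ℝ ℂ) = A.map (algebraMap ℝ ℂ) +
      (B * G).map (algebraMap ℝ ℂ) * C.map (algebraMap ℝ ℂ) := by
    rw [← Matrix.map_mul]
    ext i j
    simp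
  rw [h3, Matrix.vecMul_add, ← Matrix.vecMul_vecMul, h2, Matrix.zero_vecMul, add_zero, h1]

/-- If the closed loop is controllable from one end of a link and observable from the other end,
then a further gain on this link moves every mode. -/
theorem fixedModes_eq_empty {n p m : ℕ} {A : Matrix (Fin n) (Fin n) ℝ}
    {B : Matrix (Fin n) (Fin p) ℝ} {C : Matrix (Fin m) (Fin n) ℝ} {K : Pattern p m}
    {G : Matrix (Fin p) (Fin m) ℝ} (hG : ∀ i j, K i j = false → G i j = 0) {i : Fin p} {j : Fin m}
    (hK : K i j = true)
    (hc : EigenvectorTest (A + B * G * C) (B.submatrix id fun _ : Fin 1 => i))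
    (ho : EigenvectorTest (A + B * G * C).transpose (C.transpose.submatrix id fun _ : Fin 1 => j)) :
    fixedModes A B C K = ∅ := by
  rw [Set.eq_empty_iff_forall_notMem]
  intro z hz
  obtain ⟨w, hw0, hw⟩ := mem_spectrum_iff_left.1 (hz G hG)
  obtain ⟨v, hv0, hv⟩ := mem_spectrum_iff_right.1 (hz (G + Matrix.single i j 1) (by
    intro i' j' h
    have : ¬ (i = i' ∧ j = j') := by
      rintro ⟨rfl, rfl⟩
      rw [hK] at h
      exact Bool.noConfusion h
    simp [hG i' j' h, Matrix.single, this]))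
  set M := (A + B * G * C).map (algebraMap ℝ ℂ) with hM
  have h1 : (A + B * (G + Matrix.single i j 1) * C).map (algebraMap ℝ ℂ) =
      M + Matrix.vecMulVec (fun x => (B x i : ℂ)) (fun y => (C j y : ℂ)) := by
    rw [Matrix.mul_add, Matrix.add_mul, ← add_assoc]
    ext x y
    have : (B * Matrix.single i j (1 : ℝ) * C) x y = B x i * C j y := by
      rw [Matrix.mul_apply, Finset.sum_eq_single j]
      · simp
      · intro k _ hk
        rw [Matrix.mul_single_apply_of_ne _ _ _ _ _ hk, zero_mul]
      · simp
    rw [Matrix.map_apply, Matrix.add_apply, this]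
    simp [hM, Matrix.vecMulVec]
  rw [h1, Matrix.add_mulVec, Matrix.vecMulVec_mulVec] at hv
  have hwB : dotProduct w (fun x => (B x i : ℂ)) ≠ 0 := by
    intro h
    apply hw0
    refine hc z w hw ?_
    funext k
    exact h
  have hCv : dotProduct (fun y => (C j y : ℂ)) v = 0 := by
    have h2 := congrArg (fun y => dotProduct w y) hv
    simp only [dotProduct_add, dotProduct_smul, Matrix.dotProduct_mulVec, hw, smul_dotProduct,
      smul_eq_mul] at h2
    have h3 := left_eq_add.1 h2.symm
    simpa [hwB] using h3
  apply hv0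
  refine ho z v ?_ ?_
  · rw [Matrix.transpose_map, Matrix.vecMul_transpose]
    rw [hCv] at hv
    have h2 : M.mulVec v = z • v := by simpa using hv
    exact h2
  · funext k
    refine Eq.trans ?_ hCv
    simp only [Matrix.vecMul, dotProduct]
    exact Finset.sum_congr rfl fun x _ => mul_comm _ _

/-! ### Strongly connected closed loops have no fixed modes -/

/-- The edges of the closed loop between states: state edges, and feedback from the measured state
to the actuated state of a link. -/
def ClosedEdge {n p m : ℕ} (A : Pattern n n) (b : Fin p → Fin n) (c : Fin m → Fin n)
    (K : Pattern p m) (x y : Fin n) : Prop :=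
  A y x = true ∨ ∃ i j, K i j = true ∧ c j = x ∧ b i = y

/-- Every matrix supported on the closed loop is the closed-loop matrix of a realization with unit
actuators and sensors. -/
theorem exists_closedLoop_eq {n p m : ℕ} {A : Pattern n n} {b : Fin p → Fin n}
    {c : Fin m → Fin n} {K : Pattern p m} (hb : Function.Injective b) (hc : Function.Injective c)
    (M : Matrix (Fin n) (Fin n) ℝ) (hM : ∀ y x, ¬ ClosedEdge A b c K x y → M y x = 0) :
    ∃ (θ : A.Params) (g : K.Params),
      A.realize θ + inputMatrix b * K.realize g * (inputMatrix c).transpose = M := by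
  refine ⟨fun e => M e.1.1 e.1.2,
    fun e => if A (b e.1.1) (c e.1.2) = true then 0 else M (b e.1.1) (c e.1.2), ?_⟩
  set g : K.Params := fun e => if A (b e.1.1) (c e.1.2) = true then 0 else M (b e.1.1) (c e.1.2)
  ext x y
  have h1 : (inputMatrix b * K.realize g * (inputMatrix c).transpose) x y =
      ∑ j, ∑ i, (if b i = x ∧ c j = y then K.realize g i j else 0) := by
    rw [Matrix.mul_apply]
    refine Finset.sum_congr rfl fun j _ => ?_
    rw [Matrix.mul_apply, Finset.sum_mul]
    refine Finset.sum_congr rfl fun i _ => ?_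
    by_cases h1 : b i = x <;> by_cases h2 : c j = y <;> simp [inputMatrix, h1, h2]
  rw [Matrix.add_apply, h1]
  by_cases hA : A x y = true
  · rw [Finset.sum_eq_zero, add_zero]
    · simp [Pattern.realize, hA]
    · intro j _
      refine Finset.sum_eq_zero fun i _ => ?_
      by_cases h : b i = x ∧ c j = y
      · rw [if_pos h]
        by_cases hK : K i j = true
        · simp [Pattern.realize, hK, g, h.1, h.2, hA]
        · simp [Pattern.realize, hK]
      · rw [if_neg h]
  · have hA0 : A.realize (fun e => M e.1.1 e.1.2) x y = 0 :=
      Pattern.realize_eq_zero (by simpa using hA)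
    rw [hA0, zero_add]
    by_cases hex : ∃ i j, b i = x ∧ c j = y
    · obtain ⟨i, j, hi, hj⟩ := hex
      rw [Finset.sum_eq_single j, Finset.sum_eq_single i]
      · rw [if_pos ⟨hi, hj⟩]
        by_cases hK : K i j = true
        · simp [Pattern.realize, hK, g, hi, hj, hA]
        · rw [Pattern.realize_eq_zero (by simpa using hK), hM]
          rintro (h | ⟨i', j', h, hc', hb'⟩)
          · exact hA h
          · rw [hb (hb'.trans hi.symm), hc (hc'.trans hj.symm)] at h
            exact hK h
      · intro i' _ hne
        rw [if_neg]
        exact fun h => hne (hb (h.1.trans hi.symm))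
      · simp
      · intro j' _ hne
        refine Finset.sum_eq_zero fun i _ => ?_
        rw [if_neg]
        exact fun h => hne (hc (h.2.trans hj.symm))
      · simp
    · rw [hM]
      · refine Finset.sum_eq_zero fun j _ => Finset.sum_eq_zero fun i _ => ?_
        rw [if_neg]
        exact fun h => hex ⟨i, j, h⟩
      · rintro (h | ⟨i', j', h, hc', hb'⟩)
        · exact hA h
        · exact hex ⟨i', j', hb', hc'⟩

theorem noStructurallyFixedModes_of_reach {n p m : ℕ} {A : Pattern n n} {b : Fin p → Fin n}
    {c : Fin m → Fin n} {K : Pattern p m} (hA : HasPerfectStateMatching A)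
    (hb : Function.Injective b) (hc : Function.Injective c) {i₀ : Fin p} {j₀ : Fin m}
    (hK : K i₀ j₀ = true)
    (hin : ∀ x, Relation.ReflTransGen (ClosedEdge A b c K) (b i₀) x)
    (hout : ∀ x, Relation.ReflTransGen (ClosedEdge A b c K) x (c j₀)) :
    NoStructurallyFixedModes A (actuatorPattern b) (sensorPattern c) K := by
  obtain ⟨σ, hσ⟩ := hA.exists_perm
  have hgen := ((genericEval_pi {e : Fin n × Fin n // A e.1 e.2 = true}).prod
    ((genericEval_pi {e : Fin n × Fin p // actuatorPattern b e.1 e.2 = true}).prod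
      (genericEval_pi {e : Fin m × Fin n // sensorPattern c e.1 e.2 = true}))).prod
    (genericEval_pi {e : Fin p × Fin m // K e.1 e.2 = true})
  let AA := A.generic (fun e => Sum.inl (Sum.inl e) :
    _ → ({e : Fin n × Fin n // A e.1 e.2 = true} ⊕
      {e : Fin n × Fin p // actuatorPattern b e.1 e.2 = true} ⊕
      {e : Fin m × Fin n // sensorPattern c e.1 e.2 = true}) ⊕
      {e : Fin p × Fin m // K e.1 e.2 = true})
  let BB := (actuatorPattern b).generic (fun e => Sum.inl (Sum.inr (Sum.inl e)) :
    _ → ({e : Fin n × Fin n // A e.1 e.2 = true} ⊕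
      {e : Fin n × Fin p // actuatorPattern b e.1 e.2 = true} ⊕
      {e : Fin m × Fin n // sensorPattern c e.1 e.2 = true}) ⊕
      {e : Fin p × Fin m // K e.1 e.2 = true})
  let CC := (sensorPattern c).generic (fun e => Sum.inl (Sum.inr (Sum.inr e)) :
    _ → ({e : Fin n × Fin n // A e.1 e.2 = true} ⊕
      {e : Fin n × Fin p // actuatorPattern b e.1 e.2 = true} ⊕
      {e : Fin m × Fin n // sensorPattern c e.1 e.2 = true}) ⊕
      {e : Fin p × Fin m // K e.1 e.2 = true})
  let GG := K.generic (fun e => Sum.inr e :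
    _ → ({e : Fin n × Fin n // A e.1 e.2 = true} ⊕
      {e : Fin n × Fin p // actuatorPattern b e.1 e.2 = true} ⊕
      {e : Fin m × Fin n // sensorPattern c e.1 e.2 = true}) ⊕
      {e : Fin p × Fin m // K e.1 e.2 = true})
  -- Controllability from the actuator of the link, for almost all realizations and gains.
  have hctrl : ∀ᵐ θ : (A.Params × (actuatorPattern b).Params × (sensorPattern c).Params) ×
      K.Params, EigenvectorTest (A.realize θ.1.1 + (actuatorPattern b).realize θ.1.2.1 *
        K.realize θ.2 * (sensorPattern c).realize θ.1.2.2)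
      (((actuatorPattern b).realize θ.1.2.1).submatrix id fun _ : Fin 1 => i₀) := by
    obtain ⟨M, hM, hMt⟩ := exists_realization_eigenvectorTest (ClosedEdge A b c K) σ
      (fun x => Or.inl (hσ x)) (fun _ : Fin 1 => b i₀) (fun x => ⟨0, hin x⟩)
    obtain ⟨θ₀, g₀, h₀⟩ := exists_closedLoop_eq hb hc M hM
    have := hgen.ae_eigenvectorTest (AA + BB * GG * CC) (BB.submatrix id fun _ : Fin 1 => i₀)
      ((θ₀, fun _ => 1, fun _ => 1), g₀) (by
        rw [Matrix.map_add _ (map_add _), Matrix.map_mul, Matrix.map_mul, ← Matrix.submatrix_map]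
        simp only [AA, BB, CC, GG, Pattern.map_generic]
        change EigenvectorTest (A.realize θ₀ + (actuatorPattern b).realize (fun _ => 1) *
          K.realize g₀ * (sensorPattern c).realize (fun _ => 1))
          (((actuatorPattern b).realize (fun _ => 1)).submatrix id fun _ : Fin 1 => i₀)
        rw [realize_actuatorPattern_one, realize_sensorPattern_one, h₀]
        exact hMt)
    filter_upwards [this] with θ hθ
    rw [Matrix.map_add _ (map_add _), Matrix.map_mul, Matrix.map_mul,
      ← Matrix.submatrix_map] at hθ
    simp only [AA, BB, CC, GG, Pattern.map_generic] at hθ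
    exact hθ
  -- Dually, observability from the sensor of the link.
  have hobs : ∀ᵐ θ : (A.Params × (actuatorPattern b).Params × (sensorPattern c).Params) ×
      K.Params, EigenvectorTest (A.realize θ.1.1 + (actuatorPattern b).realize θ.1.2.1 *
        K.realize θ.2 * (sensorPattern c).realize θ.1.2.2).transpose
      (((sensorPattern c).realize θ.1.2.2).transpose.submatrix id fun _ : Fin 1 => j₀) := by
    obtain ⟨M, hM, hMt⟩ := exists_realization_eigenvectorTest
      (fun x y => ClosedEdge A b c K y x) σ⁻¹
      (fun x => by
        left
        have := hσ (σ⁻¹ x)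
        simpa using this) (fun _ : Fin 1 => c j₀)
      (fun x => ⟨0, Relation.reflTransGen_swap.1 (hout x)⟩)
    obtain ⟨θ₀, g₀, h₀⟩ := exists_closedLoop_eq hb hc M.transpose (fun y x h => hM x y h)
    have := hgen.ae_eigenvectorTest (AA + BB * GG * CC).transpose
      (CC.transpose.submatrix id fun _ : Fin 1 => j₀)
      ((θ₀, fun _ => 1, fun _ => 1), g₀) (by
        rw [Matrix.transpose_map, Matrix.map_add _ (map_add _), Matrix.map_mul, Matrix.map_mul,
          ← Matrix.submatrix_map, Matrix.transpose_map]
        simp only [AA, BB, CC, GG, Pattern.map_generic]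
        change EigenvectorTest (A.realize θ₀ + (actuatorPattern b).realize (fun _ => 1) *
          K.realize g₀ * (sensorPattern c).realize (fun _ => 1)).transpose
          (((sensorPattern c).realize (fun _ => 1)).transpose.submatrix id fun _ : Fin 1 => j₀)
        rw [realize_actuatorPattern_one, realize_sensorPattern_one, h₀]
        exact hMt)
    filter_upwards [this] with θ hθ
    rw [Matrix.transpose_map, Matrix.map_add _ (map_add _), Matrix.map_mul, Matrix.map_mul,
      ← Matrix.submatrix_map, Matrix.transpose_map] at hθ
    simp only [AA, BB, CC, GG, Pattern.map_generic] at hθ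
    exact hθ
  have h1 := MeasureTheory.Measure.ae_ae_of_ae_prod hctrl
  have h2 := MeasureTheory.Measure.ae_ae_of_ae_prod hobs
  filter_upwards [h1, h2] with θ hθ1 hθ2
  obtain ⟨g, hg1, hg2⟩ := (hθ1.and hθ2).exists
  exact fixedModes_eq_empty (fun i j h => Pattern.realize_eq_zero h) hK hg1 hg2

theorem fixedModes_ne_empty_of_actuator {n p m : ℕ} {A : Pattern n n}
    {b : Fin p → Fin n} (hA : HasPerfectStateMatching A)
    (hb : IsMinActuation A b) {K : Pattern p m} {i : Fin p} (hi : ∀ j, K i j = false)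
    (θ : A.Params × (actuatorPattern b).Params) (C : Matrix (Fin m) (Fin n) ℝ) :
    fixedModes (A.realize θ.1) ((actuatorPattern b).realize θ.2) C K ≠ ∅ := by
  obtain ⟨x₀, hx₀⟩ := hb.exists_private hA i
  refine fixedModes_ne_empty {x | ∀ i', StateReach A (b i') x → i' = i} x₀ hx₀ ?_ ?_
  · intro x hx y hxy i' hi'
    refine hx i' (hi'.tail ?_)
    by_contra h
    exact hxy (Pattern.realize_eq_zero (by simpa using h))
  · intro x hx i' hxi j
    have h1 : b i' = x := by
      by_contra h
      exact hxi (Pattern.realize_eq_zero (by simpa [actuatorPattern] using h))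
    rw [hx i' (by rw [h1]; exact Relation.ReflTransGen.refl)]
    exact hi j

theorem hasStructurallyFixedModes_of_actuator {n p m : ℕ} {A : Pattern n n}
    {b : Fin p → Fin n} {c : Fin m → Fin n} (hA : HasPerfectStateMatching A)
    (hb : IsMinActuation A b) {K : Pattern p m} {i : Fin p} (hi : ∀ j, K i j = false) :
    HasStructurallyFixedModes A (actuatorPattern b) (sensorPattern c) K :=
  Filter.Eventually.of_forall fun θ =>
    fixedModes_ne_empty_of_actuator hA hb hi (θ.1, θ.2.1) _

theorem hasStructurallyFixedModes_of_sensor {n p m : ℕ} {A : Pattern n n}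
    {b : Fin p → Fin n} {c : Fin m → Fin n} (hA : HasPerfectStateMatching A)
    (hc : IsMinSensing A c) {K : Pattern p m} {j : Fin m} (hj : ∀ i, K i j = false) :
    HasStructurallyFixedModes A (actuatorPattern b) (sensorPattern c) K := by
  refine Filter.Eventually.of_forall fun θ => ?_
  have h := fixedModes_ne_empty_of_actuator hA.transpose hc.dual
    (K := K.flip) (i := j) hj
    (flipParams A θ.1, flipParams (sensorPattern c) θ.2.2)
    ((actuatorPattern b).realize θ.2.1).transpose
  have e2 : (actuatorPattern c).realize (flipParams (sensorPattern c) θ.2.2) =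
      ((sensorPattern c).realize θ.2.2).transpose := realize_flipParams _ _
  rw [realize_flipParams] at h
  intro h0
  apply h
  refine Eq.trans (congrArg (fun B => fixedModes _ B _ K.flip) e2) ?_
  exact (fixedModes_transpose _ _ _ K).trans h0

/-! ### Results of the procedure -/

theorem reaches_iff {n p m : ℕ} {A : Pattern n n} {b : Fin p → Fin n} {c : Fin m → Fin n}
    {i : Fin p} {j : Fin m} : Reaches A b c i j ↔ StateReach A (b i) (c j) := by
  constructor
  · intro h
    have key : ∀ v, Relation.ReflTransGen (SysEdge A (actuatorPattern b) (sensorPattern c))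
        (.inr (.inl i)) v → (v = .inr (.inl i)) ∨ (∃ x, v = .inl x ∧ StateReach A (b i) x) ∨
          ∃ j, v = .inr (.inr j) ∧ StateReach A (b i) (c j) := by
      intro v hv
      induction hv with
      | refl => exact Or.inl rfl
      | @tail v w _ hvw ih =>
        right
        rcases ih with rfl | ⟨x, rfl, hx⟩ | ⟨j, rfl, hj⟩
        · rcases w with y | k | k
          · left
            have : b i = y := by simpa [SysEdge, actuatorPattern] using hvw
            exact ⟨y, rfl, this ▸ Relation.ReflTransGen.refl⟩
          · exact hvw.elim
          · exact hvw.elim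
        · rcases w with y | k | k
          · exact Or.inl ⟨y, rfl, hx.tail hvw⟩
          · exact hvw.elim
          · right
            have : c k = x := by simpa [SysEdge, sensorPattern] using hvw
            exact ⟨k, rfl, this ▸ hx⟩
        · rcases w with y | k | k <;> exact hvw.elim
    rcases key _ h with h | ⟨x, h, _⟩ | ⟨k, h, hk⟩
    · cases h
    · cases h
    · cases h
      exact hk
  · intro h
    have h1 : ∀ x, StateReach A (b i) x →
        Relation.ReflTransGen (SysEdge A (actuatorPattern b) (sensorPattern c))
          (.inr (.inl i)) (.inl x) := by
      intro x hx
      induction hx with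
      | refl => exact Relation.ReflTransGen.single (by simp [SysEdge, actuatorPattern])
      | tail _ hxy ih => exact ih.tail hxy
    exact (h1 _ h).tail (by simp [SysEdge, sensorPattern])

/-- A maximum matching leaves no edge with two unmatched ends. -/
theorem IsMaxBipMatching.matched {α β : Type} [DecidableEq α] [DecidableEq β] {R : α → β → Prop}
    {M : Finset (α × β)} (h : IsMaxBipMatching R M) {a : α} {b : β} (hab : R a b) :
    LeftMatched M a ∨ RightMatched M b := by
  by_contra hne
  push Not at hne
  obtain ⟨h1, h2⟩ := hne
  have h3 : (a, b) ∉ M := fun h => h1 ⟨b, h⟩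
  have := h.2 (insert (a, b) M) ⟨?_, ?_⟩
  · rw [Finset.card_insert_of_notMem h3] at this
    omega
  · intro e he
    rcases Finset.mem_insert.1 he with rfl | he
    · exact hab
    · exact h.1.1 e he
  · intro e he e' he' hee
    rcases Finset.mem_insert.1 he with rfl | he <;> rcases Finset.mem_insert.1 he' with rfl | he'
    · rfl
    · rcases hee with hee | hee
      · exact absurd ⟨e'.2, by simp only at hee; rw [hee]; exact he'⟩ h1
      · exact absurd ⟨e'.1, by simp only at hee; rw [hee]; exact he'⟩ h2
    · rcases hee with hee | hee
      · exact absurd ⟨e.2, by simp only at hee; rw [← hee]; exact he⟩ h1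
      · exact absurd ⟨e.1, by simp only at hee; rw [← hee]; exact he⟩ h2
    · exact h.1.2 e he e' he' hee

theorem nnz_linkPattern {p m : ℕ} (L : Finset (Fin m × Fin p)) : (linkPattern L).nnz = L.card := by
  unfold Pattern.nnz
  refine Finset.card_bij (fun e _ => (e.2, e.1)) ?_ ?_ ?_
  · intro e he
    simpa [linkPattern] using he
  · rintro ⟨a, b⟩ _ ⟨a', b'⟩ _ h
    simp only [Prod.mk.injEq] at h
    rw [h.1, h.2]
  · rintro ⟨a, b⟩ h
    exact ⟨(b, a), by simpa [linkPattern] using h, rfl⟩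

theorem IsProcedureResult.card_le {n p m : ℕ} {A : Pattern n n} {b : Fin p → Fin n}
    {c : Fin m → Fin n} {L : Finset (Fin m × Fin p)} (h : IsProcedureResult A b c L) :
    L.card ≤ max p m := by
  obtain ⟨M, L₁, L₂, hM, ⟨k, e, he, heM, rfl⟩, hL₂, rfl⟩ := h
  have hmem : ∀ t, e t ∈ M := fun t => heM ▸ Finset.mem_image_of_mem _ (Finset.mem_univ t)
  rcases hL₂ with ⟨hpm, h1, h2, _⟩ | ⟨hpm, h1, h2, _⟩
  · refine (Finset.card_le_card_of_injOn (t := Finset.univ) Prod.fst (by simp) ?_).trans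
      (by simp)
    intro l hl l' hl' hll
    simp only [Finset.coe_union, Set.mem_union, Finset.mem_coe, Finset.mem_image,
      Finset.mem_univ, true_and] at hl hl'
    rcases hl with ⟨t, rfl⟩ | hl <;> rcases hl' with ⟨t', rfl⟩ | hl'
    · have := he (hM.1.2 _ (hmem t) _ (hmem t') (Or.inr hll))
      rw [this]
    · refine absurd ⟨(e t).1, ?_⟩ (h2 l'.1 l'.2 hl')
      rw [← hll]
      exact hmem t
    · refine absurd ⟨(e t').1, ?_⟩ (h2 l.1 l.2 hl)
      rw [hll]
      exact hmem t'
    · have hj := h2 l.1 l.2 hl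
      refine Prod.ext hll ((h1 l.1 hj).unique hl ?_)
      rw [hll]
      exact hl'
  · refine (Finset.card_le_card_of_injOn (t := Finset.univ) Prod.snd (by simp) ?_).trans
      (by simp)
    intro l hl l' hl' hll
    simp only [Finset.coe_union, Set.mem_union, Finset.mem_coe, Finset.mem_image,
      Finset.mem_univ, true_and] at hl hl'
    rcases hl with ⟨t, rfl⟩ | hl <;> rcases hl' with ⟨t', rfl⟩ | hl'
    · have := (finRotate k).injective (he (hM.1.2 _ (hmem _) _ (hmem _) (Or.inl hll)))
      rw [this]
    · refine absurd ⟨(e (finRotate k t)).2, ?_⟩ (h2 l'.1 l'.2 hl')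
      rw [← hll]
      exact hmem _
    · refine absurd ⟨(e (finRotate k t')).2, ?_⟩ (h2 l.1 l.2 hl)
      rw [hll]
      exact hmem _
    · have hj := h2 l.1 l.2 hl
      refine Prod.ext ((h1 l.2 hj).unique hl ?_) hll
      rw [hll]
      exact hl'

theorem exists_finRotate_pow {k : ℕ} (s t : Fin k) : ∃ r : ℕ, ((finRotate k) ^ r) s = t := by
  cases k with
  | zero => exact s.elim0
  | succ k =>
    have h : ∀ r : ℕ, (((finRotate (k + 1)) ^ r) s : ℕ) = (s + r) % (k + 1) := by
      intro r
      induction r with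
      | zero => simp [Nat.mod_eq_of_lt s.2]
      | succ r ih =>
        rw [pow_succ', Equiv.Perm.mul_apply, finRotate_apply, Fin.val_add, ih, Fin.val_one',
          ← Nat.add_mod, add_assoc]
    refine ⟨t + (k + 1) - s, Fin.ext ?_⟩
    have h1 : (s : ℕ) + (t + (k + 1) - s) = t + (k + 1) := by omega
    rw [h, h1, Nat.add_mod_right, Nat.mod_eq_of_lt t.2]

/-- The closed loop of a result of the procedure is strongly connected: the sequential pairing
joins the matched vertices to a cycle, and since the matching is maximum every unmatched vertex
is joined to a matched one. -/
theorem IsProcedureResult.noStructurallyFixedModes {n p m : ℕ} {A : Pattern n n}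
    {b : Fin p → Fin n} {c : Fin m → Fin n} (hn : 0 < n) (hA : HasPerfectStateMatching A)
    (hb : IsMinActuation A b) (hc : IsMinSensing A c) {L : Finset (Fin m × Fin p)}
    (h : IsProcedureResult A b c L) :
    NoStructurallyFixedModes A (actuatorPattern b) (sensorPattern c) (linkPattern L) := by
  obtain ⟨M, L₁, L₂, hM, ⟨k, e, he, heM, hL₁⟩, hL₂, hL⟩ := h
  have hmem : ∀ t, e t ∈ M := fun t => heM ▸ Finset.mem_image_of_mem _ (Finset.mem_univ t)
  have hmem' : ∀ a ∈ M, ∃ t, e t = a := by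
    intro a ha
    rw [← heM] at ha
    obtain ⟨t, _, ht⟩ := Finset.mem_image.1 ha
    exact ⟨t, ht⟩
  have hk : 0 < k := by
    obtain ⟨i, hi⟩ := hb.reach ⟨0, hn⟩
    obtain ⟨j, hj⟩ := hc.reach ⟨0, hn⟩
    have hij : Reaches A b c i j := reaches_iff.2 (hi.trans hj)
    rcases hM.matched hij with ⟨j', h⟩ | ⟨i', h⟩ <;>
    · obtain ⟨t, _⟩ := hmem' _ h
      exact t.pos
  set R := Relation.ReflTransGen (ClosedEdge A b c (linkPattern L)) with hR
  have hst : ∀ x y, StateReach A x y → R x y := by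
    intro x y h
    induction h with
    | refl => exact Relation.ReflTransGen.refl
    | tail _ h ih => exact ih.tail (Or.inl h)
  have hlink : ∀ j i, (j, i) ∈ L → R (c j) (b i) := fun j i h =>
    Relation.ReflTransGen.single (Or.inr ⟨i, j, by simpa [linkPattern] using h, rfl, rfl⟩)
  have hMR : ∀ i j, (i, j) ∈ M → R (b i) (c j) := fun i j h =>
    hst _ _ (reaches_iff.1 (hM.1.1 _ h))
  have hrot : ∀ t, ((e t).2, (e (finRotate k t)).1) ∈ L := by
    intro t
    rw [hL, Finset.mem_union]
    left
    rw [hL₁]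
    exact Finset.mem_image_of_mem (fun t => ((e t).2, (e (finRotate k t)).1)) (Finset.mem_univ t)
  have hstep : ∀ t, R (b (e t).1) (b (e (finRotate k t)).1) := fun t =>
    (hMR _ _ (hmem t)).trans (hlink _ _ (hrot t))
  have hcyc : ∀ s t, R (b (e s).1) (b (e t).1) := by
    intro s t
    obtain ⟨r, rfl⟩ := exists_finRotate_pow s t
    induction r with
    | zero => exact Relation.ReflTransGen.refl
    | succ r ih =>
      rw [pow_succ', Equiv.Perm.mul_apply]
      exact ih.trans (hstep _)
  have ha : ∀ i, ¬ LeftMatched M i → ∃ j, (j, i) ∈ L := by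
    intro i hi
    rcases hL₂ with ⟨_, _, _, h⟩ | ⟨_, h, _, _⟩
    · obtain ⟨j, hj⟩ := h i hi
      exact ⟨j, by rw [hL]; exact Finset.mem_union_right _ hj⟩
    · obtain ⟨j, hj, _⟩ := h i hi
      exact ⟨j, by rw [hL]; exact Finset.mem_union_right _ hj⟩
  have hs : ∀ j, ¬ RightMatched M j → ∃ i, (j, i) ∈ L := by
    intro j hj
    rcases hL₂ with ⟨_, h, _, _⟩ | ⟨_, _, _, h⟩
    · obtain ⟨i, hi, _⟩ := h j hj
      exact ⟨i, by rw [hL]; exact Finset.mem_union_right _ hi⟩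
    · obtain ⟨i, hi⟩ := h j hj
      exact ⟨i, by rw [hL]; exact Finset.mem_union_right _ hi⟩
  let t₀ : Fin k := ⟨0, hk⟩
  have hfromM : ∀ i, LeftMatched M i → R (b (e t₀).1) (b i) := by
    rintro i ⟨j, hij⟩
    obtain ⟨t, ht⟩ := hmem' _ hij
    have := hcyc t₀ t
    rwa [ht] at this
  have htoM : ∀ i, LeftMatched M i → R (b i) (b (e t₀).1) := by
    rintro i ⟨j, hij⟩
    obtain ⟨t, ht⟩ := hmem' _ hij
    have := hcyc t t₀
    rwa [ht] at this
  have htoS : ∀ j, RightMatched M j → R (c j) (b (e t₀).1) := by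
    rintro j ⟨i, hij⟩
    obtain ⟨t, ht⟩ := hmem' _ hij
    have := (hlink _ _ (hrot t)).trans (hcyc _ t₀)
    rwa [ht] at this
  have hfromS : ∀ j, R (b (e t₀).1) (c j) := by
    intro j
    by_cases hj : RightMatched M j
    · obtain ⟨i, hij⟩ := hj
      exact (hfromM i ⟨j, hij⟩).trans (hMR _ _ hij)
    · obtain ⟨i, hi⟩ := hb.reach (c j)
      have hi' := (hM.matched (reaches_iff.2 hi)).resolve_right hj
      exact (hfromM i hi').trans (hst _ _ hi)
  have hto : ∀ i, R (b i) (b (e t₀).1) := by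
    intro i
    by_cases hi : LeftMatched M i
    · exact htoM i hi
    · obtain ⟨j, hj⟩ := hc.reach (b i)
      have hj' := (hM.matched (reaches_iff.2 hj)).resolve_left hi
      exact (hst _ _ hj).trans (htoS j hj')
  have hfrom : ∀ i, R (b (e t₀).1) (b i) := by
    intro i
    by_cases hi : LeftMatched M i
    · exact hfromM i hi
    · obtain ⟨j, hj⟩ := ha i hi
      exact (hfromS j).trans (hlink _ _ hj)
  have htoS' : ∀ j, R (c j) (b (e t₀).1) := by
    intro j
    by_cases hj : RightMatched M j
    · exact htoS j hj
    · obtain ⟨i, hi⟩ := hs j hj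
      exact (hlink _ _ hi).trans (hto i)
  refine noStructurallyFixedModes_of_reach hA (hb.injective hA) (hc.dual.injective hA.transpose)
    (i₀ := (e (finRotate k t₀)).1) (j₀ := (e t₀).2) (by simpa [linkPattern] using hrot t₀) ?_ ?_
  · intro x
    obtain ⟨i, hi⟩ := hb.reach x
    exact (hto _).trans ((hfrom i).trans (hst _ _ hi))
  · intro x
    obtain ⟨j, hj⟩ := hc.reach x
    exact (hst _ _ hj).trans ((htoS' j).trans (hfromS _))

/-- A pattern with fewer links than actuators or sensors leaves one of them without a link. -/
theorem IsProcedureResult.isSparsestPattern {n p m : ℕ} {A : Pattern n n}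
    {b : Fin p → Fin n} {c : Fin m → Fin n} (hn : 0 < n) (hA : HasPerfectStateMatching A)
    (hb : IsMinActuation A b) (hc : IsMinSensing A c) {L : Finset (Fin m × Fin p)}
    (h : IsProcedureResult A b c L) :
    IsSparsestPattern A (actuatorPattern b) (sensorPattern c) (linkPattern L) := by
  refine ⟨h.noStructurallyFixedModes hn hA hb hc, fun K' hK' => ?_⟩
  rw [nnz_linkPattern] at hK'
  have hlt := hK'.trans_le h.card_le
  rcases lt_max_iff.1 hlt with hlt | hlt
  · have : ∃ i, ∀ j, K' i j = false := by
      by_contra hne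
      push Not at hne
      choose f hf using hne
      have := Finset.card_le_card_of_injOn (s := (Finset.univ : Finset (Fin p)))
        (t := Finset.univ.filter fun e : Fin p × Fin m => K' e.1 e.2 = true)
        (fun i => (i, f i)) (by intro i _; simpa using hf i)
        (by intro i _ i' _ h; exact congrArg Prod.fst h)
      rw [Finset.card_univ, Fintype.card_fin] at this
      exact absurd hlt (not_lt.2 this)
    obtain ⟨i, hi⟩ := this
    exact hasStructurallyFixedModes_of_actuator hA hb hi
  · have : ∃ j, ∀ i, K' i j = false := by
      by_contra hne
      push Not at hne
      choose f hf using hne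
      have := Finset.card_le_card_of_injOn (s := (Finset.univ : Finset (Fin m)))
        (t := Finset.univ.filter fun e : Fin p × Fin m => K' e.1 e.2 = true)
        (fun j => (f j, j)) (by intro i _; simpa using hf i)
        (by intro i _ i' _ h; exact congrArg Prod.snd h)
      rw [Finset.card_univ, Fintype.card_fin] at this
      exact absurd hlt (not_lt.2 this)
    obtain ⟨j, hj⟩ := this
    exact hasStructurallyFixedModes_of_sensor hA hc hj

/-! ### A structured language for the random access machine -/

/-- The variables of structured programs. The numbers of states, actuators, sensors and edges are
`nS`, `nA`, `nO`, `nE`; `top`, `seen`, `done` belong to the graph search, and `free`, `unseen`,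
`todo`, `found`, `go` to the matching; the others hold intermediate values. -/
inductive Var where
  | nS | nA | nO | nE | ii | jj | tt | xx | ww | vv | aa | top | seen | done | sens | yy | found | free
  | unseen | todo | go
  deriving DecidableEq

/-- The arrays of structured programs; each is indexed by all natural numbers. The tables `pow` and
`idx` hold powers of two and their logarithms; `adj`, `act`, `own` the input; `cm`, `ca`, `cs` the
stack of the graph search; `res` and `row` the sensors that a state or an actuator reaches; `ml`,
`mr`, `par` the matching and the search forest; `al`, `sl` the ends of the links. -/
inductive Arr where
  | pow | idx | adj | act | own | cm | ca | cs | res | row | ml | mr | par | al | sl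
  deriving DecidableEq

/-- Expressions. -/
inductive Expr where
  | lit (v : ℕ)
  | var (x : Var)
  | add (a b : Expr)
  | sub (a b : Expr)
  | and (a b : Expr)
  | or (a b : Expr)
  | get (k : Arr) (a : Expr)

/-- Structured commands. The cells below the arrays, which hold the input and the output, are
accessed by `read` and `write`. -/
inductive Cmd where
  | skip
  | set (x : Var) (e : Expr)
  | put (k : Arr) (a e : Expr)
  | read (x : Var) (a : Expr)
  | write (a e : Expr)
  | seq (c d : Cmd)
  | ite (e : Expr) (c d : Cmd)
  | loop (e : Expr) (c : Cmd)

/-- The state of a structured program. The ghost component `time` counts commands. -/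
structure Env where
  var : Var → ℕ
  arr : Arr → ℕ → ℕ
  raw : ℕ → ℕ
  time : ℕ

namespace Env

/-- One unit of time passes. -/
def tick (s : Env) : Env := { s with time := s.time + 1 }

/-- Assignment to a variable. -/
def setVar (s : Env) (x : Var) (v : ℕ) : Env :=
  { s with var := fun y => if y = x then v else s.var y, time := s.time + 1 }

/-- Assignment to an array element. -/
def putArr (s : Env) (k : Arr) (a v : ℕ) : Env :=
  { s with arr := fun l b => if l = k ∧ b = a then v else s.arr l b, time := s.time + 1 }

/-- Assignment to a cell below the arrays. -/
def putRaw (s : Env) (a v : ℕ) : Env :=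
  { s with raw := fun b => if b = a then v else s.raw b, time := s.time + 1 }

variable (s : Env) (x y : Var) (k l : Arr) (a b v : ℕ)

@[simp] theorem tick_var : s.tick.var = s.var := rfl
@[simp] theorem tick_arr : s.tick.arr = s.arr := rfl
@[simp] theorem tick_raw : s.tick.raw = s.raw := rfl
@[simp] theorem tick_time : s.tick.time = s.time + 1 := rfl
@[simp] theorem setVar_var : (s.setVar x v).var y = if y = x then v else s.var y := rfl
@[simp] theorem setVar_arr : (s.setVar x v).arr = s.arr := rfl
@[simp] theorem setVar_raw : (s.setVar x v).raw = s.raw := rfl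
@[simp] theorem setVar_time : (s.setVar x v).time = s.time + 1 := rfl
@[simp] theorem putArr_var : (s.putArr k a v).var = s.var := rfl
theorem putArr_arr :
    (s.putArr k a v).arr l b = if l = k ∧ b = a then v else s.arr l b := rfl
@[simp] theorem putArr_arr_same :
    (s.putArr k a v).arr k b = if b = a then v else s.arr k b := by simp [putArr_arr]
@[simp] theorem putArr_arr_of_ne (h : l ≠ k) : (s.putArr k a v).arr l = s.arr l := by
  funext b
  simp [putArr_arr, h]
@[simp] theorem putArr_raw : (s.putArr k a v).raw = s.raw := rfl
@[simp] theorem putArr_time : (s.putArr k a v).time = s.time + 1 := rfl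
@[simp] theorem putRaw_var : (s.putRaw a v).var = s.var := rfl
@[simp] theorem putRaw_arr : (s.putRaw a v).arr = s.arr := rfl
@[simp] theorem putRaw_raw : (s.putRaw a v).raw b = if b = a then v else s.raw b := rfl
@[simp] theorem putRaw_time : (s.putRaw a v).time = s.time + 1 := rfl

end Env

/-- The value of an expression. -/
def Expr.eval (s : Env) : Expr → ℕ
  | lit v => v
  | var x => s.var x
  | add a b => a.eval s + b.eval s
  | sub a b => a.eval s - b.eval s
  | and a b => a.eval s &&& b.eval s
  | or a b => a.eval s ||| b.eval s
  | get k a => s.arr k (a.eval s)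

attribute [simp] Expr.eval

/-- The runs of a loop with guard `g` and body `R`. -/
inductive LoopRun (g : Env → ℕ) (R : Env → Env → Prop) : Env → Env → Prop
  | exit (s : Env) : g s = 0 → LoopRun g R s s.tick
  | next (s s' t : Env) : g s ≠ 0 → R s.tick s' → LoopRun g R s' t → LoopRun g R s t

/-- `c.Run B s t`: the command `c` leads from `s` to `t`, accessing no cell from `B` on by `read`
and `write`. -/
def Cmd.Run (B : ℕ) : Cmd → Env → Env → Prop
  | skip, s, t => t = s
  | set x e, s, t => t = s.setVar x (e.eval s)
  | put k a e, s, t => t = s.putArr k (a.eval s) (e.eval s)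
  | read x a, s, t => a.eval s < B ∧ t = s.setVar x (s.raw (a.eval s))
  | write a e, s, t => a.eval s < B ∧ t = s.putRaw (a.eval s) (e.eval s)
  | seq c d, s, t => ∃ u, c.Run B s u ∧ d.Run B u t
  | ite e c d, s, t => (e.eval s ≠ 0 ∧ c.Run B s.tick t) ∨ (e.eval s = 0 ∧ d.Run B s.tick t)
  | loop e c, s, t => LoopRun (fun s => e.eval s) (c.Run B) s t

/-- The weakest precondition of `Q` for total correctness. -/
def Cmd.wp (B : ℕ) (c : Cmd) (Q : Env → Prop) (s : Env) : Prop := ∃ t, c.Run B s t ∧ Q t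

namespace Cmd

variable {B : ℕ} {Q : Env → Prop} {s : Env}

@[simp] theorem wp_skip : skip.wp B Q s ↔ Q s := by simp [wp, Run]

@[simp] theorem wp_set {x : Var} {e : Expr} :
    (set x e).wp B Q s ↔ Q (s.setVar x (e.eval s)) := by simp [wp, Run]

@[simp] theorem wp_put {k : Arr} {a e : Expr} :
    (put k a e).wp B Q s ↔ Q (s.putArr k (a.eval s) (e.eval s)) := by simp [wp, Run]

@[simp] theorem wp_read {x : Var} {a : Expr} :
    (read x a).wp B Q s ↔ a.eval s < B ∧ Q (s.setVar x (s.raw (a.eval s))) := by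
  simp [wp, Run]

@[simp] theorem wp_write {a e : Expr} :
    (write a e).wp B Q s ↔ a.eval s < B ∧ Q (s.putRaw (a.eval s) (e.eval s)) := by
  simp [wp, Run]

@[simp] theorem wp_seq {c d : Cmd} : (seq c d).wp B Q s ↔ c.wp B (d.wp B Q) s := by
  simp only [wp, Run]
  constructor
  · rintro ⟨t, ⟨u, h1, h2⟩, h3⟩
    exact ⟨u, h1, t, h2, h3⟩
  · rintro ⟨u, h1, t, h2, h3⟩
    exact ⟨t, ⟨u, h1, h2⟩, h3⟩

theorem wp_ite {e : Expr} {c d : Cmd} : (ite e c d).wp B Q s ↔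
    (e.eval s ≠ 0 → c.wp B Q s.tick) ∧ (e.eval s = 0 → d.wp B Q s.tick) := by
  simp only [wp, Run]
  by_cases h : e.eval s = 0 <;> simp [h]

theorem wp_mono {c : Cmd} {Q' : Env → Prop} (h : c.wp B Q s) (hQ : ∀ t, Q t → Q' t) :
    c.wp B Q' s := by
  obtain ⟨t, h1, h2⟩ := h
  exact ⟨t, h1, hQ t h2⟩

/-- The command may assign to the variable. -/
def writesVar : Cmd → Var → Bool
  | set x _, y => x = y
  | read x _, y => x = y
  | seq c d, y => c.writesVar y || d.writesVar y
  | ite _ c d, y => c.writesVar y || d.writesVar y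
  | loop _ c, y => c.writesVar y
  | _, _ => false

/-- The command may assign to the array. -/
def writesArr : Cmd → Arr → Bool
  | put k _ _, l => k = l
  | seq c d, y => c.writesArr y || d.writesArr y
  | ite _ c d, y => c.writesArr y || d.writesArr y
  | loop _ c, y => c.writesArr y
  | _, _ => false

/-- The command may assign to cells below the arrays. -/
def writesRaw : Cmd → Bool
  | write _ _ => true
  | seq c d => c.writesRaw || d.writesRaw
  | ite _ c d => c.writesRaw || d.writesRaw
  | loop _ c => c.writesRaw
  | _ => false

/-- What the command does not assign to is the same in `s` and `t`. -/
structure Frame (c : Cmd) (s t : Env) : Prop where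
  var : ∀ x, c.writesVar x = false → t.var x = s.var x
  arr : ∀ k, c.writesArr k = false → t.arr k = s.arr k
  raw : c.writesRaw = false → t.raw = s.raw
  time : s.time ≤ t.time

theorem Frame.refl (c : Cmd) (s : Env) : c.Frame s s :=
  ⟨fun _ _ => rfl, fun _ _ => rfl, fun _ => rfl, le_rfl⟩

theorem Frame.trans {c : Cmd} {s t u : Env} (h : c.Frame s t) (h' : c.Frame t u) : c.Frame s u :=
  ⟨fun x hx => (h'.var x hx).trans (h.var x hx), fun k hk => (h'.arr k hk).trans (h.arr k hk),
    fun hr => (h'.raw hr).trans (h.raw hr), h.time.trans h'.time⟩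

theorem Frame.of_loopRun {g : Env → ℕ} {c : Cmd} {s t : Env}
    (hc : ∀ s t, c.Run B s t → c.Frame s t) (h : LoopRun g (c.Run B) s t) : c.Frame s t := by
  induction h with
  | exit s _ => exact ⟨fun _ _ => rfl, fun _ _ => rfl, fun _ => rfl, by simp⟩
  | next s s' t _ h1 _ ih =>
    have h2 := hc _ _ h1
    have h3 : c.Frame s s.tick := ⟨fun _ _ => rfl, fun _ _ => rfl, fun _ => rfl, by simp⟩
    exact (h3.trans h2).trans ih

theorem Run.frame {c : Cmd} {s t : Env} (h : c.Run B s t) : c.Frame s t := by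
  induction c generalizing s t with
  | skip => cases h; exact Frame.refl _ _
  | set x e =>
    cases h
    refine ⟨fun y hy => ?_, fun _ _ => rfl, fun _ => rfl, by simp⟩
    have : y ≠ x := by rintro rfl; simp [writesVar] at hy
    simp [this]
  | put k a e =>
    cases h
    refine ⟨fun _ _ => rfl, fun l hl => ?_, fun _ => rfl, by simp⟩
    have : l ≠ k := by rintro rfl; simp [writesArr] at hl
    simp [this]
  | read x a =>
    obtain ⟨_, rfl⟩ := h
    refine ⟨fun y hy => ?_, fun _ _ => rfl, fun _ => rfl, by simp⟩
    have : y ≠ x := by rintro rfl; simp [writesVar] at hy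
    simp [this]
  | write a e =>
    obtain ⟨_, rfl⟩ := h
    exact ⟨fun _ _ => rfl, fun _ _ => rfl, fun h => by simp [writesRaw] at h, by simp⟩
  | seq c d hc hd =>
    obtain ⟨u, h1, h2⟩ := h
    have f1 := hc h1
    have f2 := hd h2
    refine ⟨fun x hx => ?_, fun k hk => ?_, fun hr => ?_, f1.time.trans f2.time⟩
    · simp only [writesVar, Bool.or_eq_false_iff] at hx
      exact (f2.var x hx.2).trans (f1.var x hx.1)
    · simp only [writesArr, Bool.or_eq_false_iff] at hk
      exact (f2.arr k hk.2).trans (f1.arr k hk.1)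
    · simp only [writesRaw, Bool.or_eq_false_iff] at hr
      exact (f2.raw hr.2).trans (f1.raw hr.1)
  | ite e c d hc hd =>
    rcases h with ⟨_, h⟩ | ⟨_, h⟩
    · have f1 := hc h
      refine ⟨fun x hx => ?_, fun k hk => ?_, fun hr => ?_, by have := f1.time; simp at this; omega⟩
      · simp only [writesVar, Bool.or_eq_false_iff] at hx
        exact f1.var x hx.1
      · simp only [writesArr, Bool.or_eq_false_iff] at hk
        exact f1.arr k hk.1
      · simp only [writesRaw, Bool.or_eq_false_iff] at hr
        exact f1.raw hr.1
    · have f1 := hd h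
      refine ⟨fun x hx => ?_, fun k hk => ?_, fun hr => ?_, by have := f1.time; simp at this; omega⟩
      · simp only [writesVar, Bool.or_eq_false_iff] at hx
        exact f1.var x hx.2
      · simp only [writesArr, Bool.or_eq_false_iff] at hk
        exact f1.arr k hk.2
      · simp only [writesRaw, Bool.or_eq_false_iff] at hr
        exact f1.raw hr.2
  | loop e c hc =>
    have := Frame.of_loopRun (fun _ _ h => hc h) h
    exact ⟨this.var, this.arr, this.raw, this.time⟩

theorem wp_frame {c : Cmd} (h : c.wp B Q s) : c.wp B (fun t => Q t ∧ c.Frame s t) s := by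
  obtain ⟨t, h1, h2⟩ := h
  exact ⟨t, h1, h2, h1.frame⟩

/-- Total correctness of loops. The invariant `I φ s` says that there is a credit `φ` left in the
state `s`; the body preserves it and pays for its time from the credit. As each iteration takes
time, this also proves termination. -/
theorem wp_loop {e : Expr} {c : Cmd} (I : ℕ → Env → Prop) {φ₀ : ℕ} {s₀ : Env} (h₀ : I φ₀ s₀)
    (hbody : ∀ φ s, I φ s → c.Frame s₀ s → e.eval s ≠ 0 →
      c.wp B (fun t => ∃ φ', I φ' t ∧ t.time + φ' ≤ s.time + φ) s.tick)
    (hQ : ∀ φ t, I φ t → c.Frame s₀ t → e.eval t = 0 → t.time + φ ≤ s₀.time + φ₀ → Q t.tick) :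
    (loop e c).wp B Q s₀ := by
  have key : ∀ φ s, I φ s → c.Frame s₀ s → s.time + φ ≤ s₀.time + φ₀ →
      ∃ t, LoopRun (fun s => e.eval s) (c.Run B) s t ∧ Q t := by
    intro φ
    induction φ using Nat.strong_induction_on with
    | _ φ ih =>
      intro s hI hF hT
      by_cases hg : e.eval s = 0
      · exact ⟨_, LoopRun.exit s hg, hQ φ s hI hF hg hT⟩
      · obtain ⟨t, h1, φ', h2, h3⟩ := hbody φ s hI hF hg
        have h4 := h1.frame
        have h5 := h4.time
        simp only [Env.tick_time] at h5
        have h6 : c.Frame s s.tick := ⟨fun _ _ => rfl, fun _ _ => rfl, fun _ => rfl, by simp⟩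
        obtain ⟨u, h7, h8⟩ := ih φ' (by omega) t h2 (hF.trans (h6.trans h4)) (by omega)
        exact ⟨u, LoopRun.next s t u hg h1 h7, h8⟩
  exact key _ s₀ h₀ (Frame.refl _ _) le_rfl

end Cmd

/-! ### Compilation -/

/-- The register of a variable. Register `0` keeps the value zero, register `1` holds the address
where the arrays start, and the registers from `64` on hold intermediate results. -/
def Var.reg (x : Var) : ℕ := x.ctorIdx + 2

theorem Var.reg_lt (x : Var) : x.reg < 64 := by cases x <;> decide

theorem Var.two_le_reg (x : Var) : 2 ≤ x.reg := Nat.le_add_left _ _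

theorem Var.reg_injective : Function.Injective Var.reg := by
  intro x y h
  have h1 : x.ctorIdx = y.ctorIdx := Nat.add_right_cancel h
  cases x <;> cases y <;> first | rfl | cases h1

/-- The number of an array. -/
def Arr.num (k : Arr) : ℕ := k.ctorIdx

theorem Arr.num_lt (k : Arr) : k.num < 16 := by cases k <;> decide

theorem Arr.num_injective : Function.Injective Arr.num := by
  intro x y h
  have h1 : x.ctorIdx = y.ctorIdx := h
  cases x <;> cases y <;> first | rfl | cases h1

/-- Replaces an index in register `t` by the address of the array element: the arrays are
interleaved, element `a` of array number `k` has the address `B + 16 * a + k`. -/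
def addrCode (k : Arr) (t : ℕ) : List RamInstr :=
  [.add t t t, .add t t t, .add t t t, .add t t t, .add t t 1, .const (t + 1) k.num,
    .add t t (t + 1)]

/-- Code that puts the value of an expression into register `t`. -/
def Expr.code : Expr → ℕ → List RamInstr
  | lit v, t => [.const t v]
  | var x, t => [.add t x.reg 0]
  | add a b, t => a.code t ++ b.code (t + 1) ++ [.add t t (t + 1)]
  | sub a b, t => a.code t ++ b.code (t + 1) ++ [.sub t t (t + 1)]
  | and a b, t => a.code t ++ b.code (t + 1) ++ [.and t t (t + 1)]
  | or a b, t => a.code t ++ b.code (t + 1) ++ [.or t t (t + 1)]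
  | get k a, t => a.code t ++ addrCode k t ++ [.load t t]

/-- The length of the code of a command. -/
def Cmd.len : Cmd → ℕ
  | skip => 0
  | set _ e => (e.code 64).length + 1
  | put k a e => (a.code 64).length + (addrCode k 64).length + (e.code 65).length + 1
  | read _ a => (a.code 64).length + 1
  | write a e => (a.code 64).length + (e.code 65).length + 1
  | seq c d => c.len + d.len
  | ite e c d => (e.code 64).length + 1 + c.len + 1 + d.len
  | loop e c => (e.code 64).length + 1 + c.len + 1

/-- The code of a command, to be placed at position `pc`. -/
def Cmd.code : Cmd → ℕ → List RamInstr
  | skip, _ => []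
  | set x e, _ => e.code 64 ++ [.add x.reg 64 0]
  | put k a e, _ => a.code 64 ++ addrCode k 64 ++ e.code 65 ++ [.store 64 65]
  | read x a, _ => a.code 64 ++ [.load x.reg 64]
  | write a e, _ => a.code 64 ++ e.code 65 ++ [.store 64 65]
  | seq c d, pc => c.code pc ++ d.code (pc + c.len)
  | ite e c d, pc =>
    e.code 64 ++ [.jumpZero 64 (pc + (e.code 64).length + 1 + c.len + 1)] ++
      c.code (pc + (e.code 64).length + 1) ++
      [.jumpZero 0 (pc + (e.code 64).length + 1 + c.len + 1 + d.len)] ++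
      d.code (pc + (e.code 64).length + 1 + c.len + 1)
  | loop e c, pc =>
    e.code 64 ++ [.jumpZero 64 (pc + (e.code 64).length + 1 + c.len + 1)] ++
      c.code (pc + (e.code 64).length + 1) ++ [.jumpZero 0 pc]

theorem Cmd.length_code (c : Cmd) (pc : ℕ) : (c.code pc).length = c.len := by
  induction c generalizing pc with
  | skip => rfl
  | set x e => simp [code, len]
  | put k a e => simp [code, len]; omega
  | read x a => simp [code, len]
  | write a e => simp [code, len]; omega
  | seq c d hc hd => simp [code, len, hc, hd]
  | ite e c d hc hd => simp [code, len, hc, hd]; omega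
  | loop e c hc => simp [code, len, hc]; omega

/-- The instruction always continues at the next position. -/
def RamInstr.Straight (q : RamInstr) : Prop := ∀ s, (q.exec s).pc = s.pc + 1

theorem RamInstr.straight_of_ne {q : RamInstr} (h : ∀ a l, q ≠ .jumpZero a l) : q.Straight := by
  intro s
  cases q <;> first | rfl | exact absurd rfl (h _ _)

/-- The effect of a sequence of instructions without jumps. -/
def execAll (l : List RamInstr) (s : RamState) : RamState := l.foldl (fun s q => q.exec s) s

theorem execAll_append (l l' : List RamInstr) (s : RamState) :
    execAll (l ++ l') s = execAll l' (execAll l s) := List.foldl_append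

theorem step_iterate_straight (pre l post : List RamInstr) (s : RamState)
    (hl : ∀ q ∈ l, q.Straight) (hs : s.pc = pre.length) :
    (RamProgram.step (pre ++ l ++ post))^[l.length] s = execAll l s ∧
      (execAll l s).pc = pre.length + l.length := by
  induction l generalizing pre s with
  | nil => simp [execAll, hs]
  | cons q l ih =>
    have h1 : RamProgram.step (pre ++ q :: l ++ post) s = q.exec s := by
      unfold RamProgram.step
      have : (pre ++ q :: l ++ post)[s.pc]? = some q := by
        rw [hs]
        simp
      rw [this]
    have h2 := ih (pre ++ [q]) (q.exec s) (fun r hr => hl r (List.mem_cons_of_mem _ hr)) (by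
      rw [hl q List.mem_cons_self s, hs]
      simp)
    have h3 : pre ++ [q] ++ l ++ post = pre ++ q :: l ++ post := by simp
    rw [h3] at h2
    refine ⟨?_, ?_⟩
    · rw [List.length_cons, Function.iterate_succ_apply, h1, h2.1]
      rfl
    · have : execAll (q :: l) s = execAll l (q.exec s) := rfl
      rw [this, h2.2]
      simp
      omega

theorem addrCode_straight (k : Arr) (t : ℕ) : ∀ q ∈ addrCode k t, q.Straight := by
  intro q hq
  apply RamInstr.straight_of_ne
  rintro a l rfl
  simp [addrCode] at hq

theorem Expr.code_straight (e : Expr) (t : ℕ) : ∀ q ∈ e.code t, q.Straight := by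
  have hbin : ∀ (l l' : List RamInstr) (q : RamInstr), (∀ r ∈ l, r.Straight) →
      (∀ r ∈ l', r.Straight) → q.Straight → ∀ r ∈ l ++ l' ++ [q], r.Straight := by
    intro l l' q h1 h2 h3 r hr
    simp only [List.mem_append, List.mem_singleton] at hr
    rcases hr with (hr | hr) | rfl
    · exact h1 r hr
    · exact h2 r hr
    · exact h3
  induction e generalizing t with
  | lit v =>
    intro q hq
    rw [code, List.mem_singleton] at hq
    subst hq
    exact fun _ => rfl
  | var x =>
    intro q hq
    rw [code, List.mem_singleton] at hq
    subst hq
    exact fun _ => rfl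
  | add a b ha hb => exact hbin _ _ _ (ha _) (hb _) fun _ => rfl
  | sub a b ha hb => exact hbin _ _ _ (ha _) (hb _) fun _ => rfl
  | and a b ha hb => exact hbin _ _ _ (ha _) (hb _) fun _ => rfl
  | or a b ha hb => exact hbin _ _ _ (ha _) (hb _) fun _ => rfl
  | get k a ha => exact hbin _ _ _ (ha _) (addrCode_straight k t) fun _ => rfl

/-- The registers below `64` and the memory of the machine represent the state of the structured
program, the arrays starting at address `B`. -/
structure Represents (B : ℕ) (s : Env) (σ : RamState) : Prop where
  zero : σ.reg 0 = 0
  base : σ.reg 1 = B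
  var : ∀ x : Var, σ.reg x.reg = s.var x
  raw : ∀ a < B, σ.mem a = s.raw a
  arr : ∀ (k : Arr) (a : ℕ), σ.mem (B + 16 * a + k.num) = s.arr k a

theorem Represents.congr {B : ℕ} {s : Env} {σ σ' : RamState} (h : Represents B s σ)
    (hreg : ∀ r < 64, σ'.reg r = σ.reg r) (hmem : σ'.mem = σ.mem) : Represents B s σ' := by
  refine ⟨?_, ?_, ?_, ?_, ?_⟩
  · rw [hreg 0 (by omega), h.zero]
  · rw [hreg 1 (by omega), h.base]
  · intro x
    rw [hreg _ x.reg_lt, h.var]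
  · rw [hmem]
    exact h.raw
  · rw [hmem]
    exact h.arr

theorem execAll_addrCode {k : Arr} {t B a : ℕ} {σ : RamState} (ht : 2 ≤ t) (hB : σ.reg 1 = B)
    (ha : σ.reg t = a) :
    (execAll (addrCode k t) σ).mem = σ.mem ∧
      (∀ r < t, (execAll (addrCode k t) σ).reg r = σ.reg r) ∧
      (execAll (addrCode k t) σ).reg t = B + 16 * a + k.num := by
  refine ⟨rfl, fun r hr => ?_, ?_⟩
  · have h1 : r ≠ t := by omega
    have h2 : r ≠ t + 1 := by omega
    simp [execAll, addrCode, RamInstr.exec, RamState.setReg, Function.update, h1, h2]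
  · have h1 : (1 : ℕ) ≠ t := by omega
    simp [execAll, addrCode, RamInstr.exec, RamState.setReg, Function.update, h1, hB, ha]
    omega

/-- The code of the expression computes its value, with no effect on the lower registers and on the
memory. -/
def Expr.CodeCorrect (B : ℕ) (s : Env) (e : Expr) : Prop :=
  ∀ (t : ℕ) (σ : RamState), 64 ≤ t → Represents B s σ →
    (execAll (e.code t) σ).mem = σ.mem ∧
      (∀ r < t, (execAll (e.code t) σ).reg r = σ.reg r) ∧
      (execAll (e.code t) σ).reg t = e.eval s

theorem execAll_binary {B : ℕ} {s : Env} {a b : Expr} (ha : a.CodeCorrect B s)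
    (hb : b.CodeCorrect B s) {t : ℕ} {σ : RamState} {q : RamInstr} {v : ℕ} (ht : 64 ≤ t)
    (h : Represents B s σ) (hq : ∀ σ : RamState, σ.reg t = a.eval s → σ.reg (t + 1) = b.eval s →
      q.exec σ = σ.setReg t v) :
    (execAll (a.code t ++ b.code (t + 1) ++ [q]) σ).mem = σ.mem ∧
      (∀ r < t, (execAll (a.code t ++ b.code (t + 1) ++ [q]) σ).reg r = σ.reg r) ∧
      (execAll (a.code t ++ b.code (t + 1) ++ [q]) σ).reg t = v := by
  obtain ⟨a1, a2, a3⟩ := ha t σ ht h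
  have h1 := h.congr (fun r hr => a2 r (by omega)) a1
  obtain ⟨b1, b2, b3⟩ := hb (t + 1) _ (by omega) h1
  rw [execAll_append, execAll_append]
  set σ₁ := execAll (a.code t) σ
  set σ₂ := execAll (b.code (t + 1)) σ₁
  have : execAll [q] σ₂ = σ₂.setReg t v := hq σ₂ (by rw [b2 t (by omega), a3]) b3
  rw [this]
  refine ⟨b1.trans a1, fun r hr => ?_, ?_⟩
  · have hrt : r ≠ t := by omega
    simp only [RamState.setReg, Function.update, hrt, dite_false]
    rw [b2 r (by omega), a2 r hr]
  · simp [RamState.setReg]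

theorem Expr.codeCorrect (B : ℕ) (s : Env) (e : Expr) : e.CodeCorrect B s := by
  induction e with
  | lit v =>
    refine fun t σ _ _ => ⟨rfl, fun r hr => ?_, ?_⟩
    · have hrt : r ≠ t := by omega
      simp [code, execAll, RamInstr.exec, RamState.setReg, hrt]
    · simp [code, execAll, RamInstr.exec, RamState.setReg]
  | var x =>
    refine fun t σ _ h => ⟨rfl, fun r hr => ?_, ?_⟩
    · have hrt : r ≠ t := by omega
      simp [code, execAll, RamInstr.exec, RamState.setReg, hrt]
    · simp [code, execAll, RamInstr.exec, RamState.setReg, h.var, h.zero]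
  | add a b ha hb =>
    exact fun t σ ht h => execAll_binary ha hb ht h fun σ h1 h2 => by simp [RamInstr.exec, h1, h2]
  | sub a b ha hb =>
    exact fun t σ ht h => execAll_binary ha hb ht h fun σ h1 h2 => by simp [RamInstr.exec, h1, h2]
  | and a b ha hb =>
    exact fun t σ ht h => execAll_binary ha hb ht h fun σ h1 h2 => by simp [RamInstr.exec, h1, h2]
  | or a b ha hb =>
    exact fun t σ ht h => execAll_binary ha hb ht h fun σ h1 h2 => by simp [RamInstr.exec, h1, h2]
  | get k a ha =>
    intro t σ ht h
    obtain ⟨a1, a2, a3⟩ := ha t σ ht h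
    obtain ⟨b1, b2, b3⟩ := execAll_addrCode (k := k) (t := t) (B := B)
      (σ := execAll (a.code t) σ) (by omega) (by rw [a2 1 (by omega), h.base]) a3
    rw [code, execAll_append, execAll_append]
    set σ₁ := execAll (a.code t) σ
    set σ₂ := execAll (addrCode k t) σ₁
    refine ⟨b1.trans a1, fun r hr => ?_, ?_⟩
    · have hrt : r ≠ t := by omega
      simp [execAll, RamInstr.exec, RamState.setReg, hrt, b2 r hr, a2 r hr]
    · simp [execAll, RamInstr.exec, RamState.setReg, b3, b1, a1, h.arr]

theorem Represents.setReg {B : ℕ} {s : Env} {σ : RamState} (h : Represents B s σ) (x : Var)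
    (v : ℕ) : Represents B (s.setVar x v) (σ.setReg x.reg v) := by
  have h0 := x.two_le_reg
  refine ⟨?_, ?_, ?_, h.raw, h.arr⟩
  · have : 0 ≠ x.reg := by omega
    simp [RamState.setReg, Function.update, this, h.zero]
  · have : 1 ≠ x.reg := by omega
    simp [RamState.setReg, Function.update, this, h.base]
  · intro y
    by_cases hy : y = x
    · simp [RamState.setReg, hy]
    · have : y.reg ≠ x.reg := fun h => hy (Var.reg_injective h)
      simp [RamState.setReg, Function.update, this, hy, h.var]

theorem Represents.store_arr {B : ℕ} {s : Env} {σ : RamState} (h : Represents B s σ) (k : Arr)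
    (a v pc : ℕ) : Represents B (s.putArr k a v)
      ⟨pc, σ.reg, Function.update σ.mem (B + 16 * a + k.num) v⟩ := by
  have hk := k.num_lt
  refine ⟨h.zero, h.base, h.var, fun b hb => ?_, fun l b => ?_⟩
  · have : b ≠ B + 16 * a + k.num := by omega
    simp [this, h.raw b hb]
  · have hl := l.num_lt
    rw [Env.putArr_arr]
    by_cases hlk : l = k ∧ b = a
    · simp [hlk.1, hlk.2]
    · have : B + 16 * b + l.num ≠ B + 16 * a + k.num := by
        intro heq
        have h1 : l.num = k.num := by omega
        exact hlk ⟨Arr.num_injective h1, by omega⟩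
      simp only [Function.update, this, dite_false, if_neg hlk]
      exact h.arr l b

theorem Represents.store_raw {B : ℕ} {s : Env} {σ : RamState} (h : Represents B s σ)
    (a v pc : ℕ) (ha : a < B) : Represents B (s.putRaw a v)
      ⟨pc, σ.reg, Function.update σ.mem a v⟩ := by
  refine ⟨h.zero, h.base, h.var, fun b hb => ?_, fun l b => ?_⟩
  · by_cases hb' : b = a
    · simp [hb']
    · simp [hb', h.raw b hb]
  · have : B + 16 * b + l.num ≠ a := by omega
    simp [this, h.arr]

theorem step_at {pre post : List RamInstr} {q : RamInstr} {σ : RamState}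
    (h : σ.pc = pre.length) : RamProgram.step (pre ++ q :: post) σ = q.exec σ := by
  unfold RamProgram.step
  rw [h]
  simp

/-- The machine run on compiled code simulates the structured program with at most `K` steps for
each unit of time. -/
def Cmd.Simulated (B K : ℕ) (c : Cmd) : Prop :=
  ∀ (pre post : List RamInstr) (s t : Env) (σ : RamState), σ.pc = pre.length →
    Represents B s σ → c.Run B s t →
    ∃ (N : ℕ) (σ' : RamState), (RamProgram.step (pre ++ c.code pre.length ++ post))^[N] σ = σ' ∧
      σ'.pc = pre.length + c.len ∧ Represents B t σ' ∧ N + K * s.time ≤ K * t.time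

/-- Runs the code of an expression at the given position. -/
theorem run_expr_code {B : ℕ} {s : Env} {σ : RamState} (e : Expr) (pre post : List RamInstr)
    (hpc : σ.pc = pre.length) (h : Represents B s σ) :
    ∃ σ', (RamProgram.step (pre ++ e.code 64 ++ post))^[(e.code 64).length] σ = σ' ∧
      σ'.pc = pre.length + (e.code 64).length ∧ Represents B s σ' ∧ σ'.reg 64 = e.eval s := by
  obtain ⟨h1, h2⟩ := step_iterate_straight pre (e.code 64) post σ (e.code_straight 64) hpc
  obtain ⟨h3, h4, h5⟩ := e.codeCorrect B s 64 σ le_rfl h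
  exact ⟨_, h1, h2, h.congr h4 h3, h5⟩

theorem Cmd.simulated_straight {B K : ℕ} {c : Cmd} (hK : c.len ≤ K)
    (hs : ∀ pc, ∀ q ∈ c.code pc, q.Straight)
    (ht : ∀ s t, c.Run B s t → s.time + 1 ≤ t.time)
    (h : ∀ (pc : ℕ) (s t : Env) (σ : RamState), Represents B s σ → c.Run B s t →
      Represents B t (execAll (c.code pc) σ)) : c.Simulated B K := by
  intro pre post s t σ hpc hr hrun
  obtain ⟨h1, h2⟩ := step_iterate_straight pre (c.code pre.length) post σ (hs _) hpc
  rw [c.length_code] at h1 h2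
  refine ⟨c.len, _, h1, h2, h _ _ _ _ hr hrun, ?_⟩
  have := Nat.mul_le_mul_left K (ht s t hrun)
  rw [Nat.mul_add, Nat.mul_one] at this
  omega

theorem Cmd.simulated (B K : ℕ) (c : Cmd) (hK : c.len ≤ K) : c.Simulated B K := by
  induction c with
  | skip =>
    intro pre post s t σ hpc hr hrun
    cases hrun
    exact ⟨0, σ, rfl, hpc, hr, by omega⟩
  | set x e =>
    refine simulated_straight hK (fun pc q hq => ?_) (fun s t h => by cases h; simp) ?_
    · rw [code, List.mem_append, List.mem_singleton] at hq
      rcases hq with hq | rfl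
      · exact e.code_straight _ q hq
      · exact fun _ => rfl
    · intro pc s t σ hr hrun
      cases hrun
      obtain ⟨h3, h4, h5⟩ := e.codeCorrect B s 64 σ le_rfl hr
      have h6 := hr.congr h4 h3
      rw [code, execAll_append]
      have h7 : execAll [.add x.reg 64 0] (execAll (e.code 64) σ) =
          (execAll (e.code 64) σ).setReg x.reg
            ((execAll (e.code 64) σ).reg 64 + (execAll (e.code 64) σ).reg 0) := rfl
      rw [h7, h5, h6.zero, Nat.add_zero]
      exact h6.setReg x _
  | put k a e =>
    refine simulated_straight hK (fun pc q hq => ?_) (fun s t h => by cases h; simp) ?_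
    · simp only [code, List.mem_append, List.mem_singleton] at hq
      rcases hq with ((hq | hq) | hq) | rfl
      · exact a.code_straight _ q hq
      · exact addrCode_straight _ _ q hq
      · exact e.code_straight _ q hq
      · exact fun _ => rfl
    · intro pc s t σ hr hrun
      cases hrun
      obtain ⟨a1, a2, a3⟩ := a.codeCorrect B s 64 σ le_rfl hr
      obtain ⟨b1, b2, b3⟩ := execAll_addrCode (k := k) (t := 64) (B := B)
        (σ := execAll (a.code 64) σ) (by omega) (by rw [a2 1 (by omega), hr.base]) a3
      have h1 := (hr.congr a2 a1).congr b2 b1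
      obtain ⟨c1, c2, c3⟩ := e.codeCorrect B s 65 _ (by omega) h1
      have h2 := h1.congr (fun r hr => c2 r (by omega)) c1
      rw [code, execAll_append, execAll_append, execAll_append]
      have h3 := h2.store_arr k (a.eval s) (e.eval s)
        ((execAll (e.code 65) (execAll (addrCode k 64) (execAll (a.code 64) σ))).pc + 1)
      have h4 := c2 64 (by omega)
      rw [b3] at h4
      set σ₃ := execAll (e.code 65) (execAll (addrCode k 64) (execAll (a.code 64) σ))
      have h5 : execAll [.store 64 65] σ₃ =
          ⟨σ₃.pc + 1, σ₃.reg, Function.update σ₃.mem (σ₃.reg 64) (σ₃.reg 65)⟩ := rfl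
      rw [h5, h4, c3]
      exact h3
  | read x a =>
    refine simulated_straight hK (fun pc q hq => ?_) (fun s t h => by obtain ⟨_, rfl⟩ := h; simp) ?_
    · rw [code, List.mem_append, List.mem_singleton] at hq
      rcases hq with hq | rfl
      · exact a.code_straight _ q hq
      · exact fun _ => rfl
    · intro pc s t σ hr hrun
      obtain ⟨hlt, rfl⟩ := hrun
      obtain ⟨h3, h4, h5⟩ := a.codeCorrect B s 64 σ le_rfl hr
      have h6 := hr.congr h4 h3
      rw [code, execAll_append]
      have h7 : execAll [.load x.reg 64] (execAll (a.code 64) σ) =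
          (execAll (a.code 64) σ).setReg x.reg
            ((execAll (a.code 64) σ).mem ((execAll (a.code 64) σ).reg 64)) := rfl
      rw [h7, h5, h6.raw _ hlt]
      exact h6.setReg x _
  | write a e =>
    refine simulated_straight hK (fun pc q hq => ?_) (fun s t h => by obtain ⟨_, rfl⟩ := h; simp) ?_
    · simp only [code, List.mem_append, List.mem_singleton] at hq
      rcases hq with (hq | hq) | rfl
      · exact a.code_straight _ q hq
      · exact e.code_straight _ q hq
      · exact fun _ => rfl
    · intro pc s t σ hr hrun
      obtain ⟨hlt, rfl⟩ := hrun
      obtain ⟨a1, a2, a3⟩ := a.codeCorrect B s 64 σ le_rfl hr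
      have h1 := hr.congr a2 a1
      obtain ⟨c1, c2, c3⟩ := e.codeCorrect B s 65 _ (by omega) h1
      have h2 := h1.congr (fun r hr => c2 r (by omega)) c1
      rw [code, execAll_append, execAll_append]
      have h3 := h2.store_raw (a.eval s) (e.eval s)
        ((execAll (e.code 65) (execAll (a.code 64) σ)).pc + 1) hlt
      have h4 := c2 64 (by omega)
      rw [a3] at h4
      set σ₃ := execAll (e.code 65) (execAll (a.code 64) σ)
      have h5 : execAll [.store 64 65] σ₃ =
          ⟨σ₃.pc + 1, σ₃.reg, Function.update σ₃.mem (σ₃.reg 64) (σ₃.reg 65)⟩ := rfl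
      rw [h5, h4, c3]
      exact h3
  | seq c d hc hd =>
    intro pre post s t σ hpc hr hrun
    obtain ⟨u, h1, h2⟩ := hrun
    rw [len] at hK
    obtain ⟨N₁, σ₁, a1, a2, a3, a4⟩ := hc (by omega) pre (d.code (pre.length + c.len) ++ post) s u σ
      hpc hr h1
    have e2 : (pre ++ c.code pre.length).length = pre.length + c.len := by
      rw [List.length_append, c.length_code]
    obtain ⟨N₂, σ₂, b1, b2, b3, b4⟩ := hd (by omega) (pre ++ c.code pre.length) post u t σ₁
      (by rw [e2, a2]) a3 h2
    rw [e2] at b1 b2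
    refine ⟨N₂ + N₁, σ₂, ?_, by rw [b2, len]; omega, b3, by omega⟩
    rw [Function.iterate_add_apply]
    have e3 : pre ++ (seq c d).code pre.length ++ post =
        pre ++ c.code pre.length ++ (d.code (pre.length + c.len) ++ post) := by
      simp [code]
    have e4 : pre ++ (seq c d).code pre.length ++ post =
        pre ++ c.code pre.length ++ d.code (pre.length + c.len) ++ post := by
      simp [code]
    rw [e3, a1, ← e3, e4, b1]
  | ite e c d hc hd =>
    intro pre post s t σ hpc hr hrun
    rw [len] at hK
    set E := e.code 64 with hE
    set P := pre ++ (ite e c d).code pre.length ++ post with hP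
    have e1 : P = pre ++ E ++ (.jumpZero 64 (pre.length + E.length + 1 + c.len + 1) ::
        (c.code (pre.length + E.length + 1) ++
          .jumpZero 0 (pre.length + E.length + 1 + c.len + 1 + d.len) ::
          (d.code (pre.length + E.length + 1 + c.len + 1) ++ post))) := by
      simp [hP, code, hE]
    obtain ⟨σ₁, a1, a2, a3, a4⟩ := run_expr_code e pre
      (.jumpZero 64 (pre.length + E.length + 1 + c.len + 1) ::
        (c.code (pre.length + E.length + 1) ++
          .jumpZero 0 (pre.length + E.length + 1 + c.len + 1 + d.len) ::
          (d.code (pre.length + E.length + 1 + c.len + 1) ++ post))) hpc hr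
    rw [← hE, ← e1] at a1
    rw [← hE] at a2
    have b1 : RamProgram.step P σ₁ = RamInstr.exec σ₁
        (.jumpZero 64 (pre.length + E.length + 1 + c.len + 1)) := by
      rw [e1]
      exact step_at (by rw [a2, List.length_append])
    rcases hrun with ⟨hne, hrun⟩ | ⟨heq, hrun⟩
    · have b2 : RamProgram.step P σ₁ = ⟨σ₁.pc + 1, σ₁.reg, σ₁.mem⟩ := by
        rw [b1]
        simp [RamInstr.exec, a4, hne]
      have e2 : P = (pre ++ E ++ [RamInstr.jumpZero 64 (pre.length + E.length + 1 + c.len + 1)]) ++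
          c.code (pre.length + E.length + 1) ++
          (.jumpZero 0 (pre.length + E.length + 1 + c.len + 1 + d.len) ::
          (d.code (pre.length + E.length + 1 + c.len + 1) ++ post)) := by
        simp [e1]
      have e3 : (pre ++ E ++ [RamInstr.jumpZero 64 (pre.length + E.length + 1 + c.len + 1)]).length =
          pre.length + E.length + 1 := by simp; omega
      obtain ⟨N, σ₂, c1, c2, c3, c4⟩ := hc (by omega)
        (pre ++ E ++ [.jumpZero 64 (pre.length + E.length + 1 + c.len + 1)])
        (.jumpZero 0 (pre.length + E.length + 1 + c.len + 1 + d.len) ::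
          (d.code (pre.length + E.length + 1 + c.len + 1) ++ post)) s.tick t
        ⟨σ₁.pc + 1, σ₁.reg, σ₁.mem⟩ (by rw [e3, a2])
        ⟨a3.zero, a3.base, a3.var, a3.raw, a3.arr⟩ hrun
      rw [e3, ← e2] at c1
      rw [e3] at c2
      have d1 : RamProgram.step P σ₂ = ⟨pre.length + E.length + 1 + c.len + 1 + d.len, σ₂.reg, σ₂.mem⟩ := by
        have : P = (pre ++ E ++ [RamInstr.jumpZero 64 (pre.length + E.length + 1 + c.len + 1)] ++
          c.code (pre.length + E.length + 1)) ++
          (.jumpZero 0 (pre.length + E.length + 1 + c.len + 1 + d.len) ::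
          (d.code (pre.length + E.length + 1 + c.len + 1) ++ post)) := e2
        rw [this, step_at (by rw [List.length_append, e3, c.length_code, c2])]
        simp [RamInstr.exec, c3.zero]
      refine ⟨1 + (N + (1 + E.length)),
        ⟨pre.length + E.length + 1 + c.len + 1 + d.len, σ₂.reg, σ₂.mem⟩, ?_, ?_, ?_, ?_⟩
      · rw [Function.iterate_add_apply, Function.iterate_add_apply, Function.iterate_add_apply,
          a1, Function.iterate_one, b2, c1, d1]
      · simp only [len]
        rw [← hE]
        omega
      · exact ⟨c3.zero, c3.base, c3.var, c3.raw, c3.arr⟩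
      · simp only [Env.tick_time, Nat.mul_add, Nat.mul_one] at c4
        omega
    · have b2 : RamProgram.step P σ₁ = ⟨pre.length + E.length + 1 + c.len + 1, σ₁.reg, σ₁.mem⟩ := by
        rw [b1]
        simp [RamInstr.exec, a4, heq]
      have e2 : P = (pre ++ E ++ [RamInstr.jumpZero 64 (pre.length + E.length + 1 + c.len + 1)] ++
          c.code (pre.length + E.length + 1) ++
          [.jumpZero 0 (pre.length + E.length + 1 + c.len + 1 + d.len)]) ++
          d.code (pre.length + E.length + 1 + c.len + 1) ++ post := by
        simp [e1]
      have e3 : (pre ++ E ++ [RamInstr.jumpZero 64 (pre.length + E.length + 1 + c.len + 1)] ++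
          c.code (pre.length + E.length + 1) ++
          [RamInstr.jumpZero 0 (pre.length + E.length + 1 + c.len + 1 + d.len)]).length =
          pre.length + E.length + 1 + c.len + 1 := by simp [c.length_code]; omega
      obtain ⟨N, σ₂, c1, c2, c3, c4⟩ := hd (by omega)
        (pre ++ E ++ [.jumpZero 64 (pre.length + E.length + 1 + c.len + 1)] ++
          c.code (pre.length + E.length + 1) ++
          [.jumpZero 0 (pre.length + E.length + 1 + c.len + 1 + d.len)]) post s.tick t
        ⟨pre.length + E.length + 1 + c.len + 1, σ₁.reg, σ₁.mem⟩ (by rw [e3])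
        ⟨a3.zero, a3.base, a3.var, a3.raw, a3.arr⟩ hrun
      rw [e3, ← e2] at c1
      rw [e3] at c2
      refine ⟨N + (1 + E.length), σ₂, ?_, ?_, c3, ?_⟩
      · rw [Function.iterate_add_apply, Function.iterate_add_apply,
          a1, Function.iterate_one, b2, c1]
      · simp only [len]
        rw [← hE, c2]
        omega
      · simp only [Env.tick_time, Nat.mul_add, Nat.mul_one] at c4
        omega
  | loop e c hc =>
    intro pre post s t σ hpc hr hrun
    rw [len] at hK
    set E := e.code 64 with hE
    set P := pre ++ (loop e c).code pre.length ++ post with hP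
    have e1 : P = pre ++ E ++ (.jumpZero 64 (pre.length + E.length + 1 + c.len + 1) ::
        (c.code (pre.length + E.length + 1) ++ .jumpZero 0 pre.length :: post)) := by
      simp [hP, code, hE]
    simp only [Run] at hrun
    induction hrun generalizing σ with
    | exit s hg =>
      obtain ⟨σ₁, a1, a2, a3, a4⟩ := run_expr_code e pre
        (.jumpZero 64 (pre.length + E.length + 1 + c.len + 1) ::
        (c.code (pre.length + E.length + 1) ++ .jumpZero 0 pre.length :: post)) hpc hr
      rw [← hE, ← e1] at a1
      rw [← hE] at a2
      have b2 : RamProgram.step P σ₁ = ⟨pre.length + E.length + 1 + c.len + 1, σ₁.reg, σ₁.mem⟩ := by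
        rw [e1, step_at (by rw [a2, List.length_append])]
        simp [RamInstr.exec, a4, hg]
      refine ⟨1 + E.length, ⟨pre.length + E.length + 1 + c.len + 1, σ₁.reg, σ₁.mem⟩, ?_, ?_,
        ⟨a3.zero, a3.base, a3.var, a3.raw, a3.arr⟩, ?_⟩
      · rw [Function.iterate_add_apply, a1, Function.iterate_one, b2]
      · simp only [len]
        rw [← hE]
        omega
      · simp only [Env.tick_time, Nat.mul_add, Nat.mul_one]
        omega
    | next s s' t hg hbody _ ih =>
      obtain ⟨σ₁, a1, a2, a3, a4⟩ := run_expr_code e pre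
        (.jumpZero 64 (pre.length + E.length + 1 + c.len + 1) ::
        (c.code (pre.length + E.length + 1) ++ .jumpZero 0 pre.length :: post)) hpc hr
      rw [← hE, ← e1] at a1
      rw [← hE] at a2
      have b2 : RamProgram.step P σ₁ = ⟨σ₁.pc + 1, σ₁.reg, σ₁.mem⟩ := by
        rw [e1, step_at (by rw [a2, List.length_append])]
        simp only [RamInstr.exec, a4, if_neg hg]
      have e2 : P = (pre ++ E ++ [RamInstr.jumpZero 64 (pre.length + E.length + 1 + c.len + 1)]) ++
          c.code (pre.length + E.length + 1) ++ (.jumpZero 0 pre.length :: post) := by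
        simp [e1]
      have e3 : (pre ++ E ++ [RamInstr.jumpZero 64 (pre.length + E.length + 1 + c.len + 1)]).length =
          pre.length + E.length + 1 := by simp; omega
      obtain ⟨N, σ₂, c1, c2, c3, c4⟩ := hc (by omega)
        (pre ++ E ++ [.jumpZero 64 (pre.length + E.length + 1 + c.len + 1)])
        (.jumpZero 0 pre.length :: post) s.tick s'
        ⟨σ₁.pc + 1, σ₁.reg, σ₁.mem⟩ (by rw [e3, a2])
        ⟨a3.zero, a3.base, a3.var, a3.raw, a3.arr⟩ hbody
      rw [e3, ← e2] at c1
      rw [e3] at c2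
      have d1 : RamProgram.step P σ₂ = ⟨pre.length, σ₂.reg, σ₂.mem⟩ := by
        have : P = (pre ++ E ++ [RamInstr.jumpZero 64 (pre.length + E.length + 1 + c.len + 1)] ++
          c.code (pre.length + E.length + 1)) ++ (.jumpZero 0 pre.length :: post) := e2
        rw [this, step_at (by rw [List.length_append, e3, c.length_code, c2])]
        simp [RamInstr.exec, c3.zero]
      obtain ⟨N', σ₃, f1, f2, f3, f4⟩ := ih ⟨pre.length, σ₂.reg, σ₂.mem⟩ rfl
        ⟨c3.zero, c3.base, c3.var, c3.raw, c3.arr⟩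
      refine ⟨N' + (1 + (N + (1 + E.length))), σ₃, ?_, f2, f3, ?_⟩
      · rw [Function.iterate_add_apply, Function.iterate_add_apply, Function.iterate_add_apply,
          Function.iterate_add_apply, a1, Function.iterate_one, b2, c1, d1, f1]
      · simp only [Env.tick_time, Nat.mul_add, Nat.mul_one] at c4
        omega

/-- Computes the address `2 * (p + m + e) + 4`, from which on the memory is free, into
register `1`. -/
def prologue : List RamInstr :=
  [.const 64 1, .load 65 64, .add 66 64 64, .load 67 66, .add 68 66 64, .load 69 68,
    .add 65 65 67, .add 65 65 69, .add 65 65 65, .const 70 4, .add 1 65 70]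

/-- A complete program for the machine. -/
def Cmd.program (c : Cmd) : RamProgram := prologue ++ c.code prologue.length

/-- The state of a structured program at its start. -/
def Env.init (x : List ℕ) : Env :=
  ⟨fun _ => 0, fun _ _ => 0, fun a => x.getD a 0, 0⟩

/-- Total correctness carries over to the machine, with the number of steps at most a constant times
the time of the structured program. The bound `B` separates the cells of the input and the output
from the arrays. -/
theorem Cmd.program_correct (c : Cmd) (x : List ℕ) (B : ℕ)
    (hB : B = 2 * (x.getD 1 0 + x.getD 2 0 + x.getD 3 0) + 4) (hx : x.length ≤ B)
    {Q : Env → Prop} (h : c.wp B Q (Env.init x)) :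
    ∃ (T : ℕ) (t : Env), Q t ∧ T ≤ prologue.length + c.len * t.time ∧
      (c.program.step^[T] (RamState.init x)).Halted c.program ∧
      ∀ a < B, (c.program.step^[T] (RamState.init x)).mem a = t.raw a := by
  obtain ⟨t, hrun, hQ⟩ := h
  have hs : ∀ q ∈ prologue, q.Straight := by
    intro q hq
    apply RamInstr.straight_of_ne
    rintro a l rfl
    simp [prologue] at hq
  obtain ⟨h1, h2⟩ := step_iterate_straight [] prologue (c.code prologue.length)
    (RamState.init x) hs rfl
  set σ := execAll prologue (RamState.init x) with hσ
  have hr : Represents B (Env.init x) σ := by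
    refine ⟨rfl, ?_, ?_, fun _ _ => rfl, ?_⟩
    · rw [hB]
      change x.getD 1 0 + x.getD 2 0 + x.getD 3 0 + (x.getD 1 0 + x.getD 2 0 + x.getD 3 0) + 4 = _
      omega
    · intro y
      have h3 := y.reg_lt
      have h4 := y.two_le_reg
      have h5 : ∀ r, 2 ≤ r → r < 64 → σ.reg r = 0 := by
        intro r hr1 hr2
        have e1 : r ≠ 1 := by omega
        have e64 : r ≠ 64 := by omega
        have e65 : r ≠ 65 := by omega
        have e66 : r ≠ 66 := by omega
        have e67 : r ≠ 67 := by omega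
        have e68 : r ≠ 68 := by omega
        have e69 : r ≠ 69 := by omega
        have e70 : r ≠ 70 := by omega
        simp [hσ, execAll, prologue, RamInstr.exec, RamState.setReg, RamState.init,
          Function.update, e1, e64, e65, e66, e67, e68, e69, e70]
      exact h5 _ h4 h3
    · intro k a
      change x.getD (B + 16 * a + k.num) 0 = 0
      rw [List.getD_eq_default]
      omega
  obtain ⟨N, σ', a1, a2, a3, a4⟩ := Cmd.simulated B c.len c le_rfl prologue [] (Env.init x) t σ
    (by rw [h2]; simp) hr hrun
  have e1 : prologue ++ c.code prologue.length ++ [] = c.program := List.append_nil _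
  have e2 : [] ++ prologue ++ c.code prologue.length = c.program := rfl
  rw [e1] at a1
  rw [e2] at h1
  have h3 : c.program.step^[N + prologue.length] (RamState.init x) = σ' := by
    rw [Function.iterate_add_apply, h1, a1]
  refine ⟨N + prologue.length, t, hQ, ?_, ?_, ?_⟩
  · have : (Env.init x).time = 0 := rfl
    rw [this] at a4
    omega
  · rw [h3]
    change c.program.length ≤ σ'.pc
    rw [a2, Cmd.program, List.length_append, c.length_code]
  · rw [h3]
    exact a3.raw

/-! ### Sets of natural numbers as bit masks -/

/-- The number whose binary digits are the indicator function of the set. -/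
def mask (S : Finset ℕ) : ℕ := ∑ i ∈ S, 2 ^ i

theorem testBit_mask (S : Finset ℕ) (i : ℕ) : (mask S).testBit i = decide (i ∈ S) := by
  have h := Finset.toFinset_bitIndices_sum_two_pow S
  rw [Bool.eq_iff_iff, ← Nat.mem_bitIndices, ← List.mem_toFinset]
  unfold mask
  rw [h]
  simp

@[simp] theorem mask_empty : mask ∅ = 0 := rfl

@[simp] theorem mask_singleton (i : ℕ) : mask {i} = 2 ^ i := by simp [mask]

theorem mask_injective : Function.Injective mask := by
  intro S T h
  ext i
  have := congrArg (fun x => x.testBit i) h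
  simpa [testBit_mask] using this

@[simp] theorem mask_eq_zero {S : Finset ℕ} : mask S = 0 ↔ S = ∅ := by
  rw [← mask_empty]
  exact mask_injective.eq_iff

theorem mask_and (S T : Finset ℕ) : mask S &&& mask T = mask (S ∩ T) := by
  refine Nat.eq_of_testBit_eq fun i => ?_
  simp [testBit_mask]

theorem mask_or (S T : Finset ℕ) : mask S ||| mask T = mask (S ∪ T) := by
  refine Nat.eq_of_testBit_eq fun i => ?_
  simp [testBit_mask]

theorem mask_sub {S T : Finset ℕ} (h : T ⊆ S) : mask S - mask T = mask (S \ T) := by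
  unfold mask
  rw [← Finset.sum_sdiff h, Nat.add_sub_cancel]

theorem mask_sub_two_pow {S : Finset ℕ} {i : ℕ} (h : i ∈ S) : mask S - 2 ^ i = mask (S.erase i) := by
  rw [← mask_singleton, mask_sub (by simpa using h), Finset.sdiff_singleton_eq_erase]

theorem mask_and_two_pow_eq_zero {S : Finset ℕ} {i : ℕ} : mask S &&& 2 ^ i = 0 ↔ i ∉ S := by
  rw [← mask_singleton, mask_and, mask_eq_zero, ← Finset.disjoint_iff_inter_eq_empty,
    Finset.disjoint_singleton_right]

theorem mask_or_two_pow (S : Finset ℕ) (i : ℕ) : mask S ||| 2 ^ i = mask (insert i S) := by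
  rw [← mask_singleton, mask_or, Finset.union_comm, Finset.insert_eq]

theorem mask_range (k : ℕ) : mask (Finset.range k) = 2 ^ k - 1 := by
  induction k with
  | zero => rfl
  | succ k ih =>
    unfold mask at ih ⊢
    rw [Finset.sum_range_succ, ih, pow_succ]
    have := Nat.one_le_two_pow (n := k)
    omega

/-- The lowest bit of a mask is isolated by `x - (x &&& (x - 1))`. -/
theorem exists_lowBit {S : Finset ℕ} (h : mask S ≠ 0) :
    ∃ i ∈ S, mask S - (mask S &&& (mask S - 1)) = 2 ^ i := by
  have hS : S.Nonempty := by
    rw [Finset.nonempty_iff_ne_empty]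
    exact fun h0 => h (mask_eq_zero.2 h0)
  set a := S.min' hS
  have ha : a ∈ S := S.min'_mem hS
  refine ⟨a, ha, ?_⟩
  have hdisj : Disjoint (S.erase a) (Finset.range a) := by
    rw [Finset.disjoint_left]
    intro i hi hi'
    have := S.min'_le i (Finset.mem_of_mem_erase hi)
    exact absurd (Finset.mem_range.1 hi') (not_lt.2 this)
  have h1 : mask S = mask (S.erase a) + 2 ^ a := by
    unfold mask
    rw [Finset.sum_erase_add _ _ ha]
  have h2 : mask S - 1 = mask (S.erase a ∪ Finset.range a) := by
    have h3 : mask (S.erase a ∪ Finset.range a) = mask (S.erase a) + mask (Finset.range a) :=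
      Finset.sum_union hdisj
    rw [h3, mask_range, h1]
    have := Nat.one_le_two_pow (n := a)
    omega
  have h4 : S ∩ (S.erase a ∪ Finset.range a) = S.erase a := by
    ext i
    simp only [Finset.mem_inter, Finset.mem_union, Finset.mem_erase, Finset.mem_range]
    constructor
    · rintro ⟨h5, h6 | h6⟩
      · exact h6
      · have := S.min'_le i h5
        omega
    · rintro ⟨h5, h6⟩
      exact ⟨h6, Or.inl ⟨h5, h6⟩⟩
  rw [h2, mask_and, h4, h1, Nat.add_sub_cancel_left]

/-! ### The program: syntax and counting loops -/

instance : Coe Var Expr := ⟨Expr.var⟩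
instance (v : ℕ) : OfNat Expr v := ⟨Expr.lit v⟩
instance : Add Expr := ⟨Expr.add⟩
instance : Sub Expr := ⟨Expr.sub⟩
instance : AndOp Expr := ⟨Expr.and⟩
instance : OrOp Expr := ⟨Expr.or⟩
instance : CoeFun Arr (fun _ => Expr → Expr) := ⟨Expr.get⟩

infixr:30 " ;; " => Cmd.seq

namespace Expr

variable (s : Env) (a b : Expr)

@[simp] theorem eval_ofNat (v : ℕ) : (OfNat.ofNat v : Expr).eval s = OfNat.ofNat v := rfl
@[simp] theorem eval_add : (a + b).eval s = a.eval s + b.eval s := rfl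
@[simp] theorem eval_sub : (a - b).eval s = a.eval s - b.eval s := rfl
@[simp] theorem eval_and : (a &&& b).eval s = a.eval s &&& b.eval s := rfl
@[simp] theorem eval_or : (a ||| b).eval s = a.eval s ||| b.eval s := rfl

/-- The lowest binary digit `1` of a number, as a power of two. -/
def low (a : Expr) : Expr := a - (a &&& (a - 1))

@[simp] theorem eval_low : a.low.eval s = a.eval s - (a.eval s &&& (a.eval s - 1)) := rfl

end Expr

open Var Arr

/-- Executes `c` with the values `0, …, h - 1` of the variable `ii`. -/
def Cmd.upto (h : Var) (c : Cmd) : Cmd :=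
  .set ii 0 ;; .loop (h - ii) (c ;; .set ii (ii + 1))

/-- Counting loops. Each iteration may use `C` units of time beyond the credit. -/
theorem Cmd.wp_upto {B : ℕ} {Q : Env → Prop} {h : Var} {c : Cmd} {N : ℕ} {s₀ : Env}
    (C : ℕ) (I : ℕ → ℕ → Env → Prop) {φ₀ : ℕ} (hN : s₀.var h = N)
    (hh : (upto h c).writesVar h = false) (hc : c.writesVar ii = false)
    (h₀ : I 0 φ₀ (s₀.setVar ii 0))
    (hbody : ∀ k φ s, k < N → I k φ s → s.var ii = k → (upto h c).Frame s₀ s →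
      c.wp B (fun t => ∃ φ', I (k + 1) φ' (t.setVar ii (k + 1)) ∧
        t.time + φ' ≤ s.time + φ + C) s.tick)
    (hQ : ∀ φ t, I N φ t → (upto h c).Frame s₀ t →
      t.time + φ ≤ s₀.time + φ₀ + N * (C + 1) + 1 → Q t.tick) :
    (upto h c).wp B Q s₀ := by
  have hii : h ≠ ii := by
    rintro rfl
    simp [upto, writesVar] at hh
  have hF : ∀ s, (c ;; .set ii (ii + 1)).Frame (s₀.setVar ii 0) s → (upto h c).Frame s₀ s := by
    intro s hs
    refine ⟨fun x hx => ?_, fun k hk => ?_, fun hr => ?_, ?_⟩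
    · simp only [upto, writesVar, Bool.or_eq_false_iff, decide_eq_false_iff_not] at hx
      rw [hs.var x (by simp [writesVar, hx])]
      simp [Ne.symm hx.1]
    · simp only [upto, writesArr, Bool.or_eq_false_iff] at hk
      rw [hs.arr k (by simp [writesArr, hk])]
      rfl
    · simp only [upto, writesRaw, Bool.or_eq_false_iff] at hr
      rw [hs.raw (by simp [writesRaw, hr])]
      rfl
    · have := hs.time
      simp only [Env.setVar_time] at this
      omega
  have hbound : ∀ s, (upto h c).Frame s₀ s → s.var h = N := fun s hs => by
    rw [hs.var h hh, hN]
  unfold upto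
  rw [wp_seq, wp_set]
  refine wp_loop (fun φ s => ∃ k ψ, k ≤ N ∧ s.var ii = k ∧ I k ψ s ∧
    φ = ψ + (N - k) * (C + 1)) (φ₀ := φ₀ + N * (C + 1)) ?_ ?_ ?_
  · exact ⟨0, φ₀, Nat.zero_le _, by simp, h₀, by simp⟩
  · rintro φ s ⟨k, ψ, hk, hs, hI, rfl⟩ hfr hg
    have h1 := hbound s (hF s hfr)
    simp only [Expr.eval_sub, Expr.eval, h1, hs] at hg
    have hkN : k < N := by omega
    rw [wp_seq]
    refine wp_mono (wp_frame (hbody k ψ s hkN hI hs (hF s hfr))) ?_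
    rintro t ⟨⟨ψ', h2, h3⟩, h4⟩
    have h5 : t.var ii = k := by rw [h4.var ii hc]; exact hs
    rw [wp_set]
    simp only [Expr.eval, h5]
    refine ⟨ψ' + (N - (k + 1)) * (C + 1), ⟨k + 1, ψ', hkN, by simp, h2, rfl⟩, ?_⟩
    have h6 : (N - k) * (C + 1) = (N - (k + 1)) * (C + 1) + (C + 1) := by
      rw [← Nat.succ_mul]
      congr 1
      omega
    simp only [Env.setVar_time]
    omega
  · rintro φ t ⟨k, ψ, hk, hs, hI, rfl⟩ hfr hg hT
    have h1 := hbound t (hF t hfr)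
    simp only [Expr.eval_sub, Expr.eval, h1, hs] at hg
    have hkN : k = N := by omega
    subst hkN
    refine hQ ψ t hI (hF t hfr) ?_
    simp only [Env.setVar_time] at hT
    simp only [Nat.sub_self, Nat.zero_mul] at hT
    omega

/-! ### Reading the input -/

/-- The input of the procedure, with natural numbers as vertices: edges `src k → dst k` for
`k < e`, the actuated states `bs i` for `i < p`, the measured states `cs j` for `j < m`. -/
structure InputData where
  n : ℕ
  p : ℕ
  m : ℕ
  e : ℕ
  src : ℕ → ℕ
  dst : ℕ → ℕ
  bs : ℕ → ℕ
  cs : ℕ → ℕ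
  src_lt : ∀ k < e, src k < n
  dst_lt : ∀ k < e, dst k < n
  bs_lt : ∀ i < p, bs i < n

namespace InputData

variable (d : InputData)

/-- The out-neighbours of a state. -/
def adj (v : ℕ) : Finset ℕ := ((Finset.range d.e).filter fun k => d.src k = v).image d.dst

/-- The sensors that measure a state. -/
def own (v : ℕ) : Finset ℕ := (Finset.range d.m).filter fun j => d.cs j = v

/-- The memory holds the input. -/
structure Holds (raw : ℕ → ℕ) : Prop where
  n : raw 0 = d.n
  p : raw 1 = d.p
  m : raw 2 = d.m
  e : raw 3 = d.e
  src : ∀ k < d.e, raw (4 + 2 * k) = d.src k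
  dst : ∀ k < d.e, raw (4 + 2 * k + 1) = d.dst k
  bs : ∀ k < d.p, raw (4 + 2 * d.e + k) = d.bs k
  cs : ∀ k < d.m, raw (4 + 2 * d.e + d.p + k) = d.cs k

/-- The state after the input has been read: variables, the tables of powers of two and of
their logarithms, and the adjacency masks. -/
structure Loaded (s : Env) : Prop where
  nA : s.var nA = d.p
  nO : s.var nO = d.m
  pow : ∀ i < d.n + d.p + d.m, s.arr pow i = 2 ^ i
  idx : ∀ i < d.n + d.p + d.m, s.arr idx (2 ^ i) = i
  adj : ∀ v, s.arr Arr.adj v = mask (d.adj v)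
  own : ∀ v, s.arr Arr.own v = mask (d.own v)
  act : ∀ i < d.p, s.arr act i = d.bs i

end InputData

/-- Tables of the powers of two and of their logarithms. -/
def tablesCmd : Cmd :=
  .set tt (nS + nA + nO) ;; .set xx 1 ;;
  .upto tt (.put pow ii xx ;; .put idx xx ii ;; .set xx (xx + xx))

/-- Reads the edges of the state digraph into adjacency masks. -/
def edgesCmd : Cmd :=
  .set aa 4 ;;
  .upto nE (.read jj aa ;; .read ww (aa + 1) ;; .put adj jj (adj jj ||| pow ww) ;; .set aa (aa + 2))

/-- Reads the actuated states. -/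
def actuatorsCmd : Cmd :=
  .upto nA (.read jj aa ;; .put act ii jj ;; .set aa (aa + 1))

/-- Reads the measured states. -/
def sensorsCmd : Cmd :=
  .upto nO (.read jj aa ;; .put own jj (own jj ||| pow ii) ;; .set aa (aa + 1))

/-- Reads the whole input. -/
def loadCmd : Cmd :=
  .read nS 0 ;; .read nA 1 ;; .read nO 2 ;; .read nE 3 ;;
  tablesCmd ;; edgesCmd ;; actuatorsCmd ;; sensorsCmd

theorem tablesCmd_wp {B N : ℕ} {s : Env} (hN : s.var nS + s.var nA + s.var nO = N) :
    tablesCmd.wp B (fun t => (∀ i < N, t.arr pow i = 2 ^ i ∧ t.arr idx (2 ^ i) = i) ∧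
      t.time ≤ s.time + 5 * N + 4) s := by
  simp only [tablesCmd, Cmd.wp_seq, Cmd.wp_set]
  refine Cmd.wp_upto 4 (fun k φ t => φ = 0 ∧ t.var xx = 2 ^ k ∧
    ∀ i < k, t.arr pow i = 2 ^ i ∧ t.arr idx (2 ^ i) = i) (N := N) (φ₀ := 0) ?_ rfl rfl ?_ ?_ ?_
  · simpa using hN
  · simp
  · rintro k φ s' hk ⟨rfl, hx, hI⟩ hi hF
    simp only [Cmd.wp_seq, Cmd.wp_put, Cmd.wp_set]
    refine ⟨0, ⟨rfl, ?_, ?_⟩, ?_⟩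
    -- The machine does not multiply, so the powers of two arise by addition.
    · simp [hx, pow_succ]
      omega
    · intro i hik
      have : (2 ^ i = 2 ^ k) ↔ i = k := Nat.pow_right_injective (le_refl 2) |>.eq_iff
      rcases eq_or_ne i k with rfl | hne
      · simp [hx, hi]
      · simp [hx, hi, hne, hI i (by omega)]
    · simp
  · rintro φ t ⟨rfl, hx, hI⟩ hF ht
    refine ⟨hI, ?_⟩
    simp at ht ⊢
    omega

theorem edgesCmd_wp {B : ℕ} {s : Env} (d : InputData) (hraw : d.Holds s.raw)
    (hB : 4 + 2 * d.e ≤ B) (hE : s.var nE = d.e) (hpow : ∀ i < d.n, s.arr pow i = 2 ^ i)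
    (hadj : ∀ v, s.arr adj v = 0) :
    edgesCmd.wp B (fun t => (∀ v, t.arr adj v = mask (d.adj v)) ∧ t.var aa = 4 + 2 * d.e ∧
      t.time ≤ s.time + 6 * d.e + 3) s := by
  simp only [edgesCmd, Cmd.wp_seq, Cmd.wp_set]
  refine Cmd.wp_upto 5 (fun k φ t => φ = 0 ∧ t.var aa = 4 + 2 * k ∧
    ∀ v, t.arr adj v =
      mask (((Finset.range k).filter fun k => d.src k = v).image d.dst)) (N := d.e) (φ₀ := 0)
    ?_ rfl rfl ?_ ?_ ?_
  · simpa using hE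
  · simpa using hadj
  · rintro k φ s' hk ⟨rfl, ha, hI⟩ hi hF
    have h1 : s'.raw = s.raw := hF.raw rfl
    have h2 : s'.arr pow = s.arr pow := hF.arr _ rfl
    simp only [Cmd.wp_seq, Cmd.wp_put, Cmd.wp_set, Cmd.wp_read]
    refine ⟨?_, ?_, 0, ⟨rfl, ?_, ?_⟩, ?_⟩
    · simp [ha]; omega
    · simp [ha]; omega
    · simp [ha]; omega
    · intro v
      have h3 := hraw.src k hk
      have h4 := hraw.dst k hk
      simp only [Env.setVar_arr, Env.putArr_arr_same]
      simp only [Expr.eval, Env.tick_var, Env.tick_raw, Env.setVar_var, h1, ha, h3,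
        if_true, Env.setVar_raw, Expr.eval_or, Env.setVar_arr, Env.tick_arr, hI]
      simp only [reduceCtorEq, if_false, h2, h4, hpow _ (d.dst_lt k hk), mask_or_two_pow,
        Finset.range_add_one, Finset.filter_insert]
      by_cases hv : v = d.src k
      · subst hv
        simp
      · simp [hv, Ne.symm hv]
    · simp
  · rintro φ t ⟨rfl, ha, hI⟩ hF ht
    refine ⟨hI, ha, ?_⟩
    simp at ht ⊢
    omega

theorem actuatorsCmd_wp {B : ℕ} {s : Env} (d : InputData) (hraw : d.Holds s.raw)
    (hB : 4 + 2 * d.e + d.p ≤ B) (hA : s.var nA = d.p) (ha : s.var aa = 4 + 2 * d.e) :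
    actuatorsCmd.wp B (fun t => (∀ i < d.p, t.arr act i = d.bs i) ∧
      t.var aa = 4 + 2 * d.e + d.p ∧ t.time ≤ s.time + 5 * d.p + 2) s := by
  simp only [actuatorsCmd]
  refine Cmd.wp_upto 4 (fun k φ t => φ = 0 ∧ t.var aa = 4 + 2 * d.e + k ∧
    ∀ i < k, t.arr act i = d.bs i) (N := d.p) (φ₀ := 0) hA rfl rfl ?_ ?_ ?_
  · simpa using ha
  · rintro k φ s' hk ⟨rfl, ha, hI⟩ hi hF
    have h1 : s'.raw = s.raw := hF.raw rfl
    simp only [Cmd.wp_seq, Cmd.wp_put, Cmd.wp_set, Cmd.wp_read]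
    refine ⟨?_, 0, ⟨rfl, ?_, ?_⟩, ?_⟩
    · simp [ha]; omega
    · simp [ha]; omega
    · intro i hik
      have h3 := hraw.bs k hk
      rcases eq_or_ne i k with rfl | hne
      · simp [ha, hi, h1, h3]
      · simp [hi, hne, hI i (by omega)]
    · simp
  · rintro φ t ⟨rfl, ha, hI⟩ hF ht
    refine ⟨hI, ha, ?_⟩
    simp at ht ⊢
    omega

theorem sensorsCmd_wp {B : ℕ} {s : Env} (d : InputData) (hraw : d.Holds s.raw)
    (hB : 4 + 2 * d.e + d.p + d.m ≤ B) (hO : s.var nO = d.m)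
    (ha : s.var aa = 4 + 2 * d.e + d.p) (hpow : ∀ i < d.m, s.arr pow i = 2 ^ i)
    (hown : ∀ v, s.arr own v = 0) :
    sensorsCmd.wp B (fun t => (∀ v, t.arr own v = mask (d.own v)) ∧
      t.time ≤ s.time + 5 * d.m + 2) s := by
  simp only [sensorsCmd]
  refine Cmd.wp_upto 4 (fun k φ t => φ = 0 ∧ t.var aa = 4 + 2 * d.e + d.p + k ∧
    ∀ v, t.arr own v = mask ((Finset.range k).filter fun j => d.cs j = v)) (N := d.m) (φ₀ := 0)
    hO rfl rfl ?_ ?_ ?_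
  · simpa using ⟨ha, hown⟩
  · rintro k φ s' hk ⟨rfl, ha, hI⟩ hi hF
    have h1 : s'.raw = s.raw := hF.raw rfl
    have h2 : s'.arr pow = s.arr pow := hF.arr _ rfl
    simp only [Cmd.wp_seq, Cmd.wp_put, Cmd.wp_set, Cmd.wp_read]
    refine ⟨?_, 0, ⟨rfl, ?_, ?_⟩, ?_⟩
    · simp [ha]; omega
    · simp [ha]; omega
    · intro v
      have h3 := hraw.cs k hk
      by_cases hv : v = d.cs k
      · subst hv
        simp [hi, hI, h1, h2, h3, ha, hpow k hk, mask_or_two_pow, Finset.range_add_one,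
          Finset.filter_insert]
      · simp [hi, hI, h1, h2, h3, ha, hv, Ne.symm hv, Finset.range_add_one, Finset.filter_insert]
    · simp
  · rintro φ t ⟨rfl, ha, hI⟩ hF ht
    refine ⟨hI, ?_⟩
    simp at ht ⊢
    omega

theorem loadCmd_wp {B : ℕ} {s : Env} (d : InputData) (hraw : d.Holds s.raw) (hB4 : 4 ≤ B)
    (hB : 4 + 2 * d.e + d.p + d.m ≤ B) (harr : ∀ k a, s.arr k a = 0) :
    loadCmd.wp B (fun t => d.Loaded t ∧
      t.time ≤ s.time + 15 + 10 * (d.n + d.p + d.m + d.e)) s := by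
  simp only [loadCmd, Cmd.wp_seq, Cmd.wp_read]
  refine ⟨by simp; omega, by simp; omega, by simp; omega, by simp; omega, ?_⟩
  set s₁ := (((s.setVar nS (s.raw 0)).setVar nA (s.raw 1)).setVar nO (s.raw 2)).setVar nE (s.raw 3)
    with hs₁
  change tablesCmd.wp B _ s₁
  have g1 : s₁.var nS = d.n := by simp [hs₁, hraw.n]
  have g2 : s₁.var nA = d.p := by simp [hs₁, hraw.p]
  have g3 : s₁.var nO = d.m := by simp [hs₁, hraw.m]
  have g4 : s₁.var nE = d.e := by simp [hs₁, hraw.e]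
  have g5 : s₁.raw = s.raw := rfl
  have g6 : s₁.arr = s.arr := rfl
  have g7 : s₁.time = s.time + 4 := rfl
  refine Cmd.wp_mono (Cmd.wp_frame (tablesCmd_wp (N := d.n + d.p + d.m) (by rw [g1, g2, g3]))) ?_
  rintro s₂ ⟨⟨a1, a2⟩, aF⟩
  have e1 : s₂.raw = s.raw := aF.raw rfl
  rw [Cmd.wp_seq]
  refine Cmd.wp_mono (Cmd.wp_frame (edgesCmd_wp (B := B) d (e1 ▸ hraw) (by omega)
    ((aF.var nE rfl).trans g4) (fun i hi => (a1 i (by omega)).1)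
    (fun v => by rw [aF.arr adj rfl, g6, harr]))) ?_
  rintro s₃ ⟨⟨b1, b2, b3⟩, bF⟩
  have e2 : s₃.raw = s.raw := (bF.raw rfl).trans e1
  rw [Cmd.wp_seq]
  refine Cmd.wp_mono (Cmd.wp_frame (actuatorsCmd_wp (B := B) d (e2 ▸ hraw) (by omega)
    ((bF.var nA rfl).trans ((aF.var nA rfl).trans g2)) b2)) ?_
  rintro s₄ ⟨⟨c1, c2, c3⟩, cF⟩
  have e3 : s₄.raw = s.raw := (cF.raw rfl).trans e2
  have e4 : s₄.arr pow = s₂.arr pow := (cF.arr _ rfl).trans (bF.arr _ rfl)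
  refine Cmd.wp_mono (Cmd.wp_frame (sensorsCmd_wp (B := B) d (e3 ▸ hraw) (by omega)
    ((cF.var nO rfl).trans ((bF.var nO rfl).trans ((aF.var nO rfl).trans g3))) c2
    (fun i hi => by rw [e4]; exact (a1 i (by omega)).1)
    (fun v => by rw [cF.arr own rfl, bF.arr own rfl, aF.arr own rfl, g6, harr]))) ?_
  rintro s₅ ⟨⟨d1, d2⟩, dF⟩
  refine ⟨⟨?_, ?_, ?_, ?_, ?_, d1, ?_⟩, by omega⟩
  · rw [dF.var nA rfl, cF.var nA rfl, bF.var nA rfl, aF.var nA rfl, g2]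
  · rw [dF.var nO rfl, cF.var nO rfl, bF.var nO rfl, aF.var nO rfl, g3]
  · intro i hi
    rw [dF.arr pow rfl, e4, (a1 i hi).1]
  · intro i hi
    rw [dF.arr idx rfl, cF.arr idx rfl, bF.arr idx rfl, (a1 i hi).2]
  · intro v
    rw [dF.arr adj rfl, cF.arr adj rfl, b1]
  · intro i hi
    rw [dF.arr act rfl, c1 i hi]

/-! ### Search for the sensors that each state reaches -/

namespace InputData

variable (d : InputData)

/-- There is a path between two states. -/
def Walk (v w : ℕ) : Prop := Relation.ReflTransGen (fun x y => y ∈ d.adj x) v w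

open Classical in
/-- The sensors that can be reached from a state. -/
noncomputable def senseSet (v : ℕ) : Finset ℕ :=
  (Finset.range d.m).filter fun j => ∃ w, d.Walk v w ∧ j ∈ d.own w

variable {d}

theorem mem_senseSet {v j : ℕ} : j ∈ d.senseSet v ↔ ∃ w, d.Walk v w ∧ j ∈ d.own w := by
  simp only [senseSet, Finset.mem_filter, and_iff_right_iff_imp]
  rintro ⟨w, _, h⟩
  exact (Finset.mem_filter.1 h).1

theorem own_subset_senseSet (v : ℕ) : d.own v ⊆ d.senseSet v :=
  fun _ hj => mem_senseSet.2 ⟨v, .refl, hj⟩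

theorem Walk.senseSet_subset {v w : ℕ} (h : d.Walk v w) : d.senseSet w ⊆ d.senseSet v := by
  intro j hj
  obtain ⟨u, h1, h2⟩ := mem_senseSet.1 hj
  exact mem_senseSet.2 ⟨u, h.trans h1, h2⟩

theorem Walk.of_mem_adj {v w : ℕ} (h : w ∈ d.adj v) : d.Walk v w := .single h

theorem lt_of_mem_adj {v w : ℕ} (h : w ∈ d.adj v) : w < d.n := by
  obtain ⟨k, hk, rfl⟩ := Finset.mem_image.1 h
  exact d.dst_lt k (Finset.mem_range.1 (Finset.mem_filter.1 hk).1)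

end InputData

/-- A component on the stack of the depth-first search: a set of states known to be strongly
connected, the edge ends that remain to be examined, and the sensors found so far. -/
structure Comp where
  mem : Finset ℕ
  rem : Finset ℕ
  sens : Finset ℕ

/-- The invariant of a component; `up` is the set of states of the component above it. -/
structure Comp.Valid (d : InputData) (up : Finset ℕ) (c : Comp) : Prop where
  nonempty : c.mem.Nonempty
  walk : ∀ v ∈ c.mem, ∀ w ∈ c.mem, d.Walk v w
  sound : ∀ v ∈ c.mem, c.sens ⊆ d.senseSet v
  own : ∀ v ∈ c.mem, d.own v ⊆ c.sens
  rem : ∀ w ∈ c.rem, ∃ v ∈ c.mem, w ∈ d.adj v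
  cover : ∀ v ∈ c.mem, ∀ w ∈ d.adj v,
    w ∈ c.rem ∨ w ∈ c.mem ∨ d.senseSet w ⊆ c.sens ∨ w ∈ up
  walk_up : ∀ v ∈ c.mem, ∀ w ∈ up, d.Walk v w

/-- The invariant of the stack, whose top comes first. -/
def ValidStack (d : InputData) : Finset ℕ → List Comp → Prop
  | _, [] => True
  | up, c :: l => c.Valid d up ∧ ValidStack d c.mem l

/-- The states of the components of a list. -/
def states : List Comp → Finset ℕ
  | [] => ∅
  | c :: l => c.mem ∪ states l

section Components

variable {d : InputData} {up : Finset ℕ} {c c' : Comp} {l : List Comp} {w : ℕ}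

theorem Comp.Valid.erase_of_mem (h : c.Valid d up) (hw : w ∈ c.mem) :
    Comp.Valid d up ⟨c.mem, c.rem.erase w, c.sens⟩ where
  nonempty := h.nonempty
  walk := h.walk
  sound := h.sound
  own := h.own
  rem u hu := h.rem u (Finset.mem_of_mem_erase hu)
  cover v hv u hu := by
    rcases h.cover v hv u hu with h1 | h1
    · by_cases h2 : u = w
      · exact .inr (.inl (h2 ▸ hw))
      · exact .inl (Finset.mem_erase.2 ⟨h2, h1⟩)
    · exact .inr h1
  walk_up := h.walk_up

theorem Comp.Valid.erase_union (h : c.Valid d up) (hw : w ∈ c.rem) :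
    Comp.Valid d up ⟨c.mem, c.rem.erase w, c.sens ∪ d.senseSet w⟩ where
  nonempty := h.nonempty
  walk := h.walk
  sound v hv := by
    obtain ⟨v', hv', hw'⟩ := h.rem w hw
    exact Finset.union_subset (h.sound v hv)
      ((InputData.Walk.of_mem_adj hw').senseSet_subset.trans
        (h.walk v hv v' hv').senseSet_subset)
  own v hv := (h.own v hv).trans Finset.subset_union_left
  rem u hu := h.rem u (Finset.mem_of_mem_erase hu)
  cover v hv u hu := by
    by_cases h2 : u = w
    · exact .inr (.inr (.inl (h2 ▸ Finset.subset_union_right)))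
    · rcases h.cover v hv u hu with h1 | h1 | h1 | h1
      · exact .inl (Finset.mem_erase.2 ⟨h2, h1⟩)
      · exact .inr (.inl h1)
      · exact .inr (.inr (.inl (h1.trans Finset.subset_union_left)))
      · exact .inr (.inr (.inr h1))
  walk_up := h.walk_up

theorem Comp.Valid.erase_push (h : c.Valid d ∅) (hw : w ∈ c.rem) :
    Comp.Valid d {w} ⟨c.mem, c.rem.erase w, c.sens⟩ where
  nonempty := h.nonempty
  walk := h.walk
  sound := h.sound
  own := h.own
  rem u hu := h.rem u (Finset.mem_of_mem_erase hu)
  cover v hv u hu := by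
    by_cases h2 : u = w
    · exact .inr (.inr (.inr (Finset.mem_singleton.2 h2)))
    · rcases h.cover v hv u hu with h1 | h1 | h1 | h1
      · exact .inl (Finset.mem_erase.2 ⟨h2, h1⟩)
      · exact .inr (.inl h1)
      · exact .inr (.inr (.inl h1))
      · exact absurd h1 (Finset.notMem_empty u)
  walk_up v hv u hu := by
    rw [Finset.mem_singleton.1 hu]
    obtain ⟨v', hv', hw'⟩ := h.rem w hw
    exact (h.walk v hv v' hv').trans (InputData.Walk.of_mem_adj hw')

theorem Comp.valid_singleton (d : InputData) (w : ℕ) :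
    Comp.Valid d ∅ ⟨{w}, d.adj w, d.own w⟩ where
  nonempty := Finset.singleton_nonempty w
  walk v hv u hu := by
    rw [Finset.mem_singleton.1 hv, Finset.mem_singleton.1 hu]
    exact .refl
  sound v hv := by
    rw [Finset.mem_singleton.1 hv]
    exact InputData.own_subset_senseSet w
  own v hv := by rw [Finset.mem_singleton.1 hv]
  rem u hu := ⟨w, Finset.mem_singleton_self w, hu⟩
  cover v hv u hu := by
    rw [Finset.mem_singleton.1 hv] at hu
    exact .inl hu
  walk_up _ _ u hu := absurd hu (Finset.notMem_empty u)

/-- Each state on the stack reaches the top component. -/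
theorem ValidStack.walk_top (h : ValidStack d up (c :: l)) {u v : ℕ} (hu : u ∈ states (c :: l))
    (hv : v ∈ c.mem) : d.Walk u v := by
  induction l generalizing c up v with
  | nil =>
    rw [states, states, Finset.union_empty] at hu
    exact h.1.walk u hu v hv
  | cons c' l ih =>
    rw [states, Finset.mem_union] at hu
    rcases hu with hu | hu
    · exact h.1.walk u hu v hv
    · obtain ⟨v', hv'⟩ := h.2.1.nonempty
      exact (ih h.2 hu hv').trans (h.2.1.walk_up v' hv' v hv)

/-- If the top component has an edge to a state further down the stack, then it is strongly
connected to the component below it. -/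
theorem ValidStack.merge (h : ValidStack d ∅ (c :: c' :: l)) (hw : w ∈ c.rem)
    (hw' : w ∈ states (c' :: l)) :
    ValidStack d ∅ (⟨c'.mem ∪ c.mem, c'.rem ∪ c.rem, c'.sens ∪ c.sens⟩ :: l) := by
  obtain ⟨hc, hc', hl⟩ := h
  obtain ⟨v₀, hv₀, hvw⟩ := hc.rem w hw
  have hdown : ∀ v ∈ c.mem, ∀ u ∈ c'.mem, d.Walk v u := fun v hv u hu =>
    ((hc.walk v hv v₀ hv₀).trans (InputData.Walk.of_mem_adj hvw)).trans
      (ValidStack.walk_top (l := l) ⟨hc', hl⟩ hw' hu)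
  refine ⟨⟨?_, ?_, ?_, ?_, ?_, ?_, ?_⟩, ?_⟩
  · exact hc'.nonempty.mono Finset.subset_union_left
  · intro v hv u hu
    rcases Finset.mem_union.1 hv with hv | hv <;> rcases Finset.mem_union.1 hu with hu | hu
    · exact hc'.walk v hv u hu
    · exact hc'.walk_up v hv u hu
    · exact hdown v hv u hu
    · exact hc.walk v hv u hu
  · intro v hv
    obtain ⟨u, hu⟩ := hc.nonempty
    obtain ⟨u', hu'⟩ := hc'.nonempty
    rcases Finset.mem_union.1 hv with hv | hv
    · exact Finset.union_subset (hc'.sound v hv)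
        ((hc.sound u hu).trans (hc'.walk_up v hv u hu).senseSet_subset)
    · exact Finset.union_subset ((hc'.sound u' hu').trans (hdown v hv u' hu').senseSet_subset)
        (hc.sound v hv)
  · intro v hv
    rcases Finset.mem_union.1 hv with hv | hv
    · exact (hc'.own v hv).trans Finset.subset_union_left
    · exact (hc.own v hv).trans Finset.subset_union_right
  · intro u hu
    rcases Finset.mem_union.1 hu with hu | hu
    · obtain ⟨v, hv, h1⟩ := hc'.rem u hu
      exact ⟨v, Finset.mem_union_left _ hv, h1⟩
    · obtain ⟨v, hv, h1⟩ := hc.rem u hu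
      exact ⟨v, Finset.mem_union_right _ hv, h1⟩
  · intro v hv u hu
    simp only [Finset.mem_union]
    rcases Finset.mem_union.1 hv with hv | hv
    · rcases hc'.cover v hv u hu with h1 | h1 | h1 | h1
      · exact .inl (.inl h1)
      · exact .inr (.inl (.inl h1))
      · exact .inr (.inr (.inl (h1.trans Finset.subset_union_left)))
      · exact .inr (.inl (.inr h1))
    · rcases hc.cover v hv u hu with h1 | h1 | h1 | h1
      · exact .inl (.inr h1)
      · exact .inr (.inl (.inr h1))
      · exact .inr (.inr (.inl (h1.trans Finset.subset_union_right)))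
      · exact absurd h1 (Finset.notMem_empty u)
  · exact fun _ _ u hu => absurd hu (Finset.notMem_empty u)
  · cases l with
    | nil => trivial
    | cons a l =>
      obtain ⟨ha, hl⟩ := hl
      obtain ⟨u', hu'⟩ := hc'.nonempty
      refine ⟨⟨ha.nonempty, ha.walk, ha.sound, ha.own, ha.rem, ?_, ?_⟩, hl⟩
      · intro v hv u hu
        rcases ha.cover v hv u hu with h1 | h1 | h1 | h1
        · exact .inl h1
        · exact .inr (.inl h1)
        · exact .inr (.inr (.inl h1))
        · exact .inr (.inr (.inr (Finset.mem_union_left _ h1)))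
      · intro v hv u hu
        rcases Finset.mem_union.1 hu with hu | hu
        · exact ha.walk_up v hv u hu
        · exact (ha.walk_up v hv u' hu').trans (hc'.walk_up u' hu' u hu)

/-- A component without remaining edge ends has found all sensors that its states reach. -/
theorem Comp.Valid.senseSet_eq (h : c.Valid d ∅) (hrem : c.rem = ∅) {v : ℕ} (hv : v ∈ c.mem) :
    d.senseSet v = c.sens := by
  refine Finset.Subset.antisymm (fun j hj => ?_) (h.sound v hv)
  obtain ⟨u, h1, h2⟩ := InputData.mem_senseSet.1 hj
  unfold InputData.Walk at h1
  induction h1 using Relation.ReflTransGen.head_induction_on with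
  | refl => exact h.own u hv h2
  | head h3 h4 ih =>
    rcases h.cover _ hv _ h3 with h5 | h5 | h5 | h5
    · rw [hrem] at h5
      exact absurd h5 (Finset.notMem_empty _)
    · exact ih h5 (InputData.mem_senseSet.2 ⟨u, h4, h2⟩)
    · exact h5 (InputData.mem_senseSet.2 ⟨u, h4, h2⟩)
    · exact absurd h5 (Finset.notMem_empty _)

theorem ValidStack.finish (h : ValidStack d ∅ (c :: c' :: l)) (hrem : c.rem = ∅) :
    ValidStack d ∅ (⟨c'.mem, c'.rem, c'.sens ∪ c.sens⟩ :: l) := by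
  obtain ⟨hc, hc', hl⟩ := h
  refine ⟨⟨hc'.nonempty, hc'.walk, ?_, ?_, hc'.rem, ?_, ?_⟩, hl⟩
  · intro v hv
    obtain ⟨u, hu⟩ := hc.nonempty
    exact Finset.union_subset (hc'.sound v hv)
      ((hc.sound u hu).trans (hc'.walk_up v hv u hu).senseSet_subset)
  · exact fun v hv => (hc'.own v hv).trans Finset.subset_union_left
  · intro v hv u hu
    rcases hc'.cover v hv u hu with h1 | h1 | h1 | h1
    · exact .inl h1
    · exact .inr (.inl h1)
    · exact .inr (.inr (.inl (h1.trans Finset.subset_union_left)))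
    · exact .inr (.inr (.inl (by rw [hc.senseSet_eq hrem h1]; exact Finset.subset_union_right)))
  · exact fun _ _ u hu => absurd hu (Finset.notMem_empty u)

end Components

/-- Puts a new component with the single state `v` on the stack. -/
def pushCmd (v : Var) : Cmd :=
  .set top (top + 1) ;; .put cm top (pow v) ;; .put ca top (adj v) ;; .put cs top (own v) ;;
  .set seen (seen ||| pow v)

/-- Merges the two components on the top of the stack. -/
def mergeCmd : Cmd :=
  .set top (top - 1) ;; .put cm top (cm top ||| cm (top + 1)) ;;
  .put ca top (ca top ||| ca (top + 1)) ;; .put cs top (cs top ||| cs (top + 1))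

/-- Removes the top component, whose sensors are known, from the stack. -/
def finishCmd : Cmd :=
  .set sens (cs top) ;; .set yy (cm top) ;; .set done (done ||| yy) ;;
  .loop yy (.set xx (Expr.low yy) ;; .put res (idx xx) sens ;; .set yy (yy - xx)) ;;
  .set top (top - 1) ;; .put cs top (cs top ||| sens)

/-- One step of the search, a path-based computation of strongly connected components: examines
the next edge end `ww` of the top component. If it is in the component, nothing happens; if its
sensors are known, they are added; if it is further down the stack, the two top components are
merged; if it is new, it is put on the stack. -/
def stepCmd : Cmd :=
  .set aa (ca top) ;;
  .ite aa
    (.set xx (Expr.low aa) ;; .set ww (idx xx) ;;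
      .ite (cm top &&& xx) (.put ca top (aa - xx))
        (.ite (done &&& xx) (.put ca top (aa - xx) ;; .put cs top (cs top ||| res ww))
          (.ite (seen &&& xx) mergeCmd (.put ca top (aa - xx) ;; pushCmd ww))))
    finishCmd

/-- Computes the sensors that each actuator reaches, as the masks in the array `row`. -/
def searchCmd : Cmd :=
  .upto nA (.set vv (act ii) ;;
    .ite (done &&& pow vv) .skip (pushCmd vv ;; .loop top stepCmd) ;;
    .put row ii (res vv))

/-- The arrays hold the stack; its bottom is in position `1`. -/
def HoldsStack (arr : Arr → ℕ → ℕ) : List Comp → Prop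
  | [] => True
  | c :: l => (arr cm (l.length + 1) = mask c.mem ∧ arr ca (l.length + 1) = mask c.rem ∧
      arr cs (l.length + 1) = mask c.sens) ∧ HoldsStack arr l

theorem HoldsStack.congr {a a' : Arr → ℕ → ℕ} {l : List Comp} (h : HoldsStack a l)
    (h' : ∀ i, i ≤ l.length → a' cm i = a cm i ∧ a' ca i = a ca i ∧ a' cs i = a cs i) :
    HoldsStack a' l := by
  induction l with
  | nil => trivial
  | cons c l ih =>
    obtain ⟨h1, h2, h3⟩ := h' (l.length + 1) le_rfl
    refine ⟨by rw [h1, h2, h3]; exact h.1, ih h.2 fun i hi => h' i ?_⟩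
    exact hi.trans (Nat.le_succ _)

/-- The potential of the stack: the cost of examining its edge ends, of recording the sensors of its
states, and of merging or removing its components. -/
def stackWeight : List Comp → ℕ
  | [] => 0
  | c :: l => c.rem.card + c.mem.card + 1 + stackWeight l

/-- The potential of the states that have not been seen, which exceeds the potential that each of
them has as a component on the stack. -/
def unseenWeight (d : InputData) (S : Finset ℕ) : ℕ :=
  ∑ v ∈ Finset.range d.n \ S, ((d.adj v).card + 3)

theorem unseenWeight_insert (d : InputData) {S : Finset ℕ} {w : ℕ} (hw : w < d.n) (hS : w ∉ S) :
    unseenWeight d (insert w S) + ((d.adj w).card + 3) = unseenWeight d S := by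
  unfold unseenWeight
  rw [← Finset.sum_erase_add (a := w) (Finset.range d.n \ S) _ (by simp [hw, hS])]
  congr 2
  ext v
  simp
  tauto

/-- What the search needs of the loaded input. -/
structure SearchTables (d : InputData) (arr : Arr → ℕ → ℕ) : Prop where
  pow : ∀ i < d.n, arr pow i = 2 ^ i
  idx : ∀ i < d.n, arr idx (2 ^ i) = i
  adj : ∀ v, arr adj v = mask (d.adj v)
  own : ∀ v, arr own v = mask (d.own v)

/-- The invariant of the search: `D` is the set of the states whose sensors are known, and `l` is
the stack. There is a component with the states `up` still to be put on the stack. -/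
structure SearchInv (d : InputData) (s : Env) (up D : Finset ℕ) (l : List Comp) :
    Prop where
  tables : SearchTables d s.arr
  top : s.var top = l.length
  stack : HoldsStack s.arr l
  done : s.var done = mask D
  seen : s.var seen = mask (D ∪ states l)
  valid : ValidStack d up l
  res : ∀ v ∈ D, s.arr res v = mask (d.senseSet v)
  subset : D ∪ states l ⊆ Finset.range d.n

/-- The credit of the search. A step takes less than `30` units of time, apart from the time for
recording sensors, which is proportional to the number of states of the finished component. -/
def searchPotential (d : InputData) (D : Finset ℕ) (l : List Comp) : ℕ :=
  30 * (stackWeight l + unseenWeight d (D ∪ states l))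

section Search

variable {B : ℕ} {d : InputData} {s : Env} {D : Finset ℕ} {l : List Comp}

theorem SearchTables.congr {a a' : Arr → ℕ → ℕ} (h : SearchTables d a) (h1 : a' Arr.pow = a Arr.pow)
    (h2 : a' Arr.idx = a Arr.idx) (h3 : a' Arr.adj = a Arr.adj) (h4 : a' Arr.own = a Arr.own) :
    SearchTables d a' :=
  ⟨h1 ▸ h.pow, h2 ▸ h.idx, h3 ▸ h.adj, h4 ▸ h.own⟩

theorem pushCmd_wp {v : Var} {w : ℕ} (h : SearchInv d s {w} D l) (hv : s.var v = w) (hw : w < d.n)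
    (hvt : v ≠ top)
    (hw' : w ∉ D ∪ states l) :
    (pushCmd v).wp B (fun t => SearchInv d t ∅ D (⟨{w}, d.adj w, d.own w⟩ :: l) ∧
      t.time + searchPotential d D (⟨{w}, d.adj w, d.own w⟩ :: l) ≤
        s.time + searchPotential d D l) s := by
  simp only [pushCmd, Cmd.wp_seq, Cmd.wp_set, Cmd.wp_put]
  have hp := h.tables.pow w hw
  have hu : D ∪ states (⟨{w}, d.adj w, d.own w⟩ :: l) = insert w (D ∪ states l) := by
    ext x
    simp only [states, Finset.mem_union, Finset.mem_singleton, Finset.mem_insert]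
    tauto
  refine ⟨⟨?_, ?_, ?_, ?_, ?_, ?_, ?_, ?_⟩, ?_⟩
  · exact h.tables.congr (by simp) (by simp) (by simp) (by simp)
  · simp [h.top]
  · refine ⟨?_, h.stack.congr ?_⟩
    · simp [h.top, hv, hvt, hp, h.tables.adj, h.tables.own]
    · intro i hi
      have : i ≠ l.length + 1 := by omega
      simp [h.top, this]
  · simp [h.done]
  · rw [hu, ← mask_or_two_pow]
    simp [h.seen, hv, hvt, hp]
  · exact ⟨Comp.valid_singleton d w, h.valid⟩
  · simpa using h.res
  · rw [hu]
    exact Finset.insert_subset (Finset.mem_range.2 hw) h.subset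
  · have h1 := unseenWeight_insert d hw hw'
    unfold searchPotential
    rw [hu, stackWeight, Finset.card_singleton]
    simp
    omega

theorem mergeCmd_wp {c c' : Comp} {w : ℕ} (h : SearchInv d s ∅ D (c :: c' :: l)) (hw : w ∈ c.rem)
    (hw' : w ∈ states (c' :: l)) :
    mergeCmd.wp B (fun t =>
      SearchInv d t ∅ D (⟨c'.mem ∪ c.mem, c'.rem ∪ c.rem, c'.sens ∪ c.sens⟩ :: l) ∧
      t.time + 26 + searchPotential d D (⟨c'.mem ∪ c.mem, c'.rem ∪ c.rem, c'.sens ∪ c.sens⟩ :: l) ≤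
        s.time + searchPotential d D (c :: c' :: l)) s := by
  simp only [mergeCmd, Cmd.wp_seq, Cmd.wp_set, Cmd.wp_put]
  have hu : D ∪ states (⟨c'.mem ∪ c.mem, c'.rem ∪ c.rem, c'.sens ∪ c.sens⟩ :: l) =
      D ∪ states (c :: c' :: l) := by
    ext x
    simp only [states, Finset.mem_union]
    tauto
  have ht : s.var top = l.length + 2 := h.top
  obtain ⟨⟨a1, a2, a3⟩, ⟨b1, b2, b3⟩, hst⟩ := h.stack
  simp only [List.length_cons] at a1 a2 a3
  refine ⟨⟨?_, ?_, ?_, ?_, ?_, ?_, ?_, ?_⟩, ?_⟩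
  · exact h.tables.congr (by simp) (by simp) (by simp) (by simp)
  · simp [ht]
  · refine ⟨?_, hst.congr ?_⟩
    · simp [ht, a1, a2, a3, b1, b2, b3, mask_or]
    · intro i hi
      have : i ≠ l.length + 1 := by omega
      simp [ht, this]
  · simp [h.done]
  · rw [hu]
    simp [h.seen]
  · exact h.valid.merge hw hw'
  · simpa using h.res
  · rw [hu]
    exact h.subset
  · have h1 := Finset.card_union_le c'.mem c.mem
    have h2 := Finset.card_union_le c'.rem c.rem
    unfold searchPotential
    rw [hu]
    simp only [stackWeight, Env.putArr_time, Env.setVar_time]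
    omega

theorem finishCmd_wp {c : Comp} (h : SearchInv d s ∅ D (c :: l)) (hrem : c.rem = ∅) :
    finishCmd.wp B (fun t => ∃ l', SearchInv d t ∅ (D ∪ c.mem) l' ∧
      states l' = states l ∧
      t.time + 22 + searchPotential d (D ∪ c.mem) l' ≤ s.time + searchPotential d D (c :: l)) s := by
  simp only [finishCmd, Cmd.wp_seq, Cmd.wp_set]
  obtain ⟨⟨a1, a2, a3⟩, hst⟩ := h.stack
  have hc := h.valid.1
  have hsub : c.mem ⊆ Finset.range d.n := fun v hv => h.subset (by simp [states, hv])
  refine Cmd.wp_loop (fun φ t => ∃ Y ⊆ c.mem, t.var yy = mask Y ∧ φ = 4 * Y.card ∧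
    ∀ v ∈ D ∪ (c.mem \ Y), t.arr res v = mask (d.senseSet v)) (φ₀ := 4 * c.mem.card) ?_ ?_ ?_
  · refine ⟨c.mem, le_rfl, ?_, rfl, ?_⟩
    · simp [h.top, a1]
    · simpa using h.res
  · rintro φ t ⟨Y, hY, hyy, rfl, hres⟩ hF hg
    have ht : SearchTables d t.arr := h.tables.congr (hF.arr pow rfl) (hF.arr idx rfl)
      (hF.arr Arr.adj rfl) (hF.arr Arr.own rfl)
    have hsens : t.var sens = mask c.sens := by
      rw [hF.var sens rfl]
      simp [h.top, a3]
    simp only [Expr.eval, hyy] at hg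
    obtain ⟨w, hw, hlow⟩ := exists_lowBit hg
    have hwn := Finset.mem_range.1 (hsub (hY hw))
    simp only [Cmd.wp_seq, Cmd.wp_set, Cmd.wp_put]
    refine ⟨_, ⟨Y.erase w, (Finset.erase_subset w Y).trans hY, ?_, rfl, ?_⟩, ?_⟩
    · simp [hyy, hlow, mask_sub_two_pow hw]
    · intro v hv
      by_cases hvw : v = w
      · subst hvw
        simp [hyy, hlow, ht.idx v hwn, hsens, hc.senseSet_eq hrem (hY hw)]
      · have := hres v (by
          simp only [Finset.mem_union, Finset.mem_sdiff, Finset.mem_erase] at hv ⊢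
          tauto)
        simp [hyy, hlow, ht.idx w hwn, hvw, this]
    · have := Finset.card_erase_add_one hw
      simp
      omega
  · rintro φ t ⟨Y, hY, hyy, rfl, hres⟩ hF hg htime
    simp only [Expr.eval, hyy, mask_eq_zero] at hg
    subst hg
    have ht : SearchTables d t.arr := h.tables.congr (hF.arr pow rfl) (hF.arr idx rfl)
      (hF.arr Arr.adj rfl) (hF.arr Arr.own rfl)
    have hsens : t.var sens = mask c.sens := by
      rw [hF.var sens rfl]
      simp [h.top, a3]
    have htop : t.var top = l.length + 1 := by
      rw [hF.var top rfl]
      simp [h.top]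
    have hdone : t.var done = mask (D ∪ c.mem) := by
      rw [hF.var done rfl]
      simp [h.top, h.done, a1, mask_or]
    have hseen : t.var seen = mask (D ∪ states (c :: l)) := by
      rw [hF.var seen rfl]
      simp [h.seen]
    have e1 : t.arr cm = s.arr cm := hF.arr cm rfl
    have e2 : t.arr ca = s.arr ca := hF.arr ca rfl
    have e3 : t.arr cs = s.arr cs := hF.arr cs rfl
    simp only [Finset.sdiff_empty] at hres
    simp only [Env.setVar_time, Finset.card_empty, Nat.mul_zero, Nat.add_zero] at htime
    have key : ∀ l', states l' = states l → stackWeight l' = stackWeight l →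
        l'.length = l.length → ValidStack d ∅ l' →
        HoldsStack ((t.tick.setVar top (t.var top - 1)).putArr cs l.length
          (t.arr cs l.length ||| t.var sens)).arr l' →
        SearchInv d ((t.tick.setVar top (t.var top - 1)).putArr cs l.length
          (t.arr cs l.length ||| t.var sens)) ∅ (D ∪ c.mem) l' ∧ states l' = states l ∧
        ((t.tick.setVar top (t.var top - 1)).putArr cs l.length
          (t.arr cs l.length ||| t.var sens)).time + 22 + searchPotential d (D ∪ c.mem) l' ≤
          s.time + searchPotential d D (c :: l) := by
      intro l' h1 h2 h3 h4 h5
      have hu : D ∪ c.mem ∪ states l' = D ∪ states (c :: l) := by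
        rw [states, h1, Finset.union_assoc]
      refine ⟨⟨?_, ?_, h5, ?_, ?_, h4, ?_, ?_⟩, h1, ?_⟩
      · exact ht.congr (by simp) (by simp) (by simp) (by simp)
      · simp [htop, h3]
      · simp [hdone]
      · rw [hu]
        simp [hseen]
      · simpa using hres
      · rw [hu]
        exact h.subset
      · unfold searchPotential
        rw [hu, stackWeight, h2]
        simp
        omega
    have e4 : Expr.eval (t.tick.setVar top (Expr.eval t.tick (top - 1))) (top) = l.length := by
      simp [htop]
    have e5 : Expr.eval (t.tick.setVar top (Expr.eval t.tick (top - 1))) (cs top ||| sens) =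
        t.arr cs l.length ||| t.var sens := by
      simp [htop]
    rw [Cmd.wp_seq, Cmd.wp_set, Cmd.wp_put, e4, e5]
    cases l with
    | nil => exact ⟨[], key [] rfl rfl rfl trivial trivial⟩
    | cons c' l =>
      obtain ⟨⟨b1, b2, b3⟩, hst'⟩ := hst
      refine ⟨_, key (⟨c'.mem, c'.rem, c'.sens ∪ c.sens⟩ :: l) rfl rfl rfl
        (h.valid.finish hrem) ⟨?_, hst'.congr ?_⟩⟩
      · simp [e1, e2, e3, b1, b2, b3, hsens, mask_or]
      · intro i hi
        have : i ≠ l.length + 1 := by omega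
        simp [e1, e2, e3, this]

/-- The invariant after an edge end has been removed from the top component. -/
theorem searchInv_erase {up S : Finset ℕ} {c : Comp} {w : ℕ} {t : Env}
    (h : SearchInv d s ∅ D (c :: l))
    (hc : ValidStack d up (⟨c.mem, c.rem.erase w, S⟩ :: l))
    (hvar : ∀ x ∈ [top, done, seen], t.var x = s.var x)
    (harr : ∀ k ∈ [pow, idx, Arr.adj, Arr.own, cm, res], t.arr k = s.arr k)
    (hca : ∀ i, t.arr ca i = if i = l.length + 1 then mask (c.rem.erase w) else s.arr ca i)
    (hcs : ∀ i, t.arr cs i = if i = l.length + 1 then mask S else s.arr cs i) :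
    SearchInv d t up D (⟨c.mem, c.rem.erase w, S⟩ :: l) := by
  obtain ⟨⟨a1, a2, a3⟩, hst⟩ := h.stack
  simp only [List.forall_mem_cons] at hvar harr
  refine ⟨?_, ?_, ?_, ?_, ?_, hc, ?_, h.subset⟩
  · exact h.tables.congr harr.1 harr.2.1 harr.2.2.1 harr.2.2.2.1
  · rw [hvar.1, h.top]
    rfl
  · refine ⟨⟨by rw [harr.2.2.2.2.1]; exact a1, by simp [hca], by simp [hcs]⟩, hst.congr ?_⟩
    intro i hi
    have : i ≠ l.length + 1 := by omega
    simp [harr.2.2.2.2.1, hca, hcs, this]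
  · rw [hvar.2.1, h.done]
  · rw [hvar.2.2.1, h.seen]
    rfl
  · rw [harr.2.2.2.2.2.1]
    exact h.res

theorem searchPotential_erase {c : Comp} {w : ℕ} (hw : w ∈ c.rem) (S : Finset ℕ) :
    searchPotential d D (⟨c.mem, c.rem.erase w, S⟩ :: l) + 30 = searchPotential d D (c :: l) := by
  have := Finset.card_erase_add_one hw
  unfold searchPotential
  simp only [states, stackWeight]
  omega

/-- One step of the search keeps the invariant, forgets no state, and is paid by the potential. -/
theorem stepCmd_wp {c : Comp} (h : SearchInv d s ∅ D (c :: l)) :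
    stepCmd.wp B (fun t => ∃ D' l', SearchInv d t ∅ D' l' ∧
      D ∪ states (c :: l) ⊆ D' ∪ states l' ∧
      t.time + 1 + searchPotential d D' l' ≤ s.time + searchPotential d D (c :: l)) s := by
  obtain ⟨⟨a1, a2, a3⟩, hst⟩ := h.stack
  have htop : s.var top = l.length + 1 := h.top
  have hc := h.valid.1
  simp only [stepCmd, Cmd.wp_seq, Cmd.wp_set, Cmd.wp_ite]
  have hca : s.arr ca (s.var top) = mask c.rem := by rw [htop, a2]
  refine ⟨fun hg => ?_, fun hg => ?_⟩
  · simp only [Expr.eval, Env.setVar_var, if_true, hca] at hg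
    obtain ⟨w, hw, hlow⟩ := exists_lowBit hg
    have hwn : w < d.n := by
      obtain ⟨v, _, hv⟩ := hc.rem w hw
      exact InputData.lt_of_mem_adj hv
    have hidx := h.tables.idx w hwn
    have hpot := fun S => searchPotential_erase (d := d) (D := D) (l := l) hw S
    refine ⟨fun hg => ?_, fun hg1 => ⟨fun hg => ?_, fun hg2 => ⟨fun hg => ?_, fun hg3 => ?_⟩⟩⟩
    · simp [a2, hlow, htop, a1, mask_and_two_pow_eq_zero] at hg
      rw [Cmd.wp_put]
      refine ⟨D, _, searchInv_erase h (S := c.sens) (w := w) ⟨hc.erase_of_mem hg, h.valid.2⟩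
        ?_ ?_ ?_ ?_, le_rfl, ?_⟩
      · simp
      · simp
      · simp [a2, hlow, htop, mask_sub_two_pow hw]
      · intro i
        by_cases hi : i = l.length + 1
        · simp [hi, a3]
        · simp [hi]
      · have := hpot c.sens
        simp
        omega
    · simp [htop, a2, hlow, h.done, mask_and_two_pow_eq_zero] at hg
      simp only [Cmd.wp_put]
      refine ⟨D, _, searchInv_erase h (S := c.sens ∪ d.senseSet w) (w := w)
        ⟨hc.erase_union hw, h.valid.2⟩ ?_ ?_ ?_ ?_, le_rfl, ?_⟩
      · simp
      · simp
      · simp [a2, hlow, htop, mask_sub_two_pow hw]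
      · simp [a2, hlow, htop, hidx, a3, h.res w hg, mask_or]
      · have := hpot (c.sens ∪ d.senseSet w)
        simp
        omega
    · simp [a2, hlow, htop, a1, mask_and_two_pow_eq_zero] at hg1
      simp [htop, a2, hlow, h.done, mask_and_two_pow_eq_zero] at hg2
      simp [htop, a2, hlow, h.seen, mask_and_two_pow_eq_zero, states, hg1, hg2] at hg
      cases l with
      | nil => simp [states] at hg
      | cons c' l =>
        refine Cmd.wp_mono (mergeCmd_wp (d := d) (D := D) (c := c) (c' := c') (l := l) (w := w)
          ?_ hw hg) ?_
        · exact ⟨h.tables, h.top, h.stack, h.done, h.seen, h.valid, h.res, h.subset⟩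
        · rintro t ⟨h1, h2⟩
          refine ⟨D, _, h1, ?_, ?_⟩
          · intro x
            simp only [states, Finset.mem_union]
            tauto
          simp at h2
          omega
    · simp [a2, hlow, htop, a1, mask_and_two_pow_eq_zero] at hg1
      simp [htop, a2, hlow, h.seen, mask_and_two_pow_eq_zero] at hg3
      rw [Cmd.wp_put]
      refine Cmd.wp_mono (pushCmd_wp (d := d) (D := D) (w := w)
        (l := ⟨c.mem, c.rem.erase w, c.sens⟩ :: l)
        (searchInv_erase h ⟨hc.erase_push hw, h.valid.2⟩ ?_ ?_ ?_ ?_) ?_ hwn (by decide) ?_) ?_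
      · simp
      · simp
      · simp [a2, hlow, htop, mask_sub_two_pow hw]
      · intro i
        by_cases hi : i = l.length + 1
        · simp [hi, a3]
        · simp [hi]
      · simp [htop, a2, hlow, hidx]
      · simpa [states] using hg3
      · rintro t ⟨h1, h2⟩
        refine ⟨D, _, h1, ?_, ?_⟩
        · intro x
          simp only [states, Finset.mem_union]
          tauto
        have := hpot c.sens
        simp at h2
        omega
  · simp only [Expr.eval, Env.setVar_var, if_true, hca, mask_eq_zero] at hg
    refine Cmd.wp_mono (finishCmd_wp (d := d) (D := D) (c := c) (l := l)
      ⟨h.tables, h.top, h.stack, h.done, h.seen, h.valid, h.res, h.subset⟩ hg) ?_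
    rintro t ⟨l', h1, h3, h2⟩
    refine ⟨_, l', h1, by rw [h3, states, Finset.union_assoc], ?_⟩
    simp at h2
    omega

/-- Correctness and linear running time of the search. -/
theorem searchCmd_wp (ht : d.Loaded s) (hseen : s.var seen = 0) (hdone : s.var done = 0)
    (htop : s.var top = 0) :
    searchCmd.wp B (fun t => (∀ i < d.p, t.arr row i = mask (d.senseSet (d.bs i))) ∧
      t.time ≤ s.time + 30 * (4 * d.n + d.e) + 10 * d.p + 10) s := by
  have hw : unseenWeight d ∅ ≤ d.e + 3 * d.n := by
    have h1 : ∑ v ∈ Finset.range d.n, ((Finset.range d.e).filter fun k => d.src k = v).card =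
        d.e := by
      rw [← Finset.card_eq_sum_card_fiberwise, Finset.card_range]
      intro k hk
      exact Finset.mem_coe.2 (Finset.mem_range.2 (d.src_lt k (Finset.mem_range.1 hk)))
    have h2 : ∑ v ∈ Finset.range d.n, (d.adj v).card ≤
        ∑ v ∈ Finset.range d.n, ((Finset.range d.e).filter fun k => d.src k = v).card :=
      Finset.sum_le_sum fun v _ => Finset.card_image_le
    unfold unseenWeight
    rw [Finset.sdiff_empty, Finset.sum_add_distrib, Finset.sum_const, Finset.card_range,
      smul_eq_mul]
    omega
  unfold searchCmd
  refine Cmd.wp_upto 8 (fun k φ t => ∃ D, SearchInv d t ∅ D [] ∧ φ = searchPotential d D [] ∧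
    (∀ i < k, t.arr row i = mask (d.senseSet (d.bs i)))) (N := d.p)
    (φ₀ := searchPotential d ∅ []) ht.nA rfl rfl ?_ ?_ ?_
  · refine ⟨∅, ⟨?_, ?_, ?_, ?_, ?_, ?_, ?_, ?_⟩, rfl, by simp⟩
    · exact ⟨fun i hi => ht.pow i (by omega), fun i hi => ht.idx i (by omega), ht.adj, ht.own⟩
    · simp [htop]
    · trivial
    · simp [hdone]
    · simp [hseen, states]
    · trivial
    · simp
    · simp [states]
  · rintro k φ t hk ⟨D, hI, rfl, hrow⟩ hi hF
    have hact : t.arr act k = d.bs k := by rw [hF.arr act rfl, ht.act k hk]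
    have hv := d.bs_lt k hk
    have hpow := hI.tables.pow _ hv
    set v := d.bs k with hvdef
    rw [Cmd.wp_seq, Cmd.wp_set, Cmd.wp_seq]
    have hvv : Expr.eval t.tick (Expr.get act (Expr.var ii)) = v := by simp [hi, hact]
    rw [hvv]
    -- The remaining task: once the search has stopped with `v` finished, store its sensors.
    have key : ∀ D' u, SearchInv d u ∅ D' [] → v ∈ D' → u.var vv = v →
        u.var ii = k → u.arr row = t.arr row →
        u.time + searchPotential d D' [] ≤ t.time + searchPotential d D [] + 7 →
        (Cmd.put row ii (res vv)).wp B (fun t' => ∃ φ', (∃ D, SearchInv d (t'.setVar ii (k + 1)) ∅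
          D [] ∧ φ' = searchPotential d D [] ∧
          ∀ i < k + 1, (t'.setVar ii (k + 1)).arr row i = mask (d.senseSet (d.bs i))) ∧
          t'.time + φ' ≤ t.time + searchPotential d D [] + 8) u := by
      intro D' u hu hvD huv hui hur hut
      rw [Cmd.wp_put]
      refine ⟨_, ⟨D', ⟨?_, ?_, ?_, ?_, ?_, ?_, ?_, ?_⟩, rfl, ?_⟩, ?_⟩
      · exact hu.tables.congr (by simp) (by simp) (by simp) (by simp)
      · simpa using hu.top
      · trivial
      · simpa using hu.done
      · simpa using hu.seen
      · trivial
      · simpa using hu.res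
      · exact hu.subset
      · intro i hi'
        rcases eq_or_ne i k with rfl | hne
        · simp [hui, huv, hu.res v hvD, ← hvdef]
        · simp [hui, hne, hur, hrow i (by omega)]
      · simp
        omega
    have h0 : SearchInv d (t.tick.setVar vv v).tick ∅ D [] :=
      ⟨hI.tables, by simpa using hI.top, trivial, by simpa using hI.done, by simpa using hI.seen,
        trivial, hI.res, hI.subset⟩
    rw [Cmd.wp_ite]
    refine ⟨fun hg => ?_, fun hg => ?_⟩
    · simp [hI.done, hpow, mask_and_two_pow_eq_zero] at hg
      rw [Cmd.wp_skip]
      refine key D _ h0 hg (by simp) (by simpa using hi) rfl (by simp; omega)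
    · simp [hI.done, hpow, mask_and_two_pow_eq_zero] at hg
      rw [Cmd.wp_seq]
      have h1 : SearchInv d (t.tick.setVar vv v).tick {v} D [] :=
        ⟨h0.tables, h0.top, trivial, h0.done, h0.seen, trivial, h0.res, h0.subset⟩
      refine Cmd.wp_mono (Cmd.wp_frame (pushCmd_wp h1 (v := vv) (by simp) hv (by decide)
        (by simpa [states] using hg))) ?_
      rintro u ⟨⟨h2, h3⟩, hF2⟩
      refine Cmd.wp_loop (fun φ u' => ∃ D' l', SearchInv d u' ∅ D' l' ∧ v ∈ D' ∪ states l' ∧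
        φ = searchPotential d D' l') ⟨D, _, h2, by simp [states], rfl⟩ ?_ ?_
      · rintro φ u' ⟨D', l', h4, h5, rfl⟩ hF3 hg
        cases l' with
        | nil => simp [h4.top] at hg
        | cons c l' =>
          have h6 : SearchInv d u'.tick ∅ D' (c :: l') :=
            ⟨h4.tables, h4.top, h4.stack, h4.done, h4.seen, h4.valid, h4.res, h4.subset⟩
          refine Cmd.wp_mono (stepCmd_wp h6) ?_
          rintro t' ⟨D'', l'', a1, a2, a3⟩
          refine ⟨_, ⟨D'', l'', a1, a2 h5, rfl⟩, ?_⟩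
          simp at a3
          omega
      · rintro φ u' ⟨D', l', h4, h5, rfl⟩ hF3 hg hut
        have hl : l' = [] := by simpa [h4.top] using hg
        subst hl
        refine key D' _ ⟨h4.tables, h4.top, trivial, h4.done, h4.seen, trivial, h4.res,
          h4.subset⟩ (by simpa [states] using h5) ?_ ?_ ?_ ?_
        · simp [hF3.var vv rfl, hF2.var vv rfl]
        · simp [hF3.var ii rfl, hF2.var ii rfl, hi]
        · rw [Env.tick_arr, hF3.arr row rfl, hF2.arr row rfl]
          rfl
        · simp at h3 ⊢
          omega
  · rintro φ t ⟨D, hI, rfl, hrow⟩ hF htime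
    refine ⟨hrow, ?_⟩
    simp only [searchPotential, stackWeight, states, Finset.union_empty] at htime
    simp at htime ⊢
    omega

end Search

/-! ### Maximum matching by augmenting paths -/

/-- One step of the search for an augmenting path: visits an unseen sensor `jj` adjacent to the
actuator `ii` in `todo`, or removes `ii` from `todo` if there is none. An unmatched sensor ends the
search. -/
def exploreCmd : Cmd :=
  .set xx (Expr.low todo) ;; .set ii (idx xx) ;; .set aa (row ii &&& unseen) ;;
  .ite aa
    (.set yy (Expr.low aa) ;; .set jj (idx yy) ;; .set unseen (unseen - yy) ;; .put par jj ii ;;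
      .ite (mr jj) (.set todo (todo ||| pow (mr jj - 1))) (.set found (jj + 1) ;; .set todo 0))
    (.set todo (todo - xx))

/-- Changes the matching along the path of parents that ends in the sensor `found - 1`. -/
def augmentCmd : Cmd :=
  .loop found (.set jj (found - 1) ;; .set ii (par jj) ;; .set found (ml ii) ;;
    .put ml ii (jj + 1) ;; .put mr jj (ii + 1)) ;;
  .set free (free - pow ii)

/-- One search for an augmenting path from all unmatched actuators. -/
def phaseCmd : Cmd :=
  .set unseen (pow nO - 1) ;; .set todo free ;; .set found 0 ;; .loop todo exploreCmd ;;
  .ite found augmentCmd (.set go 0)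

/-- Computes a maximum matching: `ml i` is `0` if the actuator `i` is unmatched and `j + 1` if it
is matched to the sensor `j`, and `mr` is the converse array. -/
def matchCmd : Cmd :=
  .set free (pow nA - 1) ;; .set go 1 ;; .loop go phaseCmd

section Matching

variable {B p m : ℕ} {N : ℕ → Finset ℕ} {s : Env}

/-- The bipartite graph in which matchings are computed, its tables and its sizes. -/
structure MatchTables (p m : ℕ) (N : ℕ → Finset ℕ) (s : Env) : Prop where
  nA : s.var nA = p
  nO : s.var nO = m
  pow : ∀ i ≤ p + m, s.arr pow i = 2 ^ i
  idx : ∀ i ≤ p + m, s.arr idx (2 ^ i) = i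
  row : ∀ i < p, s.arr row i = mask (N i)

theorem MatchTables.congr {s t : Env} (h : MatchTables p m N s) (h1 : t.var Var.nA = s.var Var.nA)
    (h2 : t.var Var.nO = s.var Var.nO) (h3 : t.arr Arr.pow = s.arr Arr.pow)
    (h4 : t.arr Arr.idx = s.arr Arr.idx) (h5 : t.arr Arr.row = s.arr Arr.row) :
    MatchTables p m N t :=
  ⟨h1 ▸ h.nA, h2 ▸ h.nO, h3 ▸ h.pow, h4 ▸ h.idx, h5 ▸ h.row⟩

/-- The arrays `l` and `r` describe a matching of the graph `N` on the actuators below `p`. -/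
structure IsMatchArray (p : ℕ) (N : ℕ → Finset ℕ) (l r : ℕ → ℕ) : Prop where
  left : ∀ i j, l i = j + 1 → i < p ∧ j ∈ N i ∧ r j = i + 1
  right : ∀ i j, r j = i + 1 → l i = j + 1

/-- The unmatched actuators. -/
def freeSet (p : ℕ) (l : ℕ → ℕ) : Finset ℕ := (Finset.range p).filter fun i => l i = 0

/-- The visited sensors `V` form a forest of alternating paths: the parent of a visited sensor is
adjacent to it, and is unmatched or matched to a visited sensor of smaller rank `ρ`. -/
def IsSearchForest (p : ℕ) (N : ℕ → Finset ℕ) (l par : ℕ → ℕ) (V : Finset ℕ) (ρ : ℕ → ℕ)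
    (bound : ℕ) : Prop :=
  ∀ j ∈ V, ρ j ≤ bound → par j < p ∧ j ∈ N (par j) ∧
    (l (par j) = 0 ∨ ∃ r ∈ V, l (par j) = r + 1 ∧ ρ r < ρ j)

/-- The invariant of the search for an augmenting path, as long as none has been found. -/
structure ExploreInv (p m : ℕ) (N : ℕ → Finset ℕ) (l r par : ℕ → ℕ) (Z T V : Finset ℕ)
    (ρ : ℕ → ℕ) : Prop where
  todo : T ⊆ Z
  left : Z ⊆ Finset.range p
  right : V ⊆ Finset.range m
  free : freeSet p l ⊆ Z
  explored : ∀ i ∈ Z, i ∉ T → N i ⊆ V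
  mate : ∀ j ∈ V, ∃ i ∈ Z, r j = i + 1
  reached : ∀ i ∈ Z, l i = 0 ∨ ∃ j ∈ V, l i = j + 1
  forest : IsSearchForest p N l par V ρ m
  rank : ∀ j ∈ V, ρ j < V.card

/-- If the search ends without an augmenting path, then the explored sets provide a vertex cover
whose size is that of the matching, so that the matching is maximum. -/
theorem ExploreInv.card_le {l r par : ℕ → ℕ} {Z V : Finset ℕ} {ρ : ℕ → ℕ}
    (hl : IsMatchArray p N l r) (h : ExploreInv p m N l r par Z ∅ V ρ) (M : Finset (ℕ × ℕ))
    (hM : IsBipMatching (fun i j => i < p ∧ j ∈ N i) M) :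
    M.card + (freeSet p l).card ≤ p := by
  classical
  -- An edge of `M` is charged to its actuator outside `Z`, or else to the mate of its sensor.
  have h1 : (M.filter fun e => e.1 ∉ Z).card ≤ (Finset.range p \ Z).card := by
    refine Finset.card_le_card_of_injOn Prod.fst ?_ ?_
    · intro e he
      simp only [Finset.coe_filter, Set.mem_ofPred_eq] at he
      simp only [Finset.coe_sdiff, Finset.coe_range, Set.mem_sdiff, Set.mem_Iio, Finset.mem_coe]
      exact ⟨(hM.1 e he.1).1, he.2⟩
    · intro e he e' he' hee
      simp only [Finset.coe_filter, Set.mem_ofPred_eq] at he he'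
      exact hM.2 e he.1 e' he'.1 (Or.inl hee)
  have h2 : (M.filter fun e => ¬ e.1 ∉ Z).card ≤ (Z \ freeSet p l).card := by
    refine Finset.card_le_card_of_injOn (fun e => r e.2 - 1) ?_ ?_
    · intro e he
      simp only [Finset.coe_filter, Set.mem_ofPred_eq, not_not] at he
      have h3 := h.explored e.1 he.2 (Finset.notMem_empty _) (hM.1 e he.1).2
      obtain ⟨i, hi, hr⟩ := h.mate _ h3
      have := hl.right _ _ hr
      simp [hr, hi, freeSet, this]
    · intro e he e' he' hee
      simp only [Finset.coe_filter, Set.mem_ofPred_eq, not_not] at he he'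
      obtain ⟨i, hi, hr⟩ := h.mate _ (h.explored e.1 he.2 (Finset.notMem_empty _) (hM.1 e he.1).2)
      obtain ⟨i', hi', hr'⟩ :=
        h.mate _ (h.explored e'.1 he'.2 (Finset.notMem_empty _) (hM.1 e' he'.1).2)
      have hii : i = i' := by simpa [hr, hr'] using hee
      subst hii
      have := (hl.right _ _ hr).symm.trans (hl.right _ _ hr')
      exact hM.2 e he.1 e' he'.1 (Or.inr (by omega))
  have h3 := Finset.card_filter_add_card_filter_not (s := M) (fun e => e.1 ∉ Z)
  have h4 := Finset.card_sdiff_add_card_eq_card h.left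
  have h5 := Finset.card_sdiff_add_card_eq_card h.free
  rw [Finset.card_range] at h4
  omega

/-- The step of the search that finds that `i` has no unvisited neighbour. -/
theorem ExploreInv.erase {l r par : ℕ → ℕ} {Z T V : Finset ℕ} {ρ : ℕ → ℕ} {i : ℕ}
    (h : ExploreInv p m N l r par Z T V ρ) (hi : N i ⊆ V) :
    ExploreInv p m N l r par Z (T.erase i) V ρ := by
  refine { h with todo := (Finset.erase_subset i T).trans h.todo, explored := ?_ }
  intro i' hi' hT
  by_cases hii : i' = i
  · exact hii ▸ hi
  · exact h.explored i' hi' fun h' => hT (Finset.mem_erase.2 ⟨hii, h'⟩)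

/-- Visiting a new sensor extends the forest. -/
theorem ExploreInv.forest_insert {l r par : ℕ → ℕ} {Z T V : Finset ℕ} {ρ : ℕ → ℕ} {i j : ℕ}
    (h : ExploreInv p m N l r par Z T V ρ) (hi : i ∈ Z) (hj : j ∈ N i) (hjV : j ∉ V) :
    IsSearchForest p N l (fun x => if x = j then i else par x) (insert j V)
      (fun x => if x = j then V.card else ρ x) m := by
  intro x hx hxm
  by_cases hxj : x = j
  · subst hxj
    simp only [if_true]
    refine ⟨Finset.mem_range.1 (h.left hi), hj, ?_⟩
    rcases h.reached i hi with h1 | ⟨y, hy, h1⟩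
    · exact .inl h1
    · have : y ≠ x := fun h' => hjV (h' ▸ hy)
      exact .inr ⟨y, Finset.mem_insert_of_mem hy, h1, by simpa [this] using h.rank y hy⟩
  · have hxV := Finset.mem_of_mem_insert_of_ne hx hxj
    simp only [hxj, if_false] at hxm ⊢
    obtain ⟨h1, h2, h3⟩ := h.forest x hxV hxm
    refine ⟨h1, h2, h3.imp_right ?_⟩
    rintro ⟨y, hy, h4, h5⟩
    have : y ≠ j := fun h' => hjV (h' ▸ hy)
    exact ⟨y, Finset.mem_insert_of_mem hy, h4, by simpa [this] using h5⟩

/-- The step of the search that visits a matched sensor. -/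
theorem ExploreInv.visit {l r par : ℕ → ℕ} {Z T V : Finset ℕ} {ρ : ℕ → ℕ} {i j i' : ℕ}
    (hl : IsMatchArray p N l r)
    (h : ExploreInv p m N l r par Z T V ρ) (hi : i ∈ Z) (hj : j ∈ N i) (hjm : j < m) (hjV : j ∉ V)
    (hr : r j = i' + 1) :
    ExploreInv p m N l r (fun x => if x = j then i else par x) (insert i' Z) (insert i' T)
      (insert j V) (fun x => if x = j then V.card else ρ x) where
  todo := Finset.insert_subset_insert _ h.todo
  left := Finset.insert_subset (Finset.mem_range.2 (hl.left _ _ (hl.right _ _ hr)).1) h.left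
  right := Finset.insert_subset (Finset.mem_range.2 hjm) h.right
  free := h.free.trans (Finset.subset_insert _ _)
  explored x hx hxT := by
    simp only [Finset.mem_insert, not_or] at hx hxT
    exact (h.explored x (hx.resolve_left hxT.1) hxT.2).trans (Finset.subset_insert _ _)
  mate x hx := by
    rcases Finset.mem_insert.1 hx with rfl | hx
    · exact ⟨i', Finset.mem_insert_self _ _, hr⟩
    · obtain ⟨y, hy, h1⟩ := h.mate x hx
      exact ⟨y, Finset.mem_insert_of_mem hy, h1⟩
  reached x hx := by
    rcases Finset.mem_insert.1 hx with rfl | hx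
    · exact .inr ⟨j, Finset.mem_insert_self _ _, hl.right _ _ hr⟩
    · refine (h.reached x hx).imp_right ?_
      rintro ⟨y, hy, h1⟩
      exact ⟨y, Finset.mem_insert_of_mem hy, h1⟩
  forest := h.forest_insert hi hj hjV
  rank x hx := by
    rw [Finset.card_insert_of_notMem hjV]
    by_cases hxj : x = j
    · simp [hxj]
    · have := h.rank x (Finset.mem_of_mem_insert_of_ne hx hxj)
      simp only [hxj, if_false]
      omega

/-- The invariant of the augmentation: the sensor `j` is to be matched to its parent. The
unmatched actuators are still those in `F`. -/
structure AugmentInv (p : ℕ) (N : ℕ → Finset ℕ) (l r par : ℕ → ℕ) (F V : Finset ℕ)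
    (ρ : ℕ → ℕ) (j : ℕ) : Prop where
  mem : j ∈ V
  left : ∀ i j', l i = j' + 1 → i < p ∧ j' ∈ N i ∧ j' ≠ j ∧ r j' = i + 1
  right : ∀ i j', j' ≠ j → r j' = i + 1 → l i = j' + 1
  forest : IsSearchForest p N l par V ρ (ρ j)
  free : freeSet p l = F

/-- The step of the augmentation at a matched parent. -/
theorem AugmentInv.step {l r par : ℕ → ℕ} {F V : Finset ℕ} {ρ : ℕ → ℕ} {j k : ℕ}
    (h : AugmentInv p N l r par F V ρ j) (hk : l (par j) = k + 1) :
    AugmentInv p N (fun x => if x = par j then j + 1 else l x)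
      (fun x => if x = j then par j + 1 else r x) par F V ρ k ∧ ρ k < ρ j := by
  obtain ⟨h1, h2, h3⟩ := h.forest j h.mem le_rfl
  have hkV : k ∈ V ∧ ρ k < ρ j := by
    rcases h3 with h3 | ⟨k', h3, h4, h5⟩
    · omega
    · have : k' = k := by omega
      exact this ▸ ⟨h3, h5⟩
  obtain ⟨a1, a2, a3, a4⟩ := h.left _ _ hk
  refine ⟨⟨hkV.1, ?_, ?_, ?_, ?_⟩, hkV.2⟩
  · intro i j' hi
    by_cases hip : i = par j
    · simp only [hip, if_true] at hi ⊢
      have : j' = j := by omega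
      subst this
      exact ⟨h1, h2, Ne.symm a3, by simp⟩
    · simp only [hip, if_false] at hi
      obtain ⟨b1, b2, b3, b4⟩ := h.left i j' hi
      refine ⟨b1, b2, ?_, by simpa [b3] using b4⟩
      rintro rfl
      omega
  · intro i j' hj' hi
    by_cases hjj : j' = j
    · simp only [hjj, if_true] at hi ⊢
      have : i = par j := by omega
      simp [this]
    · simp only [hjj, if_false] at hi
      have b := h.right i j' hjj hi
      have : i ≠ par j := by
        rintro rfl
        omega
      simpa [this] using b
  · intro x hx hxk
    obtain ⟨b1, b2, b3⟩ := h.forest x hx (hxk.trans hkV.2.le)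
    refine ⟨b1, b2, ?_⟩
    have : par x ≠ par j := by
      intro hp
      rcases b3 with b3 | ⟨y, _, b4, b5⟩
      · rw [hp] at b3
        omega
      · rw [hp, hk] at b4
        have : k = y := by omega
        subst this
        omega
    simpa [this] using b3
  · rw [← h.free]
    unfold freeSet
    refine Finset.filter_congr fun x _ => ?_
    by_cases hx : x = par j
    · simp [hx, hk]
    · simp [hx]

/-- The last step of the augmentation. -/
theorem AugmentInv.last {l r par : ℕ → ℕ} {F V : Finset ℕ} {ρ : ℕ → ℕ} {j : ℕ}
    (h : AugmentInv p N l r par F V ρ j) (hk : l (par j) = 0) :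
    IsMatchArray p N (fun x => if x = par j then j + 1 else l x)
      (fun x => if x = j then par j + 1 else r x) ∧ par j ∈ F ∧
      freeSet p (fun x => if x = par j then j + 1 else l x) = F.erase (par j) := by
  obtain ⟨h1, h2, h3⟩ := h.forest j h.mem le_rfl
  refine ⟨⟨?_, ?_⟩, ?_, ?_⟩
  · intro i j' hi
    by_cases hip : i = par j
    · simp only [hip, if_true] at hi ⊢
      have : j' = j := by omega
      subst this
      exact ⟨h1, h2, by simp⟩
    · simp only [hip, if_false] at hi
      obtain ⟨b1, b2, b3, b4⟩ := h.left i j' hi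
      exact ⟨b1, b2, by simpa [b3] using b4⟩
  · intro i j' hi
    by_cases hjj : j' = j
    · simp only [hjj, if_true] at hi ⊢
      have : i = par j := by omega
      simp [this]
    · simp only [hjj, if_false] at hi
      have b := h.right i j' hjj hi
      have : i ≠ par j := by
        rintro rfl
        omega
      simpa [this] using b
  · rw [← h.free]
    simp [freeSet, h1, hk]
  · rw [← h.free]
    ext x
    by_cases hx : x = par j
    · simp [freeSet, hx]
    · simp [freeSet, hx]

end Matching

section MatchingProgram

variable {B p m : ℕ} {N : ℕ → Finset ℕ} {s : Env}

theorem Env.putArr_arr_self (s : Env) (k : Arr) (a v : ℕ) :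
    (s.putArr k a v).arr k = fun b => if b = a then v else s.arr k b := by
  funext b
  simp

/-- The invariant of the search: either no augmenting path has been found yet, or one ends in the
sensor `found - 1`. -/
def SearchPhaseInv (p m : ℕ) (N : ℕ → Finset ℕ) (φ : ℕ) (t : Env) : Prop :=
  (t.var found = 0 ∧ ∃ Z T V ρ, t.var todo = mask T ∧ t.var unseen = mask (Finset.range m \ V) ∧
    ExploreInv p m N (t.arr ml) (t.arr mr) (t.arr par) Z T V ρ ∧
    φ = 20 * (T.card + 2 * (Finset.range m \ V).card)) ∨
  ∃ j V ρ, t.var found = j + 1 ∧ t.var todo = 0 ∧ j ∈ V ∧ t.arr mr j = 0 ∧ ρ j ≤ m ∧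
    IsSearchForest p N (t.arr ml) (t.arr par) V ρ m ∧ φ = 0

theorem exploreCmd_wp (hN : ∀ i, N i ⊆ Finset.range m) {Z T V : Finset ℕ} {ρ : ℕ → ℕ}
    (ht : MatchTables p m N s) (hl : IsMatchArray p N (s.arr ml) (s.arr mr))
    (hf : s.var found = 0) (htodo : s.var todo = mask T) (hT : s.var todo ≠ 0)
    (hun : s.var unseen = mask (Finset.range m \ V))
    (h : ExploreInv p m N (s.arr ml) (s.arr mr) (s.arr par) Z T V ρ) :
    exploreCmd.wp B (fun t => ∃ φ, SearchPhaseInv p m N φ t ∧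
      t.time + 1 + φ ≤ s.time + 20 * (T.card + 2 * (Finset.range m \ V).card)) s := by
  rw [htodo] at hT
  obtain ⟨i, hi, hlow⟩ := exists_lowBit hT
  have hiZ := h.todo hi
  have hip : i < p := Finset.mem_range.1 (h.left hiZ)
  have hidx := ht.idx i (by omega)
  have hrow := ht.row i hip
  have hTcard := Finset.card_erase_add_one hi
  simp only [exploreCmd, Cmd.wp_seq, Cmd.wp_set, Cmd.wp_ite]
  have haa : s.arr row i &&& s.var unseen = mask (N i ∩ (Finset.range m \ V)) := by
    rw [hrow, hun, mask_and]
  refine ⟨fun hg => ?_, fun hg => ?_⟩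
  · simp only [Expr.eval, Expr.eval_low, Env.setVar_var, Env.setVar_arr, if_true, reduceCtorEq,
      if_false, htodo, hlow, hidx, haa, Expr.eval_and] at hg
    obtain ⟨j, hj, hlow'⟩ := exists_lowBit hg
    obtain ⟨hjN, hj'⟩ := Finset.mem_inter.1 hj
    obtain ⟨hjm, hjV⟩ := Finset.mem_sdiff.1 hj'
    have hjm' := Finset.mem_range.1 hjm
    have hjidx := ht.idx j (by omega)
    have hV : (Finset.range m \ V).erase j = Finset.range m \ insert j V := by
      ext x
      simp only [Finset.mem_erase, Finset.mem_sdiff, Finset.mem_insert]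
      tauto
    have hVcard := Finset.card_erase_add_one hj'
    rw [hV] at hVcard
    simp only [Cmd.wp_put, Cmd.wp_ite, Cmd.wp_seq, Cmd.wp_set]
    refine ⟨fun hg => ?_, fun hg => ?_⟩
    · simp [htodo, hlow, hidx, haa, hlow', hjidx] at hg
      obtain ⟨i', hi'⟩ := Nat.exists_eq_succ_of_ne_zero hg
      have hi'p := (hl.left _ _ (hl.right _ _ hi')).1
      have hpow := ht.pow i' (by omega)
      refine ⟨_, Or.inl ⟨?_, insert i' Z, insert i' T, insert j V,
        fun x => if x = j then V.card else ρ x, ?_, ?_, ?_, rfl⟩, ?_⟩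
      · simp [hf]
      · simp [htodo, hlow, hidx, haa, hlow', hjidx, hi', hpow, mask_or_two_pow]
      · simp [htodo, hlow, hidx, haa, hlow']
        rw [hun, mask_sub_two_pow hj', hV]
      · have := h.visit hl hiZ hjN hjm' hjV hi'
        simpa [Env.putArr_arr_self, htodo, hlow, hidx, haa, hlow', hjidx] using this
      · have := Finset.card_insert_le i' T
        simp
        omega
    · simp [htodo, hlow, hidx, haa, hlow', hjidx] at hg
      refine ⟨0, Or.inr ⟨j, insert j V, fun x => if x = j then V.card else ρ x, ?_, ?_,
        Finset.mem_insert_self j V, ?_, ?_, ?_, rfl⟩, ?_⟩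
      · simp [htodo, hlow, hidx, haa, hlow', hjidx]
      · simp
      · simpa using hg
      · have := Finset.card_le_card h.right
        simpa using this
      · have := h.forest_insert hiZ hjN hjV
        simpa [Env.putArr_arr_self, htodo, hlow, hidx, haa, hlow', hjidx] using this
      · simp
        omega
  · simp only [Expr.eval, Expr.eval_low, Env.setVar_var, Env.setVar_arr, if_true, reduceCtorEq,
      if_false, htodo, hlow, hidx, haa, Expr.eval_and, mask_eq_zero] at hg
    have hiV : N i ⊆ V := by
      intro j hj
      by_contra hjV
      have : j ∈ N i ∩ (Finset.range m \ V) :=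
        Finset.mem_inter.2 ⟨hj, Finset.mem_sdiff.2 ⟨hN i hj, hjV⟩⟩
      rw [hg] at this
      exact absurd this (Finset.notMem_empty j)
    refine ⟨_, Or.inl ⟨?_, Z, T.erase i, V, ρ, ?_, ?_, ?_, rfl⟩, ?_⟩
    · simp [hf]
    · simp [htodo, hlow, mask_sub_two_pow hi]
    · simp [hun]
    · exact h.erase hiV
    · simp
      omega

/-- Augmentation takes at most one iteration for each rank in the search forest. -/
theorem augmentCmd_wp {V : Finset ℕ} {ρ : ℕ → ℕ} {j : ℕ} (ht : MatchTables p m N s)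
    (hfree : s.var free = mask (freeSet p (s.arr ml)))
    (hl : IsMatchArray p N (s.arr ml) (s.arr mr)) (hf : s.var found = j + 1) (hj : j ∈ V)
    (hmr : s.arr mr j = 0) (hρ : ρ j ≤ m)
    (hforest : IsSearchForest p N (s.arr ml) (s.arr par) V ρ m) :
    augmentCmd.wp B (fun t => IsMatchArray p N (t.arr ml) (t.arr mr) ∧
      t.var free = mask (freeSet p (t.arr ml)) ∧
      (freeSet p (t.arr ml)).card + 1 = (freeSet p (s.arr ml)).card ∧
      t.time ≤ s.time + 6 * (m + 1) + 2) s := by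
  simp only [augmentCmd, Cmd.wp_seq]
  refine Cmd.wp_loop (fun φ t => (∃ k, t.var found = k + 1 ∧ φ = 6 * (ρ k + 1) ∧
      AugmentInv p N (t.arr ml) (t.arr mr) (t.arr par) (freeSet p (s.arr ml)) V ρ k) ∨
    (t.var found = 0 ∧ φ = 0 ∧ IsMatchArray p N (t.arr ml) (t.arr mr) ∧
      t.var ii ∈ freeSet p (s.arr ml) ∧
      freeSet p (t.arr ml) = (freeSet p (s.arr ml)).erase (t.var ii)))
    (φ₀ := 6 * (ρ j + 1)) ?_ ?_ ?_
  · refine Or.inl ⟨j, hf, rfl, hj, ?_, fun i j' _ => hl.right i j', ?_, rfl⟩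
    · intro i j' hi
      obtain ⟨h1, h2, h3⟩ := hl.left i j' hi
      refine ⟨h1, h2, ?_, h3⟩
      rintro rfl
      omega
    · exact fun x hx hxj => hforest x hx (hxj.trans hρ)
  · rintro φ t (⟨k, hk, rfl, hI⟩ | ⟨h0, _⟩) hF hg
    · simp only [Cmd.wp_seq, Cmd.wp_set, Cmd.wp_put]
      rcases Nat.eq_zero_or_eq_succ_pred (t.arr ml (t.arr par k)) with h1 | h1
      · obtain ⟨h2, h3, h4⟩ := hI.last h1
        refine ⟨0, Or.inr ⟨?_, rfl, ?_, ?_, ?_⟩, ?_⟩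
        · simp [hk, h1]
        · simpa [Env.putArr_arr_self, hk] using h2
        · simpa [hk] using h3
        · simpa [Env.putArr_arr_self, hk] using h4
        · simp
          omega
      · obtain ⟨h2, h3⟩ := hI.step h1
        refine ⟨_, Or.inl ⟨(t.arr ml (t.arr par k)).pred, ?_, rfl, ?_⟩, ?_⟩
        · simpa [hk] using h1
        · simpa [Env.putArr_arr_self, hk] using h2
        · simp only [Env.putArr_time, Env.setVar_time, Env.tick_time]
          omega
    · exact absurd h0 hg
  · rintro φ t (⟨k, hk, _⟩ | ⟨_, rfl, h1, h2, h3⟩) hF hg htime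
    · simp [hk] at hg
    · have hlt : t.var ii < p := Finset.mem_range.1 (Finset.mem_filter.1 h2).1
      have hfr : t.var free = s.var free := hF.var free rfl
      have hpow : t.arr pow = s.arr pow := hF.arr pow rfl
      have := ht.pow (t.var ii) (by omega)
      rw [Cmd.wp_set]
      refine ⟨h1, ?_, ?_, ?_⟩
      · simp [h3, hfr, hfree, hpow, this, mask_sub_two_pow h2]
      · have := Finset.card_erase_add_one h2
        simpa [h3] using this
      · simp
        omega

/-- The result of a phase: an improved matching, or the proof that the matching is maximum. -/
theorem phaseCmd_wp (hN : ∀ i, N i ⊆ Finset.range m) (ht : MatchTables p m N s)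
    (hl : IsMatchArray p N (s.arr ml) (s.arr mr))
    (hfree : s.var free = mask (freeSet p (s.arr ml))) :
    phaseCmd.wp B (fun t => IsMatchArray p N (t.arr ml) (t.arr mr) ∧
      t.var free = mask (freeSet p (t.arr ml)) ∧
      ((t.var go = s.var go ∧ (freeSet p (t.arr ml)).card + 1 = (freeSet p (s.arr ml)).card) ∨
        (t.var go = 0 ∧ freeSet p (t.arr ml) = freeSet p (s.arr ml) ∧
          ∀ M : Finset (ℕ × ℕ), IsBipMatching (fun i j => i < p ∧ j ∈ N i) M →
            M.card + (freeSet p (t.arr ml)).card ≤ p)) ∧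
      t.time ≤ s.time + 46 * (p + m) + 20) s := by
  simp only [phaseCmd, Cmd.wp_seq, Cmd.wp_set]
  have hcard : (freeSet p (s.arr ml)).card ≤ p := by
    have := Finset.card_le_card (Finset.filter_subset (fun i => s.arr ml i = 0) (Finset.range p))
    rwa [Finset.card_range] at this
  refine Cmd.wp_loop (SearchPhaseInv p m N) (φ₀ := 20 * ((freeSet p (s.arr ml)).card + 2 * m))
    ?_ ?_ ?_
  · refine Or.inl ⟨by simp, freeSet p (s.arr ml), freeSet p (s.arr ml), ∅, fun _ => 0, ?_, ?_, ?_, ?_⟩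
    · simp [hfree]
    · have := ht.pow m (by omega)
      simp [ht.nO, this, mask_range]
    · refine ⟨le_rfl, Finset.filter_subset _ _, Finset.empty_subset _, le_rfl,
        fun i h1 h2 => absurd h1 h2, ?_, ?_, ?_, ?_⟩
      · simp
      · exact fun i hi => Or.inl (Finset.mem_filter.1 hi).2
      · intro x hx
        simp at hx
      · simp
    · simp
  · rintro φ t hI hF hg
    have e1 : t.arr ml = s.arr ml := hF.arr ml rfl
    have e2 : t.arr mr = s.arr mr := hF.arr mr rfl
    rcases hI with ⟨hf, Z, T, V, ρ, h1, h2, h3, rfl⟩ | ⟨j, V, ρ, _, h1, _⟩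
    · have ht' : MatchTables p m N t.tick := ht.congr (hF.var nA rfl) (hF.var nO rfl)
        (hF.arr Arr.pow rfl) (hF.arr Arr.idx rfl) (hF.arr Arr.row rfl)
      refine Cmd.wp_mono (exploreCmd_wp (s := t.tick) hN ht' (by simpa [e1, e2] using hl) hf h1
        (by simpa using hg) h2 h3) ?_
      rintro u ⟨φ, h4, h5⟩
      refine ⟨φ, h4, ?_⟩
      simp at h5
      omega
    · exact absurd h1 hg
  · rintro φ t hI hF hg htime
    have e1 : t.arr ml = s.arr ml := hF.arr ml rfl
    have e2 : t.arr mr = s.arr mr := hF.arr mr rfl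
    have e3 : t.var free = s.var free := hF.var free rfl
    have e4 : t.var go = s.var go := hF.var go rfl
    have e5 : t.time ≤ s.time + 40 * (p + m) + 3 := by
      simp at htime
      omega
    rw [Cmd.wp_ite]
    rcases hI with ⟨hf, Z, T, V, ρ, h1, h2, h3, rfl⟩ | ⟨j, V, ρ, hf, h1, h2, h3, h4, h5, rfl⟩
    · refine ⟨fun hg' => absurd hf hg', fun _ => ?_⟩
      have hT : T = ∅ := by simpa [h1] using hg
      subst hT
      rw [Cmd.wp_set]
      refine ⟨?_, ?_, Or.inr ⟨?_, ?_, ?_⟩, ?_⟩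
      · simpa [e1, e2] using hl
      · simpa [e1, e3] using hfree
      · simp
      · simp [e1]
      · intro M hM
        exact h3.card_le (by simpa [e1, e2] using hl) M hM
      · simp
        omega
    · refine ⟨fun _ => ?_, fun hg' => by simp [hf] at hg'⟩
      have ht' : MatchTables p m N t.tick.tick := ht.congr (hF.var nA rfl) (hF.var nO rfl)
        (hF.arr Arr.pow rfl) (hF.arr Arr.idx rfl) (hF.arr Arr.row rfl)
      refine Cmd.wp_mono (Cmd.wp_frame (augmentCmd_wp (s := t.tick.tick) ht'
        (by simpa [e1, e3] using hfree) (by simpa [e1, e2] using hl) hf h2 h3 h4 h5)) ?_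
      rintro u ⟨⟨a1, a2, a3, a4⟩, aF⟩
      refine ⟨a1, a2, Or.inl ⟨?_, ?_⟩, ?_⟩
      · rw [aF.var go rfl]
        exact e4
      · simpa [e1] using a3
      · simp at a4
        omega

/-- The arrays `ml` and `mr` become a maximum matching. -/
theorem matchCmd_wp (hN : ∀ i, N i ⊆ Finset.range m) (ht : MatchTables p m N s)
    (hml : ∀ i, s.arr ml i = 0) (hmr : ∀ i, s.arr mr i = 0) :
    matchCmd.wp B (fun t => IsMatchArray p N (t.arr ml) (t.arr mr) ∧
      (∀ M : Finset (ℕ × ℕ), IsBipMatching (fun i j => i < p ∧ j ∈ N i) M →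
        M.card + (freeSet p (t.arr ml)).card ≤ p) ∧
      t.time ≤ s.time + (46 * (p + m) + 21) * (p + 1) + 3) s := by
  simp only [matchCmd, Cmd.wp_seq, Cmd.wp_set]
  refine Cmd.wp_loop (fun φ t => IsMatchArray p N (t.arr ml) (t.arr mr) ∧
      t.var free = mask (freeSet p (t.arr ml)) ∧
      ((t.var go ≠ 0 ∧ φ = (46 * (p + m) + 21) * ((freeSet p (t.arr ml)).card + 1)) ∨
      (t.var go = 0 ∧ φ = 0 ∧
        ∀ M : Finset (ℕ × ℕ), IsBipMatching (fun i j => i < p ∧ j ∈ N i) M →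
        M.card + (freeSet p (t.arr ml)).card ≤ p)))
    (φ₀ := (46 * (p + m) + 21) * (p + 1)) ?_ ?_ ?_
  · have hfs : freeSet p (s.arr ml) = Finset.range p :=
      Finset.filter_true_of_mem fun i _ => hml i
    have := ht.pow p (by omega)
    refine ⟨⟨?_, ?_⟩, ?_, Or.inl ⟨?_, ?_⟩⟩
    · intro i j h
      simp [hml] at h
    · intro i j h
      simp [hmr] at h
    · simp [hfs, mask_range, ht.nA, this]
    · simp
    · simp [hfs]
  · rintro φ t ⟨h1, h2, h3⟩ hF hg
    rcases h3 with ⟨_, rfl⟩ | ⟨h3, _⟩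
    · have ht' : MatchTables p m N t.tick := ht.congr (hF.var nA rfl) (hF.var nO rfl)
        (hF.arr Arr.pow rfl) (hF.arr Arr.idx rfl) (hF.arr Arr.row rfl)
      refine Cmd.wp_mono (phaseCmd_wp (s := t.tick) hN ht' h1 h2) ?_
      rintro u ⟨a1, a2, ⟨a3, a4⟩ | ⟨a3, a4, a5⟩, a6⟩
      · refine ⟨_, ⟨a1, a2, Or.inl ⟨by rw [a3]; exact hg, rfl⟩⟩, ?_⟩
        simp at a4 a6
        rw [← a4, Nat.mul_succ _ (_ + 1)]
        omega
      · refine ⟨0, ⟨a1, a2, Or.inr ⟨a3, rfl, a5⟩⟩, ?_⟩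
        simp at a6
        rw [Nat.mul_succ]
        have := Nat.zero_le ((46 * (p + m) + 21) * (freeSet p (t.arr ml)).card)
        omega
    · exact absurd h3 hg
  · rintro φ t ⟨h1, h2, h3⟩ hF hg htime
    rcases h3 with ⟨h3, _⟩ | ⟨_, rfl, h3⟩
    · exact absurd hg h3
    · refine ⟨h1, h3, ?_⟩
      simp at htime ⊢
      omega

end MatchingProgram

/-! ### Output of the links -/

/-- Lists the matched actuators in `al`, and their sensors in `sl`, shifted by one position
cyclically. -/
def pairCmd : Cmd :=
  .set top 0 ;;
  .upto nA (.ite (ml ii)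
    (.put al top ii ;; .set top (top + 1) ;; .put sl top (ml ii - 1)) .skip) ;;
  .put sl 0 (sl top)

/-- Appends to the array `g`, from position `tt` on, all numbers below `h` at which the array `f`
vanishes. -/
def collectCmd (h : Var) (f g : Arr) : Cmd :=
  .upto h (.ite (f ii) .skip (.put g tt ii ;; .set tt (tt + 1)))

/-- Writes the links. -/
def writeCmd : Cmd :=
  .set xx (nA + (nO - nA)) ;; .write 0 xx ;;
  .upto xx (.write (ii + ii + 1) (sl ii) ;; .write (ii + ii + 2) (al ii))

/-- Outputs the links of a result of the procedure for the computed matching. -/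
def outputCmd : Cmd :=
  pairCmd ;; .set tt top ;; collectCmd nA ml al ;; .set tt top ;; collectCmd nO mr sl ;; writeCmd

section Output

variable {B p m : ℕ} {N : ℕ → Finset ℕ} {s : Env}

/-- The links from sensor `b t` to actuator `a t`, `t < max p m`: first the
`k` links of a sequential pairing of the matching described by `l` and `r`, then the extra
links. -/
structure IsLinkList (p m : ℕ) (l r a b : ℕ → ℕ) (k : ℕ) : Prop where
  le_left : k ≤ p
  pair : ∀ t < k, l (a t) = (if t + 1 = k then b 0 else b (t + 1)) + 1
  left_lt : ∀ t, a t < p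
  right_lt : ∀ t, b t < m
  left_inj : ∀ t < p, ∀ t' < p, a t = a t' → t = t'
  right_inj : ∀ t < m, ∀ t' < m, b t = b t' → t = t'
  left_extra : ∀ t, k ≤ t → t < p → l (a t) = 0
  right_extra : ∀ t, k ≤ t → t < m → r (b t) = 0
  left_surj : ∀ i < p, l i = 0 → ∃ t, k ≤ t ∧ t < p ∧ a t = i
  right_surj : ∀ j < m, r j = 0 → ∃ t, k ≤ t ∧ t < m ∧ b t = j
  matched_surj : ∀ i < p, l i ≠ 0 → ∃ t < k, a t = i

/-- The first `k` positions hold the sequential pairing: position `u + 1` of `sl` holds the sensor of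
the actuator in position `u` of `al`, cyclically. -/
theorem pairCmd_wp (hA : s.var nA = p) (hml : ∀ i < p, s.arr ml i ≤ m)
    (hal : ∀ t, s.arr al t = 0) (hsl : ∀ t, s.arr sl t = 0) :
    pairCmd.wp B (fun t => ∃ k, t.var top = k ∧
      (∀ u < k, t.arr al u < p ∧
        s.arr ml (t.arr al u) = (if u + 1 = k then t.arr sl 0 else t.arr sl (u + 1)) + 1) ∧
      (∀ u < k, ∀ u' < k, t.arr al u = t.arr al u' → u = u') ∧
      (∀ i < p, s.arr ml i ≠ 0 → ∃ u < k, t.arr al u = i) ∧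
      (∀ u, k ≤ u → t.arr al u = 0) ∧ (∀ u, t.arr sl u ≤ m - 1) ∧
      t.time ≤ s.time + 6 * p + 10) s := by
  simp only [pairCmd, Cmd.wp_seq, Cmd.wp_set]
  refine Cmd.wp_upto 5 (fun c φ t => φ = 0 ∧ ∃ k, t.var top = k ∧
      (∀ u < k, t.arr al u < c ∧ s.arr ml (t.arr al u) = t.arr sl (u + 1) + 1) ∧
      (∀ u < k, ∀ u' < k, t.arr al u = t.arr al u' → u = u') ∧
      (∀ i < c, s.arr ml i ≠ 0 → ∃ u < k, t.arr al u = i) ∧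
      (∀ u, k ≤ u → t.arr al u = 0) ∧ (∀ u, t.arr sl u ≤ m - 1))
    (N := p) (φ₀ := 0) (by simpa using hA) rfl rfl ?_ ?_ ?_
  · refine ⟨rfl, 0, ?_⟩
    simp [hal, hsl]
  · rintro c φ t hc ⟨rfl, k, h1, h2, h3, h4, h5, h6⟩ hi hF
    have hmle : t.arr ml = s.arr ml := hF.arr ml rfl
    rw [Cmd.wp_ite]
    refine ⟨fun hg => ?_, fun hg => ?_⟩
    · simp only [Expr.eval, Env.tick_arr, Env.tick_var, hi, hmle] at hg
      simp only [Cmd.wp_seq, Cmd.wp_put, Cmd.wp_set]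
      have hm := hml c hc
      refine ⟨0, ⟨rfl, k + 1, ?_, ?_, ?_, ?_, ?_, ?_⟩, ?_⟩
      · simp [h1]
      · intro u hu
        rcases Nat.lt_succ_iff_lt_or_eq.1 hu with hu | rfl
        · obtain ⟨a1, a2⟩ := h2 u hu
          have : u ≠ k := by omega
          simp [h1, this, a2]
          omega
        · simp [h1, hi, hmle]
          omega
      · intro u hu u' hu'
        rcases Nat.lt_succ_iff_lt_or_eq.1 hu with hu | rfl <;>
          rcases Nat.lt_succ_iff_lt_or_eq.1 hu' with hu' | rfl
        · have e1 : u ≠ k := by omega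
          have e2 : u' ≠ k := by omega
          simpa [h1, e1, e2] using h3 u hu u' hu'
        · have e1 : u ≠ u' := by omega
          have := (h2 u hu).1
          simp [h1, e1, hi]
          omega
        · have e1 : u' ≠ u := by omega
          have := (h2 u' hu').1
          simp [h1, e1, hi]
          omega
        · simp
      · intro i hi' hne
        rcases Nat.lt_succ_iff_lt_or_eq.1 hi' with hi' | rfl
        · obtain ⟨u, hu, hui⟩ := h4 i hi' hne
          have : u ≠ k := by omega
          exact ⟨u, by omega, by simp [h1, this, hui]⟩
        · exact ⟨k, by omega, by simp [h1, hi]⟩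
      · intro u hu
        have : u ≠ k := by omega
        simp [h1, this, h5 u (by omega)]
      · intro u
        by_cases hu : u = k + 1
        · simp [hu, h1, hi, hmle]
          omega
        · simp [hu, h1, h6]
      · simp
    · simp only [Expr.eval, Env.tick_arr, Env.tick_var, hi, hmle] at hg
      rw [Cmd.wp_skip]
      refine ⟨0, ⟨rfl, k, ?_, ?_, h3, ?_, h5, h6⟩, ?_⟩
      · simp [h1]
      · intro u hu
        obtain ⟨a1, a2⟩ := h2 u hu
        exact ⟨Nat.lt_succ_of_lt a1, a2⟩
      · intro i hi' hne
        rcases Nat.lt_succ_iff_lt_or_eq.1 hi' with hi' | rfl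
        · exact h4 i hi' hne
        · exact absurd hg hne
      · simp
  · rintro φ t ⟨rfl, k, h1, h2, h3, h4, h5, h6⟩ hF htime
    rw [Cmd.wp_put]
    refine ⟨k, ?_, ?_, ?_, ?_, ?_, ?_, ?_⟩
    · simp [h1]
    · intro u hu
      obtain ⟨a1, a2⟩ := h2 u hu
      by_cases hk : u + 1 = k
      · simp [hk, h1, a1, a2]
      · simp [hk, a1, a2]
    · simpa using h3
    · simpa using h4
    · simpa using h5
    · intro u
      by_cases hu : u = 0
      · simp [hu, h6]
      · simp [hu, h6]
    · simp at htime ⊢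
      omega

theorem collectCmd_wp {h : Var} {f g : Arr} {n k : ℕ} (hfg : f ≠ g) (hii : h ≠ ii) (htt : h ≠ tt)
    (hn : s.var h = n) (hk : s.var tt = k) :
    (collectCmd h f g).wp B (fun t => ∃ k', k ≤ k' ∧
      (∀ u, u < k ∨ k' ≤ u → t.arr g u = s.arr g u) ∧
      (∀ u, k ≤ u → u < k' → t.arr g u < n ∧ s.arr f (t.arr g u) = 0) ∧
      (∀ u, k ≤ u → u < k' → ∀ u', k ≤ u' → u' < k' → t.arr g u = t.arr g u' → u = u') ∧
      (∀ i < n, s.arr f i = 0 → ∃ u, k ≤ u ∧ u < k' ∧ t.arr g u = i) ∧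
      t.time ≤ s.time + 5 * n + 2) s := by
  unfold collectCmd
  refine Cmd.wp_upto 4 (fun c φ t => φ = 0 ∧ ∃ k', t.var tt = k' ∧ k ≤ k' ∧
      (∀ u, u < k ∨ k' ≤ u → t.arr g u = s.arr g u) ∧
      (∀ u, k ≤ u → u < k' → t.arr g u < c ∧ s.arr f (t.arr g u) = 0) ∧
      (∀ u, k ≤ u → u < k' → ∀ u', k ≤ u' → u' < k' → t.arr g u = t.arr g u' → u = u') ∧
      (∀ i < c, s.arr f i = 0 → ∃ u, k ≤ u ∧ u < k' ∧ t.arr g u = i)) (N := n) (φ₀ := 0) hn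
      ?_ rfl ?_ ?_ ?_
  · simp [Cmd.upto, Cmd.writesVar, hii.symm, htt.symm]
  · refine ⟨rfl, k, by simp [hk], le_rfl, by simp, ?_, ?_, by simp⟩
    · intro u h1 h2
      omega
    · intro u h1 h2
      omega
  · rintro c φ t hc ⟨rfl, k', h1, h2, h3, h4, h5, h6⟩ hi hF
    have hf : t.arr f = s.arr f :=
      hF.arr f (by simp [Cmd.upto, Cmd.writesArr, hfg.symm])
    rw [Cmd.wp_ite]
    refine ⟨fun hg => ?_, fun hg => ?_⟩
    · simp only [Expr.eval, Env.tick_arr, Env.tick_var, hi, hf] at hg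
      rw [Cmd.wp_skip]
      refine ⟨0, ⟨rfl, k', by simp [h1], h2, h3, ?_, h5, ?_⟩, ?_⟩
      · intro u hu hu'
        obtain ⟨a1, a2⟩ := h4 u hu hu'
        exact ⟨Nat.lt_succ_of_lt a1, a2⟩
      · intro i hi' hne
        rcases Nat.lt_succ_iff_lt_or_eq.1 hi' with hi' | rfl
        · exact h6 i hi' hne
        · exact absurd hne hg
      · simp
    · simp only [Expr.eval, Env.tick_arr, Env.tick_var, hi, hf] at hg
      simp only [Cmd.wp_seq, Cmd.wp_put, Cmd.wp_set]
      refine ⟨0, ⟨rfl, k' + 1, ?_, by omega, ?_, ?_, ?_, ?_⟩, ?_⟩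
      · simp [h1]
      · intro u hu
        have : u ≠ k' := by omega
        simp [h1, this, h3 u (by omega)]
      · intro u hu hu'
        rcases Nat.lt_succ_iff_lt_or_eq.1 hu' with hu' | rfl
        · obtain ⟨a1, a2⟩ := h4 u hu hu'
          have : u ≠ k' := by omega
          simp [h1, this, a2]
          omega
        · simp [h1, hi, hg]
      · intro u hu1 hu v hv1 hv
        rcases Nat.lt_succ_iff_lt_or_eq.1 hu with hu | rfl <;>
          rcases Nat.lt_succ_iff_lt_or_eq.1 hv with hv | rfl
        · have e1 : u ≠ k' := by omega
          have e2 : v ≠ k' := by omega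
          simpa [h1, e1, e2] using h5 u hu1 hu v hv1 hv
        · have e1 : u ≠ v := by omega
          have := (h4 u hu1 hu).1
          simp [h1, e1, hi]
          omega
        · have e1 : v ≠ u := by omega
          have := (h4 v hv1 hv).1
          simp [h1, e1, hi]
          omega
        · simp
      · intro i hi' hne
        rcases Nat.lt_succ_iff_lt_or_eq.1 hi' with hi' | rfl
        · obtain ⟨u, hu1, hu, hui⟩ := h6 i hi' hne
          have : u ≠ k' := by omega
          exact ⟨u, hu1, by omega, by simp [h1, this, hui]⟩
        · exact ⟨k', h2, by omega, by simp [h1, hi]⟩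
      · simp
  · rintro φ t ⟨rfl, k', h1, h2, h3, h4, h5, h6⟩ hF htime
    refine ⟨k', h2, h3, h4, h5, h6, ?_⟩
    simp at htime ⊢
    omega

theorem writeCmd_wp {a b : ℕ → ℕ} (hA : s.var nA = p) (hO : s.var nO = m)
    (ha : s.arr al = a) (hb : s.arr sl = b) (hB : 2 * (p + m) + 1 ≤ B) :
    writeCmd.wp B (fun t => t.raw 0 = max p m ∧
      (∀ u < max p m, t.raw (1 + 2 * u) = b u ∧ t.raw (2 + 2 * u) = a u) ∧
      t.time ≤ s.time + 4 * (p + m) + 5) s := by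
  simp only [writeCmd, Cmd.wp_seq, Cmd.wp_set, Cmd.wp_write]
  have hmax : p + (m - p) = max p m := by omega
  refine ⟨by simp; omega, ?_⟩
  refine Cmd.wp_upto 3 (fun c φ t => φ = 0 ∧ t.raw 0 = max p m ∧
    ∀ u < c, t.raw (1 + 2 * u) = b u ∧ t.raw (2 + 2 * u) = a u) (N := max p m) (φ₀ := 0)
    (by simp [hA, hO, hmax]) rfl rfl ?_ ?_ ?_
  · simp [hA, hO, hmax]
  · rintro c φ t hc ⟨rfl, h1, h2⟩ hi hF
    have e1 : t.arr al = a := (hF.arr al rfl).trans ha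
    have e2 : t.arr sl = b := (hF.arr sl rfl).trans hb
    simp only [Cmd.wp_seq, Cmd.wp_write]
    refine ⟨by simp [hi]; omega, by simp [hi]; omega, 0, ⟨rfl, by simp [h1], ?_⟩, ?_⟩
    · intro u hu
      have g1 : 1 + 2 * u ≠ c + c + 2 := by omega
      have g2 : 2 + 2 * u ≠ c + c + 1 := by omega
      rcases Nat.lt_succ_iff_lt_or_eq.1 hu with hu | rfl
      · obtain ⟨a1, a2⟩ := h2 u hu
        have g3 : 1 + 2 * u ≠ c + c + 1 := by omega
        have g4 : 2 + 2 * u ≠ c + c + 2 := by omega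
        simp [hi, g1, g2, g3, g4, a1, a2]
      · have g3 : 1 + 2 * u = u + u + 1 := by omega
        have g4 : 2 + 2 * u = u + u + 2 := by omega
        simp [hi, g3, g4, e1, e2]
    · simp
  · rintro φ t ⟨rfl, h1, h2⟩ hF htime
    refine ⟨h1, h2, ?_⟩
    simp at htime ⊢
    omega

end Output

section Output

variable {B p m : ℕ} {N : ℕ → Finset ℕ} {s : Env}

theorem eq_of_bijOn_range {f : ℕ → ℕ} {k p : ℕ} (h1 : ∀ u < k, f u < p)
    (h2 : ∀ u < k, ∀ u' < k, f u = f u' → u = u') (h3 : ∀ i < p, ∃ u < k, f u = i) : k = p := by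
  have h4 : (Finset.range k).image f = Finset.range p := by
    ext i
    simp only [Finset.mem_image, Finset.mem_range]
    exact ⟨fun ⟨u, hu, hui⟩ => hui ▸ h1 u hu, fun hi => h3 i hi⟩
  have h5 := congrArg Finset.card h4
  rwa [Finset.card_image_of_injOn, Finset.card_range, Finset.card_range] at h5
  intro u hu u' hu' h
  exact h2 u (Finset.mem_range.1 hu) u' (Finset.mem_range.1 hu') h

/-- The output is a list of links as the procedure demands. -/
theorem outputCmd_wp (hp : 0 < p) (hm : 0 < m) (hN : ∀ i, N i ⊆ Finset.range m)
    (hA : s.var nA = p) (hO : s.var nO = m) (hl : IsMatchArray p N (s.arr ml) (s.arr mr))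
    (hal : ∀ t, s.arr al t = 0) (hsl : ∀ t, s.arr sl t = 0) (hB : 2 * (p + m) + 1 ≤ B) :
    outputCmd.wp B (fun t => ∃ a b k, IsLinkList p m (s.arr ml) (s.arr mr) a b k ∧
      t.raw 0 = max p m ∧ (∀ u < max p m, t.raw (1 + 2 * u) = b u ∧ t.raw (2 + 2 * u) = a u) ∧
      t.time ≤ s.time + 15 * (p + m) + 25) s := by
  have hml : ∀ i < p, s.arr ml i ≤ m := by
    intro i _
    rcases Nat.eq_zero_or_eq_succ_pred (s.arr ml i) with h | h
    · omega
    · have := Finset.mem_range.1 (hN i (hl.left _ _ h).2.1)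
      omega
  unfold outputCmd
  rw [Cmd.wp_seq]
  refine Cmd.wp_mono (Cmd.wp_frame (pairCmd_wp hA hml hal hsl)) ?_
  rintro s₁ ⟨⟨k, a0, a1, a2, a3, a4, a5, a6⟩, F1⟩
  rw [Cmd.wp_seq, Cmd.wp_set, Cmd.wp_seq]
  refine Cmd.wp_mono (Cmd.wp_frame (collectCmd_wp (h := nA) (f := ml) (g := al) (n := p) (k := k)
    (by decide) (by decide) (by decide) ?_ ?_)) ?_
  · simp [F1.var nA rfl, hA]
  · simp [a0]
  rintro s₂ ⟨⟨k₂, b1, b2, b3, b4, b5, b6⟩, F2⟩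
  rw [Cmd.wp_seq, Cmd.wp_set, Cmd.wp_seq]
  refine Cmd.wp_mono (Cmd.wp_frame (collectCmd_wp (h := nO) (f := mr) (g := sl) (n := m) (k := k)
    (by decide) (by decide) (by decide) ?_ ?_)) ?_
  · simp [F2.var nO rfl, F1.var nO rfl, hO]
  · simp [F2.var top rfl, a0]
  rintro s₃ ⟨⟨k₃, c1, c2, c3, c4, c5, c6⟩, F3⟩
  have e1 : s₁.arr ml = s.arr ml := F1.arr ml rfl
  have e2 : s₂.arr mr = s.arr mr := (F2.arr mr rfl).trans (F1.arr mr rfl)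
  have e3 : s₂.arr sl = s₁.arr sl := F2.arr sl rfl
  have e4 : s₃.arr al = s₂.arr al := F3.arr al rfl
  simp only [Env.setVar_arr] at b2 b3 b5 c2 c3 c5
  rw [e1] at b3 b5
  rw [e2] at c3 c5
  rw [e3] at c2
  refine Cmd.wp_mono (writeCmd_wp (p := p) (m := m) ?_ ?_ rfl rfl hB) ?_
  · rw [F3.var nA rfl]
    simp [F2.var nA rfl, F1.var nA rfl, hA]
  · rw [F3.var nO rfl]
    simp [F2.var nO rfl, F1.var nO rfl, hO]
  rintro s₄ ⟨d1, d2, d3⟩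
  refine ⟨_, _, k, ?_, d1, d2, ?_⟩
  · rw [e4]
    have hpair : ∀ t < k, s.arr ml (s₂.arr al t) =
        (if t + 1 = k then s₃.arr sl 0 else s₃.arr sl (t + 1)) + 1 := by
      intro t ht
      rw [b2 t (.inl ht), (a1 t ht).2]
      split_ifs with h
      · rw [c2 0 (.inl (by omega))]
      · rw [c2 (t + 1) (.inl (by omega))]
    -- Each position below `k` holds the sensor of an actuator, by which it is determined.
    have hmate : ∀ t < k, ∃ u < k, s.arr ml (s₂.arr al u) = s₃.arr sl t + 1 ∧
        t = if u + 1 = k then 0 else u + 1 := by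
      intro t ht
      rcases Nat.eq_zero_or_eq_succ_pred t with h | h
      · subst h
        refine ⟨k - 1, by omega, ?_, ?_⟩
        · rw [hpair _ (by omega), if_pos (by omega)]
        · rw [if_pos (by omega)]
      · refine ⟨t.pred, by omega, ?_, ?_⟩
        · rw [hpair _ (by omega), if_neg (by omega)]
          congr 2
          omega
        · rw [if_neg (by omega)]
          exact h
    have hleft : ∀ t < k, s₂.arr al t < p ∧ s.arr ml (s₂.arr al t) ≠ 0 := by
      intro t ht
      refine ⟨?_, by rw [hpair t ht]; omega⟩
      rw [b2 t (.inl ht)]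
      exact (a1 t ht).1
    have hlinj : ∀ u < k₂, ∀ u' < k₂, s₂.arr al u = s₂.arr al u' → u = u' := by
      intro u hu u' hu' h
      by_cases h1 : u < k <;> by_cases h2 : u' < k
      · rw [b2 u (.inl h1), b2 u' (.inl h2)] at h
        exact a2 u h1 u' h2 h
      · exact absurd (b3 u' (by omega) hu').2 (h ▸ (hleft u h1).2)
      · exact absurd (b3 u (by omega) hu).2 (h ▸ (hleft u' h2).2)
      · exact b4 u (by omega) hu u' (by omega) hu' h
    have hmatched : ∀ i < p, s.arr ml i ≠ 0 → ∃ t < k, s₂.arr al t = i := by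
      intro i hi hne
      obtain ⟨u, hu, hui⟩ := a3 i hi hne
      exact ⟨u, hu, by rw [b2 u (.inl hu), hui]⟩
    have hk₂ : k₂ = p := by
      refine eq_of_bijOn_range (f := s₂.arr al) ?_ hlinj ?_
      · intro u hu
        by_cases h1 : u < k
        · exact (hleft u h1).1
        · exact (b3 u (by omega) hu).1
      · intro i hi
        by_cases h1 : s.arr ml i = 0
        · obtain ⟨u, _, h2, h3⟩ := b5 i hi h1
          exact ⟨u, h2, h3⟩
        · obtain ⟨u, h2, h3⟩ := hmatched i hi h1
          exact ⟨u, by omega, h3⟩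
    have hright : ∀ t < k, s₃.arr sl t < m ∧
        ∃ u < k, s.arr mr (s₃.arr sl t) = s₂.arr al u + 1 ∧
          t = if u + 1 = k then 0 else u + 1 := by
      intro t ht
      obtain ⟨u, hu, h1, h2⟩ := hmate t ht
      obtain ⟨_, h3, h4⟩ := hl.left _ _ h1
      exact ⟨Finset.mem_range.1 (hN _ h3), u, hu, h4, h2⟩
    have hrinj : ∀ u < k₃, ∀ u' < k₃, s₃.arr sl u = s₃.arr sl u' → u = u' := by
      intro u hu u' hu' h
      by_cases h1 : u < k <;> by_cases h2 : u' < k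
      · obtain ⟨_, v, hv, g1, g2⟩ := hright u h1
        obtain ⟨_, v', hv', g1', g2'⟩ := hright u' h2
        rw [h] at g1
        have : v = v' := hlinj v (by omega) v' (by omega) (by omega)
        subst this
        rw [g2, g2']
      · obtain ⟨_, v, hv, g1, g2⟩ := hright u h1
        have := (c3 u' (by omega) hu').2
        rw [h] at g1
        omega
      · obtain ⟨_, v, hv, g1, g2⟩ := hright u' h2
        have := (c3 u (by omega) hu).2
        rw [← h] at g1
        omega
      · exact c4 u (by omega) hu u' (by omega) hu' h
    have hk₃ : k₃ = m := by
      refine eq_of_bijOn_range (f := s₃.arr sl) ?_ hrinj ?_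
      · intro u hu
        by_cases h1 : u < k
        · exact (hright u h1).1
        · exact (c3 u (by omega) hu).1
      · intro j hj
        rcases Nat.eq_zero_or_eq_succ_pred (s.arr mr j) with h1 | h1
        · obtain ⟨u, _, h2, h3⟩ := c5 j hj h1
          exact ⟨u, h2, h3⟩
        · have h2 := hl.right _ _ h1
          obtain ⟨u, hu, hui⟩ := hmatched _ (hl.left _ _ h2).1 (by omega)
          have h3 := hpair u hu
          rw [hui, h2] at h3
          split_ifs at h3 with h4
          · exact ⟨0, by omega, by omega⟩
          · exact ⟨u + 1, by omega, by omega⟩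
    subst hk₂ hk₃
    refine ⟨b1, hpair, ?_, ?_, hlinj, hrinj, fun t h h' => (b3 t h h').2,
      fun t h h' => (c3 t h h').2, b5, c5, hmatched⟩
    · intro t
      by_cases h1 : t < k
      · exact (hleft t h1).1
      · by_cases h2 : t < k₂
        · exact (b3 t (by omega) h2).1
        · rw [b2 t (.inr (by omega)), a4 t (by omega)]
          exact hp
    · intro t
      by_cases h1 : t < k
      · exact (hright t h1).1
      · by_cases h2 : t < k₃
        · exact (c3 t (by omega) h2).1
        · rw [c2 t (.inr (by omega))]
          have := a5 t
          omega
  · simp at b6 c6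
    omega

end Output

section Result

variable {n p m : ℕ} {N : ℕ → Finset ℕ} {l r a b : ℕ → ℕ} {k : ℕ}

theorem val_finRotate {k : ℕ} (t : Fin k) :
    (finRotate k t : ℕ) = if (t : ℕ) + 1 = k then 0 else (t : ℕ) + 1 := by
  cases k with
  | zero => exact t.elim0
  | succ k =>
    rw [finRotate_apply, Fin.val_add_one]
    simp [Fin.ext_iff]

/-- The link number `t`, as a pair of a sensor and an actuator. -/
def IsLinkList.link (h : IsLinkList p m l r a b k) (t : ℕ) : Fin m × Fin p :=
  (⟨b t, h.right_lt t⟩, ⟨a t, h.left_lt t⟩)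

/-- The matching described by an array of mates. -/
def arrayMatching (p m : ℕ) (l : ℕ → ℕ) : Finset (Fin p × Fin m) :=
  Finset.univ.filter fun e => l e.1 = (e.2 : ℕ) + 1

theorem mem_arrayMatching {e : Fin p × Fin m} :
    e ∈ arrayMatching p m l ↔ l e.1 = (e.2 : ℕ) + 1 := by
  simp [arrayMatching]

theorem leftMatched_arrayMatching (hN : ∀ i, N i ⊆ Finset.range m) (hl : IsMatchArray p N l r)
    (i : Fin p) : LeftMatched (arrayMatching p m l) i ↔ l i ≠ 0 := by
  constructor
  · rintro ⟨j, hj⟩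
    have := mem_arrayMatching.1 hj
    simp only at this
    omega
  · intro h
    obtain ⟨j, hj⟩ := Nat.exists_eq_succ_of_ne_zero h
    have := Finset.mem_range.1 (hN _ (hl.left _ _ hj).2.1)
    exact ⟨⟨j, this⟩, mem_arrayMatching.2 hj⟩

theorem rightMatched_arrayMatching (hl : IsMatchArray p N l r) (j : Fin m) :
    RightMatched (arrayMatching p m l) j ↔ r j ≠ 0 := by
  constructor
  · rintro ⟨i, hi⟩
    have := (hl.left _ _ (mem_arrayMatching.1 hi)).2.2
    simp only at this
    omega
  · intro h
    obtain ⟨i, hi⟩ := Nat.exists_eq_succ_of_ne_zero h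
    have h1 := hl.right _ _ hi
    exact ⟨⟨i, (hl.left _ _ h1).1⟩, mem_arrayMatching.2 h1⟩

theorem isMaxBipMatching_arrayMatching {R : Fin p → Fin m → Prop}
    (hR : ∀ i j, R i j ↔ (j : ℕ) ∈ N i) (hN : ∀ i, N i ⊆ Finset.range m)
    (hl : IsMatchArray p N l r)
    (hmax : ∀ M : Finset (ℕ × ℕ), IsBipMatching (fun i j => i < p ∧ j ∈ N i) M →
      M.card + (freeSet p l).card ≤ p) :
    IsMaxBipMatching R (arrayMatching p m l) := by
  refine ⟨⟨?_, ?_⟩, ?_⟩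
  · intro e he
    exact (hR _ _).2 (hl.left _ _ (mem_arrayMatching.1 he)).2.1
  · intro e he e' he' h
    rw [mem_arrayMatching] at he he'
    have h1 := (hl.left _ _ he).2.2
    have h2 := (hl.left _ _ he').2.2
    rcases h with h | h
    · rw [h] at he
      exact Prod.ext h (Fin.ext (by omega))
    · rw [h] at h1
      exact Prod.ext (Fin.ext (by omega)) h
  · intro M' hM'
    set f : Fin p × Fin m → ℕ × ℕ := fun e => (e.1, e.2) with hf
    have hinj : Function.Injective f := by
      intro e e' h
      simp only [hf, Prod.mk.injEq] at h
      exact Prod.ext (Fin.ext h.1) (Fin.ext h.2)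
    have h1 := hmax (M'.image f) (by
      refine ⟨?_, ?_⟩
      · intro x hx
        obtain ⟨e, he, rfl⟩ := Finset.mem_image.1 hx
        exact ⟨e.1.2, (hR _ _).1 (hM'.1 e he)⟩
      · intro x hx x' hx' h
        obtain ⟨e, he, rfl⟩ := Finset.mem_image.1 hx
        obtain ⟨e', he', rfl⟩ := Finset.mem_image.1 hx'
        rw [hM'.2 e he e' he' (h.imp (fun h => Fin.ext h) fun h => Fin.ext h)])
    rw [Finset.card_image_of_injective _ hinj] at h1
    have h2 : Finset.range p ⊆
        freeSet p l ∪ (arrayMatching p m l).image fun e => (e.1 : ℕ) := by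
      intro i hi
      have hi' := Finset.mem_range.1 hi
      by_cases h : l i = 0
      · exact Finset.mem_union_left _ (Finset.mem_filter.2 ⟨hi, h⟩)
      · obtain ⟨j, hj⟩ := (leftMatched_arrayMatching hN hl ⟨i, hi'⟩).2 h
        exact Finset.mem_union_right _ (Finset.mem_image.2 ⟨_, hj, rfl⟩)
    have h3 := (Finset.card_le_card h2).trans (Finset.card_union_le _ _)
    have h4 := Finset.card_image_le (s := arrayMatching p m l) (f := fun e => (e.1 : ℕ))
    rw [Finset.card_range] at h3
    omega

/-- The links from a list of links are a result of the procedure. -/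
theorem IsLinkList.isProcedureResult {A : Pattern n n} {bs : Fin p → Fin n} {cs : Fin m → Fin n}
    (h : IsLinkList p m l r a b k) (hR : ∀ i j, Reaches A bs cs i j ↔ (j : ℕ) ∈ N i)
    (hN : ∀ i, N i ⊆ Finset.range m) (hl : IsMatchArray p N l r)
    (hmax : ∀ M : Finset (ℕ × ℕ), IsBipMatching (fun i j => i < p ∧ j ∈ N i) M →
      M.card + (freeSet p l).card ≤ p) :
    IsProcedureResult A bs cs ((Finset.range (max p m)).image h.link) := by
  classical
  have hpair : ∀ t : Fin k, l (a t) = b (finRotate k t) + 1 := by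
    intro t
    rw [h.pair t t.2, val_finRotate]
    split_ifs <;> rfl
  refine ⟨arrayMatching p m l, (Finset.range k).image h.link,
    (Finset.range (max p m) \ Finset.range k).image h.link,
    isMaxBipMatching_arrayMatching hR hN hl hmax, ?_, ?_, ?_⟩
  · refine ⟨k, fun t => (⟨a t, h.left_lt t⟩, ⟨b (finRotate k t), h.right_lt _⟩), ?_, ?_, ?_⟩
    · intro t t' htt
      simp only [Prod.mk.injEq, Fin.mk.injEq] at htt
      exact Fin.ext (h.left_inj t (t.2.trans_le h.le_left) t' (t'.2.trans_le h.le_left) htt.1)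
    · ext e
      simp only [Finset.mem_image, Finset.mem_univ, true_and, mem_arrayMatching]
      constructor
      · rintro ⟨t, rfl⟩
        exact hpair t
      · intro he
        obtain ⟨t, ht, hta⟩ := h.matched_surj e.1 e.1.2 (by omega)
        refine ⟨⟨t, ht⟩, Prod.ext (Fin.ext hta) (Fin.ext ?_)⟩
        have := hpair ⟨t, ht⟩
        simp only [hta, he] at this
        simp only
        omega
    · ext e
      simp only [Finset.mem_image, Finset.mem_range, Finset.mem_univ, true_and]
      constructor
      · rintro ⟨t, ht, rfl⟩
        refine ⟨(finRotate k).symm ⟨t, ht⟩, ?_⟩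
        simp only [Equiv.apply_symm_apply, IsLinkList.link]
      · rintro ⟨t, rfl⟩
        exact ⟨finRotate k t, (finRotate k t).2, rfl⟩
  · have hmem : ∀ j i, (j, i) ∈ (Finset.range (max p m) \ Finset.range k).image h.link ↔
        ∃ t, k ≤ t ∧ t < max p m ∧ b t = j ∧ a t = i := by
      intro j i
      simp only [Finset.mem_image, Finset.mem_sdiff, Finset.mem_range, not_lt, IsLinkList.link,
        Prod.mk.injEq, Fin.ext_iff]
      constructor
      · rintro ⟨t, ⟨h1, h2⟩, h3, h4⟩
        exact ⟨t, h2, h1, h3, h4⟩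
      · rintro ⟨t, h1, h2, h3, h4⟩
        exact ⟨t, ⟨h2, h1⟩, h3, h4⟩
    unfold IsExtraLinks
    simp only [hmem, leftMatched_arrayMatching hN hl, rightMatched_arrayMatching hl, not_not]
    rcases Nat.lt_or_ge m p with hmp | hpm
    · refine Or.inr ⟨hmp, ?_, ?_, ?_⟩
      · intro i hi
        obtain ⟨t, h1, h2, h3⟩ := h.left_surj i i.2 hi
        refine ⟨⟨b t, h.right_lt t⟩, ⟨t, h1, by omega, rfl, h3⟩, ?_⟩
        rintro j ⟨t', h4, h5, h6, h7⟩
        have : t' = t := h.left_inj t' (by omega) t h2 (by omega)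
        exact Fin.ext (by simp only [← h6, this])
      · rintro j i ⟨t, h1, h2, _, h3⟩
        rw [← h3]
        exact h.left_extra t h1 (by omega)
      · intro j hj
        obtain ⟨t, h1, h2, h3⟩ := h.right_surj j j.2 hj
        exact ⟨⟨a t, h.left_lt t⟩, t, h1, by omega, h3, rfl⟩
    · refine Or.inl ⟨hpm, ?_, ?_, ?_⟩
      · intro j hj
        obtain ⟨t, h1, h2, h3⟩ := h.right_surj j j.2 hj
        refine ⟨⟨a t, h.left_lt t⟩, ⟨t, h1, by omega, h3, rfl⟩, ?_⟩
        rintro i ⟨t', h4, h5, h6, h7⟩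
        have : t' = t := h.right_inj t' (by omega) t h2 (by omega)
        exact Fin.ext (by simp only [← h7, this])
      · rintro j i ⟨t, h1, h2, h3, _⟩
        rw [← h3]
        exact h.right_extra t h1 (by omega)
      · intro i hi
        obtain ⟨t, h1, h2, h3⟩ := h.left_surj i i.2 hi
        exact ⟨⟨b t, h.right_lt t⟩, t, h1, by omega, rfl, h3⟩
  · rw [← Finset.image_union, Finset.union_sdiff_of_subset]
    exact Finset.range_subset_range.2 (h.le_left.trans (le_max_left p m))

/-- The memory holds the links of a list of links, which are distinct. -/
theorem IsLinkList.holdsLinks (h : IsLinkList p m l r a b k) {mem : ℕ → ℕ}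
    (h0 : mem 0 = max p m)
    (hmem : ∀ t < max p m, mem (1 + 2 * t) = b t ∧ mem (2 + 2 * t) = a t) :
    HoldsLinks mem ((Finset.range (max p m)).image h.link) := by
  refine ⟨(List.range (max p m)).map h.link, ?_, ?_, ?_, ?_⟩
  · refine List.Nodup.map_on ?_ List.nodup_range
    intro t ht t' ht' htt
    rw [List.mem_range] at ht ht'
    simp only [IsLinkList.link, Prod.mk.injEq, Fin.mk.injEq] at htt
    rcases Nat.lt_or_ge m p with hmp | hpm
    · exact h.left_inj t (by omega) t' (by omega) htt.2
    · exact h.right_inj t (by omega) t' (by omega) htt.1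
  · ext e
    simp
  · simpa using h0
  · intro t ht
    have ht' : t < max p m := by simpa using ht
    simpa [IsLinkList.link] using hmem t ht'

end Result

/-! ### The complete program -/

/-- The procedure as a structured program, run on the input from cell `0` on. -/
def mainCmd : Cmd := loadCmd ;; searchCmd ;; matchCmd ;; outputCmd

theorem InputData.senseSet_subset (d : InputData) (v : ℕ) : d.senseSet v ⊆ Finset.range d.m := by
  intro j hj
  obtain ⟨w, _, h⟩ := InputData.mem_senseSet.1 hj
  exact (Finset.mem_filter.1 h).1

theorem InputData.mem_adj {d : InputData} {v w : ℕ} :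
    w ∈ d.adj v ↔ ∃ k < d.e, d.src k = v ∧ d.dst k = w := by
  simp [InputData.adj, and_assoc]

theorem InputData.mem_own {d : InputData} {j w : ℕ} : j ∈ d.own w ↔ j < d.m ∧ d.cs j = w := by
  simp [InputData.own]

theorem mainCmd_wp (d : InputData) (hn : 0 < d.n) (hp : 0 < d.p) (hm : 0 < d.m) {x : List ℕ}
    (hraw : d.Holds fun i => x.getD i 0) {B : ℕ} (hB : B = 2 * (d.p + d.m + d.e) + 4) :
    mainCmd.wp B (fun t => ∃ l r a b k,
      IsMatchArray d.p (fun i => d.senseSet (d.bs i)) l r ∧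
      (∀ M : Finset (ℕ × ℕ),
        IsBipMatching (fun i j => i < d.p ∧ j ∈ d.senseSet (d.bs i)) M →
        M.card + (freeSet d.p l).card ≤ d.p) ∧
      IsLinkList d.p d.m l r a b k ∧ t.raw 0 = max d.p d.m ∧
      (∀ u < max d.p d.m, t.raw (1 + 2 * u) = b u ∧ t.raw (2 + 2 * u) = a u) ∧
      t.time ≤ 350 * (d.n + d.p + d.m + d.e + (d.p + d.m) ^ 2)) (Env.init x) := by
  have hN : ∀ i, d.senseSet (d.bs i) ⊆ Finset.range d.m := fun i => d.senseSet_subset _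
  unfold mainCmd
  rw [Cmd.wp_seq]
  refine Cmd.wp_mono (Cmd.wp_frame (loadCmd_wp (s := Env.init x) d hraw (by omega) (by omega)
    fun _ _ => rfl)) ?_
  rintro s₁ ⟨⟨a1, a2⟩, F1⟩
  rw [Cmd.wp_seq]
  refine Cmd.wp_mono (Cmd.wp_frame (searchCmd_wp a1 (F1.var seen rfl) (F1.var done rfl)
    (F1.var top rfl))) ?_
  rintro s₂ ⟨⟨b1, b2⟩, F2⟩
  rw [Cmd.wp_seq]
  have ht : MatchTables d.p d.m (fun i => d.senseSet (d.bs i)) s₂ := by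
    refine ⟨?_, ?_, ?_, ?_, b1⟩
    · rw [F2.var nA rfl, a1.nA]
    · rw [F2.var nO rfl, a1.nO]
    · intro i hi
      rw [F2.arr Arr.pow rfl, a1.pow i (by omega)]
    · intro i hi
      rw [F2.arr Arr.idx rfl, a1.idx i (by omega)]
  refine Cmd.wp_mono (Cmd.wp_frame (matchCmd_wp hN ht ?_ ?_)) ?_
  · intro i
    rw [F2.arr ml rfl, F1.arr ml rfl]
    rfl
  · intro i
    rw [F2.arr mr rfl, F1.arr mr rfl]
    rfl
  rintro s₃ ⟨⟨c1, c2, c3⟩, F3⟩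
  refine Cmd.wp_mono (outputCmd_wp hp hm hN ?_ ?_ c1 ?_ ?_ (by omega)) ?_
  · rw [F3.var nA rfl, ht.nA]
  · rw [F3.var nO rfl, ht.nO]
  · intro i
    rw [F3.arr al rfl, F2.arr al rfl, F1.arr al rfl]
    rfl
  · intro i
    rw [F3.arr sl rfl, F2.arr sl rfl, F1.arr sl rfl]
    rfl
  rintro s₄ ⟨a, b, k, d1, d2, d3, d4⟩
  refine ⟨_, _, a, b, k, c1, c2, d1, d2, d3, ?_⟩
  have h0 : (Env.init x).time = 0 := rfl
  rw [h0] at a2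
  have hq : (46 * (d.p + d.m) + 21) * (d.p + 1) ≤ 134 * (d.p + d.m) ^ 2 := by
    have h1 : 46 * (d.p + d.m) + 21 ≤ 67 * (d.p + d.m) := by omega
    have h2 : d.p + 1 ≤ 2 * (d.p + d.m) := by omega
    calc _ ≤ 67 * (d.p + d.m) * (2 * (d.p + d.m)) := Nat.mul_le_mul h1 h2
      _ = 134 * (d.p + d.m) ^ 2 := by ring
  omega

section Encoding

variable {n p m : ℕ}

/-- The input of the procedure for a system. -/
def InputData.ofSystem (E : List (Fin n × Fin n)) (b : Fin p → Fin n) (c : Fin m → Fin n) :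
    InputData where
  n := n
  p := p
  m := m
  e := E.length
  src k := if h : k < E.length then (E[k].1 : ℕ) else 0
  dst k := if h : k < E.length then (E[k].2 : ℕ) else 0
  bs i := if h : i < p then (b ⟨i, h⟩ : ℕ) else 0
  cs j := if h : j < m then (c ⟨j, h⟩ : ℕ) else 0
  src_lt k hk := by simp [hk]
  dst_lt k hk := by simp [hk]
  bs_lt i hi := by simp [hi]

theorem length_flatMap_pair (E : List (Fin n × Fin n)) :
    (E.flatMap fun e => [(e.1 : ℕ), (e.2 : ℕ)]).length = 2 * E.length := by
  induction E with
  | nil => rfl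
  | cons e E ih =>
    rw [List.flatMap_cons, List.length_append, ih]
    simp
    omega

theorem getD_flatMap_pair (E : List (Fin n × Fin n)) (k : ℕ) (hk : k < E.length) :
    (E.flatMap fun e => [(e.1 : ℕ), (e.2 : ℕ)]).getD (2 * k) 0 = E[k].1 ∧
      (E.flatMap fun e => [(e.1 : ℕ), (e.2 : ℕ)]).getD (2 * k + 1) 0 = E[k].2 := by
  induction E generalizing k with
  | nil => simp at hk
  | cons e E ih =>
    cases k with
    | zero => simp
    | succ k =>
      have := ih k (by simpa using hk)
      have e1 : 2 * (k + 1) = 2 * k + 1 + 1 := by ring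
      simpa [e1] using this

theorem InputData.holds_encodeInput (E : List (Fin n × Fin n)) (b : Fin p → Fin n)
    (c : Fin m → Fin n) :
    (InputData.ofSystem E b c).Holds fun i => (encodeInput E b c).getD i 0 := by
  have hlen := length_flatMap_pair E
  have h4 : ∀ k, (encodeInput E b c).getD (4 + k) 0 =
      (E.flatMap (fun e => [(e.1 : ℕ), (e.2 : ℕ)]) ++ List.ofFn (fun i => (b i : ℕ)) ++
        List.ofFn (fun j => (c j : ℕ))).getD k 0 := by
    intro k
    unfold encodeInput
    rw [List.append_assoc, List.append_assoc, List.getD_append_right _ _ _ _ (by simp)]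
    simp
  refine ⟨rfl, rfl, rfl, rfl, ?_, ?_, ?_, ?_⟩
  · intro k hk
    change k < E.length at hk
    simp only [h4, List.append_assoc]
    rw [List.getD_append _ _ _ _ (by omega), (getD_flatMap_pair E k hk).1]
    simp [InputData.ofSystem, hk]
  · intro k hk
    change k < E.length at hk
    simp only [Nat.add_assoc, h4, List.append_assoc]
    rw [List.getD_append _ _ _ _ (by omega), (getD_flatMap_pair E k hk).2]
    simp [InputData.ofSystem, hk]
  · intro k hk
    change k < p at hk
    change (encodeInput E b c).getD (4 + 2 * E.length + k) 0 = _
    rw [Nat.add_assoc, h4, List.append_assoc, List.getD_append_right _ _ _ _ (by omega), hlen,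
      Nat.add_sub_cancel_left, List.getD_append _ _ _ _ (by simpa using hk)]
    simp [InputData.ofSystem, hk]
  · intro k hk
    change k < m at hk
    change (encodeInput E b c).getD (4 + 2 * E.length + p + k) 0 = _
    rw [Nat.add_assoc, Nat.add_assoc, h4, List.append_assoc,
      List.getD_append_right _ _ _ _ (by omega), hlen,
      Nat.add_sub_cancel_left, List.getD_append_right _ _ _ _ (by simp)]
    simp [InputData.ofSystem, hk]

theorem length_encodeInput (E : List (Fin n × Fin n)) (b : Fin p → Fin n) (c : Fin m → Fin n) :
    (encodeInput E b c).length = 4 + 2 * E.length + p + m := by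
  unfold encodeInput
  rw [List.length_append, List.length_append, List.length_append, length_flatMap_pair]
  simp

theorem InputData.mem_adj_ofSystem {A : Pattern n n} {E : List (Fin n × Fin n)}
    (hE : IsEdgeList A E) {b : Fin p → Fin n} {c : Fin m → Fin n} {v w : ℕ} :
    w ∈ (InputData.ofSystem E b c).adj v ↔
      ∃ x y : Fin n, (x : ℕ) = v ∧ (y : ℕ) = w ∧ A y x = true := by
  simp only [InputData.mem_adj, InputData.ofSystem]
  constructor
  · rintro ⟨k, hk, h1, h2⟩
    simp only [hk, dif_pos] at h1 h2
    exact ⟨E[k].1, E[k].2, h1, h2, (hE.2 _ _).1 (List.getElem_mem hk)⟩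
  · rintro ⟨x, y, rfl, rfl, h⟩
    obtain ⟨k, hk, hkE⟩ := List.getElem_of_mem ((hE.2 x y).2 h)
    exact ⟨k, hk, by simp [hk, hkE], by simp [hk, hkE]⟩

theorem InputData.walk_ofSystem {A : Pattern n n} {E : List (Fin n × Fin n)}
    (hE : IsEdgeList A E) {b : Fin p → Fin n} {c : Fin m → Fin n} {x y : Fin n} :
    (InputData.ofSystem E b c).Walk x y ↔ StateReach A x y := by
  unfold InputData.Walk StateReach
  constructor
  · intro h
    have key : ∀ w, Relation.ReflTransGen (fun u v => v ∈ (InputData.ofSystem E b c).adj u) (x : ℕ) w →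
        ∃ z : Fin n, (z : ℕ) = w ∧ Relation.ReflTransGen (fun u v => A v u = true) x z := by
      intro w h
      induction h with
      | refl => exact ⟨x, rfl, .refl⟩
      | tail _ h2 ih =>
        obtain ⟨z, rfl, hz⟩ := ih
        obtain ⟨z', y', h3, h4, h5⟩ := (InputData.mem_adj_ofSystem hE).1 h2
        have : z' = z := Fin.ext h3
        subst this
        exact ⟨y', h4, hz.tail h5⟩
    obtain ⟨z, hz, h1⟩ := key y h
    have : z = y := Fin.ext hz
    exact this ▸ h1
  · intro h
    induction h with
    | refl => exact .refl
    | tail _ h2 ih => exact ih.tail ((InputData.mem_adj_ofSystem hE).2 ⟨_, _, rfl, rfl, h2⟩)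

theorem InputData.mem_senseSet_ofSystem {A : Pattern n n} {E : List (Fin n × Fin n)}
    (hE : IsEdgeList A E) {b : Fin p → Fin n} {c : Fin m → Fin n} (i : Fin p) (j : Fin m) :
    Reaches A b c i j ↔ (j : ℕ) ∈ (InputData.ofSystem E b c).senseSet
      ((InputData.ofSystem E b c).bs i) := by
  have hb : (InputData.ofSystem E b c).bs i = b i := by simp [InputData.ofSystem]
  have hc : ∀ w, (j : ℕ) ∈ (InputData.ofSystem E b c).own w ↔ (c j : ℕ) = w := by
    intro w
    simp [InputData.mem_own, InputData.ofSystem]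
  rw [reaches_iff, InputData.mem_senseSet, hb, ← InputData.walk_ofSystem hE (b := b) (c := c)]
  simp only [hc]
  constructor
  · exact fun h => ⟨_, h, rfl⟩
  · rintro ⟨w, h, rfl⟩
    exact h

theorem numVertices_eq (n p m : ℕ) : numVertices n p m = n + p + m := by
  simp [numVertices]
  omega

theorem IsEdgeList.length_le {A : Pattern n n} {E : List (Fin n × Fin n)} (hE : IsEdgeList A E)
    (B : Pattern n p) (C : Pattern m n) : E.length ≤ numEdges A B C := by
  classical
  have hinj : Function.Injective
      (fun e : Fin n × Fin n => ((Sum.inl e.1, Sum.inl e.2) : SysVertex n p m × SysVertex n p m)) := by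
    intro e e' h
    simp only [Prod.mk.injEq, Sum.inl.injEq] at h
    exact Prod.ext h.1 h.2
  rw [← List.toFinset_card_of_nodup hE.1, ← Finset.card_image_of_injective _ hinj,
    ← Set.ncard_coe_finset]
  refine Set.ncard_le_ncard ?_ (Set.toFinite _)
  intro e he
  obtain ⟨f, hf, rfl⟩ := Finset.mem_image.1 (Finset.mem_coe.1 he)
  exact (hE.2 _ _).1 (List.mem_toFinset.1 hf)

end Encoding

/-- The program runs within the time bound and outputs a result of the procedure. -/
theorem exists_program : ∃ (P : RamProgram) (κ : ℝ),
    ∀ (n p m : ℕ) (A : Pattern n n) (b : Fin p → Fin n) (c : Fin m → Fin n),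
      0 < n → IsMinActuation A b → IsMinSensing A c →
      ∀ E : List (Fin n × Fin n), IsEdgeList A E →
        ∃ T : ℕ,
          (T : ℝ) ≤ κ * max
            ((numVertices n p m : ℝ) + numEdges A (actuatorPattern b) (sensorPattern c))
            (((p : ℝ) + m) ^ ((5 : ℝ) / 2)) ∧
          (P.step^[T] (RamState.init (encodeInput E b c))).Halted P ∧
          ∃ L : Finset (Fin m × Fin p), IsProcedureResult A b c L ∧
            HoldsLinks (P.step^[T] (RamState.init (encodeInput E b c))).mem L := by
  refine ⟨mainCmd.program, prologue.length + 700 * mainCmd.len, ?_⟩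
  intro n p m A b c hn hA hC E hE
  -- As there is a state, there are an actuator that reaches it and a sensor that it reaches.
  obtain ⟨i₀, _⟩ := hA.reach ⟨0, hn⟩
  obtain ⟨j₀, _⟩ := hC.reach ⟨0, hn⟩
  have hp : 0 < p := i₀.pos
  have hm : 0 < m := j₀.pos
  set d := InputData.ofSystem E b c with hd
  have hraw := InputData.holds_encodeInput E b c
  have hlen := length_encodeInput E b c
  obtain ⟨T, t, ⟨l, r, a, b', k, h1, h2, h3, h4, h5, h6⟩, hT, hhalt, hmem⟩ :=
    mainCmd.program_correct (encodeInput E b c) (2 * (p + m + E.length) + 4)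
      (by rw [hraw.p, hraw.m, hraw.e]; rfl) (by omega) (mainCmd_wp d hn hp hm hraw rfl)
  change _ ≤ 350 * (n + p + m + E.length + (p + m) ^ 2) at h6
  refine ⟨T, ?_, hhalt, (Finset.range (max p m)).image h3.link, ?_, ?_⟩
  · set V := (numVertices n p m : ℝ) + numEdges A (actuatorPattern b) (sensorPattern c) with hV
    set W := ((p : ℝ) + m) ^ ((5 : ℝ) / 2) with hW
    have hV' : ((n + p + m + E.length : ℕ) : ℝ) ≤ V := by
      rw [hV, numVertices_eq]
      have : (E.length : ℝ) ≤ numEdges A (actuatorPattern b) (sensorPattern c) := by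
        exact_mod_cast hE.length_le (actuatorPattern b) (sensorPattern c)
      push_cast
      linarith
    -- As `1 ≤ p + m`, the quadratic time of the matching is within the bound.
    have hpm : (1 : ℝ) ≤ (p : ℝ) + m := by
      have : 1 ≤ p + m := by omega
      exact_mod_cast this
    have hW' : (((p + m) ^ 2 : ℕ) : ℝ) ≤ W := by
      rw [hW]
      push_cast
      rw [← Real.rpow_natCast]
      exact Real.rpow_le_rpow_of_exponent_le hpm (by norm_num)
    have h1V : (1 : ℝ) ≤ max V W := by
      refine le_trans ?_ ((le_max_left V W).trans' hV')
      exact_mod_cast (by omega : 1 ≤ n + p + m + E.length)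
    have ht : (t.time : ℝ) ≤ 700 * max V W := by
      have h7 : (t.time : ℝ) ≤ 350 * (((n + p + m + E.length : ℕ) : ℝ) + ((p + m) ^ 2 : ℕ)) := by
        exact_mod_cast h6
      have := le_max_left V W
      have := le_max_right V W
      linarith
    calc (T : ℝ) ≤ prologue.length + mainCmd.len * t.time := by exact_mod_cast hT
      _ ≤ prologue.length * max V W + mainCmd.len * (700 * max V W) := by
        gcongr
        exact le_mul_of_one_le_right (Nat.cast_nonneg _) h1V
      _ = _ := by ring
  · exact h3.isProcedureResult (fun i j => InputData.mem_senseSet_ofSystem hE i j)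
      (fun i => d.senseSet_subset _) h1 h2
  · refine h3.holdsLinks ?_ ?_
    · rw [hmem 0 (by omega), h4]
    · intro u hu
      have h7 := h5 u hu
      change u < max p m at hu
      have hu' : u < p + m := by omega
      rw [hmem _ (by omega), hmem _ (by omega)]
      exact h7

theorem lemma1 :
    (∀ (n p m : ℕ) (A : Pattern n n) (b : Fin p → Fin n) (c : Fin m → Fin n),
      0 < n → HasPerfectStateMatching A → IsMinActuation A b → IsMinSensing A c →
      ∀ L : Finset (Fin m × Fin p), IsProcedureResult A b c L →
        IsSparsestPattern A (actuatorPattern b) (sensorPattern c) (linkPattern L)) ∧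
    (∃ (P : RamProgram) (κ : ℝ),
      ∀ (n p m : ℕ) (A : Pattern n n) (b : Fin p → Fin n) (c : Fin m → Fin n),
        0 < n → HasPerfectStateMatching A → IsMinActuation A b → IsMinSensing A c →
        ∀ E : List (Fin n × Fin n), IsEdgeList A E →
          ∃ T : ℕ,
            (T : ℝ) ≤ κ * max
              ((numVertices n p m : ℝ) + numEdges A (actuatorPattern b) (sensorPattern c))
              (((p : ℝ) + m) ^ ((5 : ℝ) / 2)) ∧
            (P.step^[T] (RamState.init (encodeInput E b c))).Halted P ∧
            ∃ L : Finset (Fin m × Fin p), IsProcedureResult A b c L ∧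
              HoldsLinks (P.step^[T] (RamState.init (encodeInput E b c))).mem L) := by
  refine ⟨fun n p m A b c hn hA hb hc L h => h.isSparsestPattern hn hA hb hc, ?_⟩
  obtain ⟨P, κ, h⟩ := exists_program
  exact ⟨P, κ, fun n p m A b c hn _ hb hc => h n p m A b c hn hb hc⟩
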